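/- \textbf{Model.} There are $2p$ physical qubits, initially in a product of $p$ singlets $\frac1{\sqrt2}(|01\rangle-|10\rangle)$. The only quantum operations allowed are: the unitaries $X$ and $Z$ on a single physical qubit, and the $s/t$ measurement on a pair of distinct physical qubits (the projective measurement of singlet versus triplet, i.e. of the singlet state versus its orthogonal complement). A classical controller chooses each operation from what it has seen so far. \textbf{Gate set to be simulated.} Instructions on $n$ logical qubits: one- and two-qubit Clifford unitaries; measurements of one- and two-qubit Pauli operators; and the gate $T=\mathrm{diag}(1,e^{i\pi/4})$ on a single qubit. An adaptive circuit starts in $|0\rangle^{\otimes n}$, and each of its instructions may depend on the outcomes of the earlier measurements. \textbf{Simulators.} A simulator first prepares the logical register. It then receives the instructions of the circuit one at a time, finishing each one (and, for a measurement, reporting its outcome) before the next one is revealed. At any time, $n$ of the physical qubits are designated as the logical qubits. \textbf{Frames.} Singlets and all the allowed operations are invariant, up to phases, under the group $F$ of eight symmetries generated by complex conjugation $K$ and by applying the same Pauli operator to every qubit, $P^{\otimes}$ with $P\in\{I,X,Y,Z\}$. The basis labels of the logical qubits are therefore only meaningful up to a hidden, uniformly random element of $F$. The outcome probabilities of a circuit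 do not depend on this element. \textbf{Theorem.} There are constants $C,k\in\mathbb N$ such that for all $n,L,t\in\mathbb N$ and all $\delta\in(0,1)$, with $$B=C\Bigl(n+L+t\,\bigl(1+\log\tfrac1\delta\bigr)^k\Bigr),$$ there is a simulator with $p\le B$ that has the following properties for every adaptive circuit $c$ on $n$ qubits with at most $L$ instructions and at most $t$ gates $T$ along each branch. \begin{enumerate} \item The expected total number of operations ($X$, $Z$ and $s/t$) in the simulation of $c$ is at most $B$. \item Let $\tau\le t$ be the largest number of $T$ gates along a branch of $c$. Consider any test, given by effects $0\le E_h\le 1$ on $n$ qubits, that accepts with effect $E_h$ when the list of reported outcomes is $h$. Its acceptance probability on the outcomes and final logical state of the simulation differs by at most $\tau\delta$ from its acceptance probability on the outcomes and final state of the perfect circuit $c$, where a uniformly random element of $F$ is applied to the final state of the perfect circuit. \end{enumerate} In particular, Clifford unitaries and Pauli measurements are simulated exactly ($\tau=0$) with constant expected overhead, and each $T$ gate is simulated with error at most $\delta$ and with expected overhead polylogarithmic in $1/\delta$. -/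

import Mathlib

open Matrix Filter Topology
open scoped ComplexOrder

noncomputable section

/-! ## Qubit registers

A register of qubits labelled by `ι` has the computational basis `ι → Fin 2`. -/

/-- Pure, possibly unnormalised, states of the qubits labelled by `ι`. -/
abbrev QState (ι : Type) : Type := (ι → Fin 2) → ℂ

/-- Operators on the qubits labelled by `ι`. -/
abbrev QOp (ι : Type) : Type := Matrix (ι → Fin 2) (ι → Fin 2) ℂ

/-- The operator `A` acting on the qubits `e 0, e 1, …` (which are distinct), and the identity on
all the other qubits. -/
def onQubits {κ ι : Type} (e : κ ↪ ι) (A : QOp κ) : QOp ι :=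
  open Classical in
  Matrix.of fun x y => if ∀ q, q ∉ Set.range e → x q = y q then A (x ∘ e) (y ∘ e) else 0

/-- A single qubit as a one-qubit subregister. -/
def oneQubit {ι : Type} (i : ι) : Fin 1 ↪ ι := ⟨fun _ => i, fun _ _ _ => Subsingleton.elim _ _⟩

/-- An ordered pair of distinct qubits as a two-qubit subregister. -/
def twoQubits {ι : Type} (i j : ι) (h : i ≠ j) : Fin 2 ↪ ι :=
  ⟨![i, j], by
    intro a b hab
    fin_cases a <;> fin_cases b <;> simp_all⟩

/-- A `2 × 2` matrix as an operator on a one-qubit register. -/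
def oneQubitOp (A : Matrix (Fin 2) (Fin 2) ℂ) : QOp (Fin 1) := A.submatrix (fun x => x 0) (fun y => y 0)

/-- The squared norm of a state. -/
def weight {ι : Type} [Fintype ι] [DecidableEq ι] (ψ : QState ι) : ℝ := ∑ x, ‖ψ x‖ ^ 2

/-- The expectation `⟨ψ, E ψ⟩`. -/
def expect {ι : Type} [Fintype ι] [DecidableEq ι] (E : QOp ι) (ψ : QState ι) : ℝ :=
  (star ψ ⬝ᵥ (E *ᵥ ψ)).re

/-! ## Pauli operators, Clifford unitaries and the `T` gate -/

inductive Pauli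
  | I
  | X
  | Y
  | Z

def Pauli.mat : Pauli → Matrix (Fin 2) (Fin 2) ℂ
  | .I => 1
  | .X => !![0, 1; 1, 0]
  | .Y => !![0, -Complex.I; Complex.I, 0]
  | .Z => !![1, 0; 0, -1]

/-- The tensor product of the Pauli matrices `P q`. -/
def pauliString {κ : Type} [Fintype κ] (P : κ → Pauli) : QOp κ :=
  Matrix.of fun x y => ∏ q, (P q).mat (x q) (y q)

/-- `U` is a Clifford unitary: conjugation by `U` maps every tensor product of Pauli matrices to a
scalar multiple (which is then `1` or `-1`) of a tensor product of Pauli matrices. -/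
def IsClifford {κ : Type} [Fintype κ] [DecidableEq κ] (U : QOp κ) : Prop :=
  U ∈ Matrix.unitaryGroup (κ → Fin 2) ℂ ∧
    ∀ P : κ → Pauli, ∃ (Q : κ → Pauli) (c : ℂ), U * pauliString P * Uᴴ = c • pauliString Q

/-- The `T` gate `diag (1, exp (i π / 4))`. -/
def tMat : Matrix (Fin 2) (Fin 2) ℂ := !![1, 0; 0, Complex.exp (Complex.I * (Real.pi / 4 : ℝ))]

/-! ## The gate set to be simulated, and adaptive circuits over it -/

/-- Instructions on `n` qubits: a Clifford unitary on one or two qubits, the measurement of a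
tensor product of Pauli matrices on one or two qubits, or a `T` gate on one qubit. -/
inductive Instr (n : ℕ)
  | clifford (k : ℕ) (hk : k = 1 ∨ k = 2) (U : QOp (Fin k)) (hU : IsClifford U)
      (e : Fin k ↪ Fin n)
  | measure (k : ℕ) (hk : k = 1 ∨ k = 2) (P : Fin k → Pauli) (e : Fin k ↪ Fin n)
  | t (i : Fin n)

/-- The operator by which an instruction acts when its outcome bit is `b`.  A measurement reports
`false` for the eigenvalue `1` and `true` for the eigenvalue `-1`; a unitary gate always
reports `false`. -/
def Instr.kraus {n : ℕ} : Instr n → Bool → QOp (Fin n)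
  | .clifford _ _ U _ e, false => onQubits e U
  | .clifford _ _ _ _ _, true => 0
  | .measure _ _ P e, false => (1 / 2 : ℂ) • (1 + onQubits e (pauliString P))
  | .measure _ _ P e, true => (1 / 2 : ℂ) • (1 - onQubits e (pauliString P))
  | .t i, false => onQubits (oneQubit i) (oneQubitOp tMat)
  | .t _, true => 0

/-- `1` for a `T` gate and `0` for the other instructions. -/
def Instr.tCost {n : ℕ} : Instr n → ℕ
  | .t _ => 1
  | _ => 0

/-- An adaptive circuit: each instruction may depend on the outcomes of the previous ones. -/
inductive Circuit (n : ℕ)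
  | halt
  | step (g : Instr n) (next : Bool → Circuit n)

/-- The largest number of instructions along a branch. -/
def Circuit.depth {n : ℕ} : Circuit n → ℕ
  | .halt => 0
  | .step _ next => 1 + max (next false).depth (next true).depth

/-- The largest number of `T` gates along a branch. -/
def Circuit.tCount {n : ℕ} : Circuit n → ℕ
  | .halt => 0
  | .step g next => g.tCost + max (next false).tCount (next true).tCount

/-- The basis state `|0…0⟩`. -/
def zeroState (n : ℕ) : QState (Fin n) := fun x => if x = 0 then 1 else 0

/-- The eight symmetries of the operations that are available to the simulation: complex
conjugation (if `conj` is true), followed by the same Pauli matrix `P` on every qubit. -/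
def inFrame {n : ℕ} (P : Pauli) (conj : Bool) (ψ : QState (Fin n)) : QState (Fin n) :=
  pauliString (fun _ => P) *ᵥ (if conj then star ψ else ψ)

/-- The expectation of `E` when a uniformly random one of the eight symmetries is applied
to `ψ`. -/
def frameExpect {n : ℕ} (E : QOp (Fin n)) (ψ : QState (Fin n)) : ℝ :=
  (1 / 8) * ∑ conj : Bool,
    (expect E (inFrame .I conj ψ) + expect E (inFrame .X conj ψ) +
      expect E (inFrame .Y conj ψ) + expect E (inFrame .Z conj ψ))

/-- A test of the list of all outcome bits together with the final state: when the outcomes are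
`h`, it accepts with the effect `E h`, where `0 ≤ E h ≤ 1`. -/
structure Test (n : ℕ) where
  effect : List Bool → QOp (Fin n)
  nonneg : ∀ h, (effect h).PosSemidef
  le_one : ∀ h, (1 - effect h).PosSemidef

/-- The acceptance probability when the circuit is run, with perfect gates, from the state `ψ`
after the outcomes `h`, in a uniformly random frame. -/
def Circuit.accept {n : ℕ} (E : Test n) : Circuit n → List Bool → QState (Fin n) → ℝ
  | .halt, h, ψ => frameExpect (E.effect h) ψ
  | .step g next, h, ψ =>
      (next false).accept E (h ++ [false]) (g.kraus false *ᵥ ψ) +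
        (next true).accept E (h ++ [true]) (g.kraus true *ᵥ ψ)

/-- The acceptance probability of the perfect circuit, started in `|0…0⟩`. -/
def Circuit.idealAccept {n : ℕ} (c : Circuit n) (E : Test n) : ℝ := c.accept E [] (zeroState n)

/-! ## Simulation by singlet/triplet measurements and the unitaries `X` and `Z` -/

/-- The singlet state `(|01⟩ - |10⟩) / √2` of two qubits. -/
def singlet : QState (Fin 2) := fun x =>
  if x = ![0, 1] then 1 / (Real.sqrt 2 : ℂ) else if x = ![1, 0] then -(1 / (Real.sqrt 2 : ℂ)) else 0

/-- The projection onto the singlet. -/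
def singletProj : QOp (Fin 2) := Matrix.vecMulVec singlet (star singlet)

/-- The projection onto the triplet subspace, the orthogonal complement of the singlet. -/
def tripletProj : QOp (Fin 2) := 1 - singletProj

/-- The `2 * p` physical qubits: `p` pairs. -/
abbrev Phys (p : ℕ) : Type := Fin p × Fin 2

/-- The product of `p` singlets, one on each pair. -/
def singletsState (p : ℕ) : QState (Phys p) := fun x => ∏ a, singlet fun b => x (a, b)

/-- What the classical controller with memory `σ` can do next: apply `X` or `Z` to a physical
qubit, measure singlet/triplet on two distinct qubits and continue according to the outcome
(`true` for the singlet), or declare the current task finished and report a bit. -/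
inductive Move (p : ℕ) (σ : Type)
  | x (i : Phys p) (s : σ)
  | z (i : Phys p) (s : σ)
  | st (i j : Phys p) (hij : i ≠ j) (next : Bool → σ)
  | done (b : Bool) (s : σ)

/-- A simulator of `n` logical qubits on `2 * p` physical ones.  Its first task, from the memory
`init`, is to prepare the logical register; afterwards it receives the instructions
one at a time (`load`) and has to finish each of them before it gets to see the next one.
`loc` tells which physical qubits currently hold the logical ones. -/
structure Simulator (n p : ℕ) (σ : Type) where
  init : σ
  load : Instr n → σ → σ
  move : σ → Move p σ
  loc : σ → (Fin n ↪ Phys p)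

namespace Simulator

variable {n p : ℕ} {σ : Type}

/-- The probability that, within `K` moves, the run ends and the test accepts; `next b` is the
rest of the circuit and the list of outcomes so far, should the current task report `b`. -/
def acceptFrom (S : Simulator n p σ) (E : Test n) :
    ℕ → (Bool → Circuit n × List Bool) → σ → QState (Phys p) → ℝ
  | 0, _, _, _ => 0
  | K + 1, next, s, ψ =>
    match S.move s with
    | .x i s' => S.acceptFrom E K next s' (onQubits (oneQubit i) (oneQubitOp Pauli.X.mat) *ᵥ ψ)
    | .z i s' => S.acceptFrom E K next s' (onQubits (oneQubit i) (oneQubitOp Pauli.Z.mat) *ᵥ ψ)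
    | .st i j hij s' =>
        S.acceptFrom E K next (s' true) (onQubits (twoQubits i j hij) singletProj *ᵥ ψ) +
          S.acceptFrom E K next (s' false) (onQubits (twoQubits i j hij) tripletProj *ᵥ ψ)
    | .done b s' =>
      match next b with
      | (.halt, h) => expect (onQubits (S.loc s') (E.effect h)) ψ
      | (.step g c, h) => S.acceptFrom E K (fun b' => (c b', h ++ [b'])) (S.load g s') ψ

/-- The expected number of operations (`X`, `Z` and singlet/triplet measurements) among the first
`K` moves; the arguments are those of `acceptFrom`. -/
def opsFrom (S : Simulator n p σ) : ℕ → (Bool → Circuit n) → σ → QState (Phys p) → ℝ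
  | 0, _, _, _ => 0
  | K + 1, next, s, ψ =>
    match S.move s with
    | .x i s' =>
        weight ψ + S.opsFrom K next s' (onQubits (oneQubit i) (oneQubitOp Pauli.X.mat) *ᵥ ψ)
    | .z i s' =>
        weight ψ + S.opsFrom K next s' (onQubits (oneQubit i) (oneQubitOp Pauli.Z.mat) *ᵥ ψ)
    | .st i j hij s' =>
        weight ψ +
          (S.opsFrom K next (s' true) (onQubits (twoQubits i j hij) singletProj *ᵥ ψ) +
            S.opsFrom K next (s' false) (onQubits (twoQubits i j hij) tripletProj *ᵥ ψ))
    | .done b s' =>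
      match next b with
      | .halt => 0
      | .step g c => S.opsFrom K c (S.load g s') ψ

/-- The probability that the simulation of `c`, started from singlets, ends within `K` moves
and the test accepts. -/
def accept (S : Simulator n p σ) (c : Circuit n) (E : Test n) (K : ℕ) : ℝ :=
  S.acceptFrom E K (fun _ => (c, [])) S.init (singletsState p)

/-- The expected number of operations among the first `K` moves of the simulation of `c`, started
from singlets. -/
def expectedOps (S : Simulator n p σ) (c : Circuit n) (K : ℕ) : ℝ :=
  S.opsFrom K (fun _ => c) S.init (singletsState p)

end Simulator

end

noncomputable section

set_option linter.unusedSectionVars false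

/-! ## Operators on subregisters -/

section Registers

variable {κ κ' ι : Type} [Fintype κ] [DecidableEq κ] [Fintype κ'] [DecidableEq κ']
  [Fintype ι] [DecidableEq ι]

/-! Everything rests on one measurement, that of `P ⊗ P` on two qubits for a Pauli matrix `P ≠ 1`.
The singlet and its image under `P` on one qubit span the eigenspace of `P ⊗ P` with eigenvalue -1.
Hence, if one takes one qubit from each of two singlets and finds this pair in neither of these two
Bell states, the two singlets have been projected to the eigenvalue 1 (`cat_le`). If one of the Bell
states is found, entanglement swapping restores the two singlets and the attempt is repeated.
Sending two given qubits through this resource and back by Bell measurements turns its correlation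
into a measurement of the given qubits and leaves the two singlets for reuse (`pairMeas_le`). The
algebra behind these steps is the relation `e f e = e / 4` for singlet projections on overlapping
pairs (`sg_sg_sg`).

A reference qubit in an eigenstate of `P` turns this into a measurement of `P` on a single qubit
(`meas_le`). Measurements with an ancilla in a known eigenstate, followed by the erasure of the
ancilla, give the rotations `(1 - i R) / √2` (`rot_le`) and a controlled gate (`ctl_le`), and
conjugation by the latter extends rotations and measurements to strings on two qubits. Every
Clifford unitary on at most two qubits is, up to a phase, a Pauli string followed by at most eight
rotations (`IsClifford.isWord`): rotations return the images of the generators `Z` and `X` of each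
qubit to their places, and a unitary that fixes all generators up to sign is a Pauli string up to a
phase.

The available operations cannot single out an eigenstate of `P`, which is where frames enter. The
partners of the reference qubits are never touched. The eigenvalues of `X`, `Y`, `Z` on three of
them split the initial singlets into eight sectors that no operation mixes and that the group `F`
permutes simply transitively. In one sector the reference qubits are as desired; the others are its
images, which is precisely a uniformly random hidden frame (`eq_frameSum_sector`, `startState_mem`).

For the `T` gate, triplet projections on two copies of `|0⟩ + r |1⟩`, with postselected
measurements, produce `|0⟩ + (1 / r + r / 2) |1⟩`, one Newton step towards `√2` (`newton_le`). A
last step converts the ratio `√2` into the angle `π / 8` (`magicStep_le`). Convergence is quadratic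
while the expected cost grows by a bounded factor per step, so `m` steps cost `O(64 ^ m)`
(`prep_le`, `magic_le`) for an error of at most `(1 / 2) ^ 2 ^ m` (`errSin_sq_le`), which is
polylogarithmic. The gadget that consumes the magic state errs by an angle whose sign is random with
equal probabilities; the cross terms cancel on average, so that the gate is perfect except for an
additional `Z` with probability `errSin m ^ 2` (`tProg_le`, `compile_le`).

The bookkeeping is uniform: each program is analysed once, for an arbitrary `Val`, in unnormalised
states. The instances are the expected number of operations at a fixed cutoff, the acceptance
probability and its negative, which together bound the acceptance probability from both sides, and
the negative weight, which controls the weights of intermediate states. Loops are handled by solving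
a linear inequality (`loop_le`). Induction on the circuit then gives `circuitLim_bounds` and
`circuitOps_le`. -/

lemma extend_comp_self (e : κ ↪ ι) (u : κ → Fin 2) (x : ι → Fin 2) :
    Function.extend e u x ∘ e = u := by
  funext k; simp [e.injective.extend_apply]

/-- Only those basis states contribute that agree with `x` outside the range of `e`, and these are
the functions `Function.extend e u x`. The rules for products, embeddings and commutation then
become facts about overwriting coordinates. -/
lemma onQubits_mulVec (e : κ ↪ ι) (A : QOp κ) (ψ : QState ι) (x : ι → Fin 2) :
    (onQubits e A *ᵥ ψ) x = ∑ u, A (x ∘ e) u * ψ (Function.extend e u x) := by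
  classical
  symm
  rw [mulVec, dotProduct]
  refine Finset.sum_of_injOn (fun u => Function.extend e u x) ?_ (by simp) ?_ ?_
  · intro u _ v _ h
    have := congrArg (· ∘ e) h
    simpa [extend_comp_self] using this
  · intro y _ hy
    simp only [onQubits, of_apply]
    rw [if_neg, zero_mul]
    intro h
    refine hy ⟨y ∘ e, by simp, ?_⟩
    funext q
    change Function.extend e (y ∘ e) x q = y q
    by_cases hq : q ∈ Set.range e
    · obtain ⟨k, rfl⟩ := hq
      simp [e.injective.extend_apply]
    · rw [Function.extend_apply' _ _ _ (by simpa using hq), h q hq]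
  · intro u _
    simp only [onQubits, of_apply]
    rw [if_pos, extend_comp_self]
    intro q hq
    rw [Function.extend_apply' _ _ _ (by simpa using hq)]

lemma op_ext {A B : QOp ι} (h : ∀ ψ, A *ᵥ ψ = B *ᵥ ψ) : A = B :=
  Matrix.ext_of_mulVec_single fun _ => h _

lemma onQubits_mul (e : κ ↪ ι) (A B : QOp κ) :
    onQubits e (A * B) = onQubits e A * onQubits e B := by
  refine op_ext fun ψ => ?_
  rw [← mulVec_mulVec]
  funext x
  have hext : ∀ u v : κ → Fin 2, Function.extend e v (Function.extend e u x) =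
      Function.extend e v x := by
    intro u v; funext q
    by_cases hq : ∃ k, e k = q
    · obtain ⟨k, rfl⟩ := hq; simp [e.injective.extend_apply]
    · simp [Function.extend_apply' _ _ _ hq]
  simp only [onQubits_mulVec, extend_comp_self, hext, Matrix.mul_apply, Finset.mul_sum,
    Finset.sum_mul]
  rw [Finset.sum_comm]
  simp only [mul_assoc]

lemma onQubits_one (e : κ ↪ ι) : onQubits e (1 : QOp κ) = 1 := by
  refine op_ext fun ψ => ?_
  funext x
  rw [onQubits_mulVec, one_mulVec, Finset.sum_eq_single (x ∘ e)]
  · rw [one_apply_eq, one_mul]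
    congr 1
    funext q
    by_cases hq : ∃ k, e k = q
    · obtain ⟨k, rfl⟩ := hq; simp [e.injective.extend_apply]
    · simp [Function.extend_apply' _ _ _ hq]
  · intro u _ hu; rw [one_apply_ne (Ne.symm hu), zero_mul]
  · simp

lemma onQubits_add (e : κ ↪ ι) (A B : QOp κ) :
    onQubits e (A + B) = onQubits e A + onQubits e B := by
  ext x y; simp only [onQubits, of_apply, Matrix.add_apply]; split_ifs <;> simp

lemma onQubits_smul (e : κ ↪ ι) (c : ℂ) (A : QOp κ) :
    onQubits e (c • A) = c • onQubits e A := by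
  ext x y; simp only [onQubits, of_apply, Matrix.smul_apply]; split_ifs <;> simp

lemma onQubits_zero (e : κ ↪ ι) : onQubits e (0 : QOp κ) = 0 := by
  ext x y; simp [onQubits]

lemma onQubits_sub (e : κ ↪ ι) (A B : QOp κ) :
    onQubits e (A - B) = onQubits e A - onQubits e B := by
  ext x y; simp only [onQubits, of_apply, Matrix.sub_apply]; split_ifs <;> simp

lemma onQubits_conjTranspose (e : κ ↪ ι) (A : QOp κ) :
    (onQubits e A)ᴴ = onQubits e Aᴴ := by
  ext x y
  simp only [onQubits, of_apply, Matrix.conjTranspose_apply]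
  by_cases h : ∀ q ∉ Set.range e, x q = y q
  · rw [if_pos h, if_pos fun q hq => (h q hq).symm]
  · rw [if_neg h, if_neg fun h' => h fun q hq => (h' q hq).symm, star_zero]

lemma onQubits_trans (e : κ ↪ κ') (f : κ' ↪ ι) (A : QOp κ) :
    onQubits f (onQubits e A) = onQubits (e.trans f) A := by
  refine op_ext fun ψ => ?_
  funext x
  have h := onQubits_mulVec e A (fun u => ψ (Function.extend f u x)) (x ∘ f)
  rw [onQubits_mulVec, onQubits_mulVec]
  rw [mulVec, dotProduct] at h
  rw [h]
  refine Finset.sum_congr rfl fun u _ => ?_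
  congr 2
  funext q
  by_cases hq : ∃ k, f k = q
  · obtain ⟨k, rfl⟩ := hq
    rw [f.injective.extend_apply]
    by_cases hk : ∃ j, e j = k
    · obtain ⟨j, rfl⟩ := hk
      rw [e.injective.extend_apply]
      exact ((e.trans f).injective.extend_apply u x j).symm
    · rw [Function.extend_apply' _ _ _ hk, Function.extend_apply', Function.comp]
      rintro ⟨j, hj⟩
      exact hk ⟨j, f.injective hj⟩
  · rw [Function.extend_apply' _ _ _ hq, Function.extend_apply']
    rintro ⟨j, hj⟩
    exact hq ⟨e j, hj⟩

/-- Disjoint sets of coordinates can be overwritten in either order, so the two sums may be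
exchanged. -/
lemma onQubits_comm (e : κ ↪ ι) (f : κ' ↪ ι) (h : ∀ j k, e j ≠ f k) (A : QOp κ) (B : QOp κ') :
    onQubits e A * onQubits f B = onQubits f B * onQubits e A := by
  refine op_ext fun ψ => ?_
  rw [← mulVec_mulVec, ← mulVec_mulVec]
  funext x
  have h1 : ∀ u, Function.extend e u x ∘ f = x ∘ f := by
    intro u; funext k
    exact Function.extend_apply' _ _ _ (by rintro ⟨j, hj⟩; exact h j k hj)
  have h2 : ∀ u, Function.extend f u x ∘ e = x ∘ e := by
    intro u; funext k
    exact Function.extend_apply' _ _ _ (by rintro ⟨j, hj⟩; exact h k j hj.symm)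
  have h3 : ∀ u v, Function.extend f v (Function.extend e u x) =
      Function.extend e u (Function.extend f v x) := by
    intro u v; funext q
    by_cases hq : ∃ k, f k = q
    · obtain ⟨k, rfl⟩ := hq
      rw [f.injective.extend_apply, Function.extend_apply', f.injective.extend_apply]
      rintro ⟨j, hj⟩; exact h j k hj
    · rw [Function.extend_apply' _ _ _ hq]
      by_cases hq' : ∃ k, e k = q
      · obtain ⟨k, rfl⟩ := hq'
        simp only [e.injective.extend_apply]
      · rw [Function.extend_apply' _ _ _ hq', Function.extend_apply' _ _ _ hq',
          Function.extend_apply' _ _ _ hq]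
  simp only [onQubits_mulVec, h1, h2, h3, Finset.mul_sum]
  rw [Finset.sum_comm]
  refine Finset.sum_congr rfl fun u _ => Finset.sum_congr rfl fun v _ => ?_
  ring

end Registers

/-! ## Pauli operators -/

instance : DecidableEq Pauli := fun a b => by
  cases a <;> cases b <;>
    first
      | exact isTrue rfl
      | exact isFalse (by intro h; cases h)

instance : Fintype Pauli := ⟨{.I, .X, .Y, .Z}, by intro P; cases P <;> simp⟩

lemma Pauli.sum_univ {M : Type*} [AddCommMonoid M] (f : Pauli → M) :
    ∑ P, f P = f .I + f .X + f .Y + f .Z := by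
  have : (Finset.univ : Finset Pauli) = {.I, .X, .Y, .Z} := rfl
  rw [this]
  simp [add_assoc]

/-- The product of two Pauli matrices, up to the phase. -/
def Pauli.mul : Pauli → Pauli → Pauli
  | .I, Q => Q
  | P, .I => P
  | .X, .X => .I
  | .X, .Y => .Z
  | .X, .Z => .Y
  | .Y, .X => .Z
  | .Y, .Y => .I
  | .Y, .Z => .X
  | .Z, .X => .Y
  | .Z, .Y => .X
  | .Z, .Z => .I

/-- The phase in the product of two Pauli matrices. -/
def Pauli.phase : Pauli → Pauli → ℂ
  | .X, .Y => Complex.I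
  | .X, .Z => -Complex.I
  | .Y, .X => -Complex.I
  | .Y, .Z => Complex.I
  | .Z, .X => Complex.I
  | .Z, .Y => -Complex.I
  | _, _ => 1

/-- Whether two Pauli matrices anticommute. -/
def Pauli.anti (P Q : Pauli) : Bool := P ≠ .I && Q ≠ .I && P ≠ Q

/-- The sign `-1` for `true` and `1` for `false`. -/
def bsign (b : Bool) : ℂ := if b then -1 else 1

@[simp] lemma bsign_true : bsign true = -1 := rfl
@[simp] lemma bsign_false : bsign false = 1 := rfl
@[simp] lemma norm_bsign (b : Bool) : ‖bsign b‖ = 1 := by cases b <;> simp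
@[simp] lemma bsign_mul_self (b : Bool) : bsign b * bsign b = 1 := by cases b <;> simp
lemma bsign_xor (a b : Bool) : bsign (a ^^ b) = bsign a * bsign b := by cases a <;> cases b <;> simp
@[simp] lemma bsign_not (b : Bool) : bsign (!b) = -bsign b := by cases b <;> simp

lemma Pauli.mat_mul (P Q : Pauli) : P.mat * Q.mat = P.phase Q • (P.mul Q).mat := by
  cases P <;> cases Q <;> ext i j <;> fin_cases i <;> fin_cases j <;>
    simp [Pauli.mat, Pauli.phase, Pauli.mul]

lemma Pauli.norm_phase (P Q : Pauli) : ‖P.phase Q‖ = 1 := by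
  cases P <;> cases Q <;> simp [Pauli.phase]

lemma Pauli.mul_comm (P Q : Pauli) : P.mul Q = Q.mul P := by cases P <;> cases Q <;> rfl

lemma Pauli.phase_comm (P Q : Pauli) : P.phase Q = bsign (P.anti Q) * Q.phase P := by
  cases P <;> cases Q <;> simp [Pauli.phase, Pauli.anti, bsign]

lemma Pauli.mat_conjTranspose (P : Pauli) : (P.mat)ᴴ = P.mat := by
  cases P <;> ext i j <;> fin_cases i <;> fin_cases j <;> simp [Pauli.mat]

lemma oneQubitOp_mul (A B : Matrix (Fin 2) (Fin 2) ℂ) :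
    oneQubitOp (A * B) = oneQubitOp A * oneQubitOp B := by
  ext x y
  simp only [oneQubitOp, submatrix_apply, mul_apply]
  refine (Equiv.sum_comp (Equiv.funUnique (Fin 1) (Fin 2))
    (fun j => A (x 0) j * B j (y 0))).symm.trans ?_
  rfl

lemma oneQubitOp_smul (c : ℂ) (A : Matrix (Fin 2) (Fin 2) ℂ) :
    oneQubitOp (c • A) = c • oneQubitOp A := rfl

lemma oneQubitOp_add (A B : Matrix (Fin 2) (Fin 2) ℂ) :
    oneQubitOp (A + B) = oneQubitOp A + oneQubitOp B := rfl

lemma oneQubitOp_one : oneQubitOp 1 = 1 := by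
  ext x y
  simp only [oneQubitOp, submatrix_apply, one_apply]
  refine if_congr ⟨fun h => ?_, fun h => by rw [h]⟩ rfl rfl
  funext i; rw [Fin.fin_one_eq_zero i]; exact h

section Pauli

variable {κ ι : Type} [Fintype κ] [DecidableEq κ] [Fintype ι] [DecidableEq ι]

/-- The Pauli matrix `P` on the qubit `i`. -/
def pauliOp (P : Pauli) (i : ι) : QOp ι := onQubits (oneQubit i) (oneQubitOp P.mat)

lemma onQubits_pauliOp (e : κ ↪ ι) (P : Pauli) (i : κ) :
    onQubits e (pauliOp P i) = pauliOp P (e i) := by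
  rw [pauliOp, onQubits_trans]; rfl

@[simp] lemma pauliOp_I (i : ι) : pauliOp .I i = 1 := by
  rw [pauliOp, Pauli.mat, oneQubitOp_one, onQubits_one]

lemma pauliOp_mul (P Q : Pauli) (i : ι) :
    pauliOp P i * pauliOp Q i = P.phase Q • pauliOp (P.mul Q) i := by
  rw [pauliOp, pauliOp, ← onQubits_mul, ← oneQubitOp_mul, Pauli.mat_mul, oneQubitOp_smul,
    onQubits_smul, pauliOp]

lemma pauliOp_comm_of_ne (P Q : Pauli) {i j : ι} (h : i ≠ j) :
    pauliOp P i * pauliOp Q j = pauliOp Q j * pauliOp P i :=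
  onQubits_comm _ _ (fun _ _ => h) _ _

lemma pauliOp_conjTranspose (P : Pauli) (i : ι) : (pauliOp P i)ᴴ = pauliOp P i := by
  have : (oneQubitOp P.mat)ᴴ = oneQubitOp P.mat := by
    conv_rhs => rw [← Pauli.mat_conjTranspose]
    rfl
  rw [pauliOp, onQubits_conjTranspose, this]

end Pauli

end

noncomputable section

set_option linter.unusedSectionVars false

/-! ## Pauli operators and singlet projections as linear maps -/

section Linear

variable {V ι : Type} [Fintype ι] [DecidableEq ι] (q : V ↪ ι)

/-- The Pauli matrix `P` on the qubit labelled `i`. -/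
def pa (P : Pauli) (i : V) : QState ι →ₗ[ℂ] QState ι := (pauliOp P (q i)).mulVecLin

lemma pa_apply (P : Pauli) (i : V) (ψ : QState ι) : pa q P i ψ = pauliOp P (q i) *ᵥ ψ := rfl

@[simp] lemma pa_I (i : V) (ψ : QState ι) : pa q .I i ψ = ψ := by simp [pa_apply]

lemma pa_mul (P Q : Pauli) (i : V) (ψ : QState ι) :
    pa q P i (pa q Q i ψ) = P.phase Q • pa q (P.mul Q) i ψ := by
  simp only [pa_apply, mulVec_mulVec, pauliOp_mul, smul_mulVec]

@[simp] lemma pa_self (P : Pauli) (i : V) (ψ : QState ι) : pa q P i (pa q P i ψ) = ψ := by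
  rw [pa_mul]; cases P <;> simp [Pauli.phase, Pauli.mul]

lemma pa_anti (P Q : Pauli) (i : V) (ψ : QState ι) :
    pa q P i (pa q Q i ψ) = bsign (P.anti Q) • pa q Q i (pa q P i ψ) := by
  rw [pa_mul, pa_mul, Pauli.phase_comm, Pauli.mul_comm, smul_smul]

lemma pa_comm (P Q : Pauli) {i j : V} (h : i ≠ j) (ψ : QState ι) :
    pa q P i (pa q Q j ψ) = pa q Q j (pa q P i ψ) := by
  simp only [pa_apply, mulVec_mulVec, pauliOp_comm_of_ne P Q (q.injective.ne h)]

/-- The projection onto the singlet of the qubits labelled `i` and `j`. -/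
def sg (i j : V) : QState ι →ₗ[ℂ] QState ι :=
  (1 / 4 : ℂ) • (LinearMap.id - pa q .X i ∘ₗ pa q .X j - pa q .Y i ∘ₗ pa q .Y j -
    pa q .Z i ∘ₗ pa q .Z j)

lemma sg_apply (i j : V) (ψ : QState ι) :
    sg q i j ψ = (1 / 4 : ℂ) • (ψ - pa q .X i (pa q .X j ψ) - pa q .Y i (pa q .Y j ψ) -
      pa q .Z i (pa q .Z j ψ)) := rfl

variable {q}

lemma pa_pair_mul (P Q : Pauli) {i j : V} (h : i ≠ j) (ψ : QState ι) :
    pa q P i (pa q P j (pa q Q i (pa q Q j ψ))) =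
      (P.phase Q * P.phase Q) • pa q (P.mul Q) i (pa q (P.mul Q) j ψ) := by
  rw [pa_comm q P Q h.symm, pa_mul, pa_mul, map_smul, smul_smul]

/-- The operators `1`, `-X X`, `-Y Y`, `-Z Z` form a group, of which `sg` is the average.
Multiplication by one of them permutes the terms. -/
lemma pa_pair_sg {P : Pauli} (hP : P ≠ .I) {i j : V} (h : i ≠ j) (ψ : QState ι) :
    pa q P i (pa q P j (sg q i j ψ)) = -sg q i j ψ := by
  simp only [sg_apply, map_smul, map_sub, pa_pair_mul _ _ h]
  cases P <;> simp [Pauli.phase, Pauli.mul] at hP ⊢ <;> module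

lemma sg_pa_pair {P : Pauli} (hP : P ≠ .I) {i j : V} (h : i ≠ j) (ψ : QState ι) :
    sg q i j (pa q P i (pa q P j ψ)) = -sg q i j ψ := by
  simp only [sg_apply, pa_pair_mul _ _ h]
  cases P <;> simp [Pauli.phase, Pauli.mul] at hP ⊢ <;> module

lemma sg_idem {i j : V} (h : i ≠ j) (ψ : QState ι) : sg q i j (sg q i j ψ) = sg q i j ψ := by
  nth_rw 1 [sg_apply]
  simp only [pa_pair_sg (P := .X) (by decide) h, pa_pair_sg (P := .Y) (by decide) h,
    pa_pair_sg (P := .Z) (by decide) h]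
  module

lemma sg_symm {i j : V} (h : i ≠ j) (ψ : QState ι) : sg q i j ψ = sg q j i ψ := by
  simp only [sg_apply, pa_comm q _ _ h]

lemma pa_sg {P : Pauli} {i j : V} (h : i ≠ j) (ψ : QState ι) :
    pa q P i (sg q i j ψ) = bsign (P ≠ .I) • pa q P j (sg q i j ψ) := by
  by_cases hP : P = .I
  · subst hP; simp
  · have := congrArg (pa q P j) (pa_pair_sg (q := q) hP h ψ)
    rw [pa_comm q _ _ h, pa_self, map_neg] at this
    simp [hP, this]

lemma sg_pa {P : Pauli} {i j : V} (h : i ≠ j) (ψ : QState ι) :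
    sg q i j (pa q P i ψ) = bsign (P ≠ .I) • sg q i j (pa q P j ψ) := by
  by_cases hP : P = .I
  · subst hP; simp
  · have := sg_pa_pair (q := q) hP h (pa q P j ψ)
    rw [pa_self] at this
    simp [hP, this]

lemma sg_comm_pa (P : Pauli) {i j k : V} (hi : i ≠ k) (hj : j ≠ k) (ψ : QState ι) :
    sg q i j (pa q P k ψ) = pa q P k (sg q i j ψ) := by
  simp only [sg_apply, map_smul, map_sub, pa_comm q _ P hj, pa_comm q _ P hi]

/-- Distinct Bell states are orthogonal: for `Q` that anticommutes with `P`, both singlet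
projections absorb `Q ⊗ Q` with the same sign, whereas passing it through `P` changes the sign. -/
lemma sg_pa_sg {P : Pauli} (hP : P ≠ .I) {i j : V} (h : i ≠ j) (ψ : QState ι) :
    sg q i j (pa q P i (sg q i j ψ)) = 0 := by
  obtain ⟨Q, hQ, hPQ⟩ : ∃ Q : Pauli, Q ≠ .I ∧ P.anti Q = true := by
    revert hP; cases P <;> decide
  have h1 := sg_pa_pair (q := q) hQ h (pa q P i (sg q i j ψ))
  rw [pa_comm q Q P h.symm, pa_anti, map_smul, pa_pair_sg hQ h, map_neg, map_neg] at h1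
  have h2 : Q.anti P = true := by revert hPQ; cases P <;> cases Q <;> decide
  rw [h2, bsign_true, neg_smul, one_smul, neg_neg] at h1
  exact self_eq_neg.mp h1

/-- This is the Temperley–Lieb relation. Of the four terms of the middle projection only the
identity survives, since the others take the singlet of `i` and `j` to an orthogonal Bell state. -/
lemma sg_sg_sg {i j k : V} (hij : i ≠ j) (hjk : j ≠ k) (hik : i ≠ k) (ψ : QState ι) :
    sg q i j (sg q j k (sg q i j ψ)) = (1 / 4 : ℂ) • sg q i j ψ := by
  have h : ∀ P : Pauli, P ≠ .I → sg q i j (pa q P j (pa q P k (sg q i j ψ))) = 0 := by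
    intro P hP
    rw [pa_comm q _ _ hjk, sg_comm_pa _ hik hjk]
    have := sg_pa_sg hP hij.symm (q := q) ψ
    rw [← sg_symm hij, ← sg_symm hij] at this
    rw [this, map_zero]
  rw [sg_apply q j k]
  simp only [map_smul, map_sub, h .X (by decide), h .Y (by decide), h .Z (by decide), sg_idem hij]
  module

end Linear

/-! ## Weights and expectations -/

section Weight

variable {κ V ι : Type} [Fintype ι] [DecidableEq ι] [Fintype κ] [DecidableEq κ]

lemma weight_eq (ψ : QState ι) : weight ψ = (star ψ ⬝ᵥ ψ).re := by
  simp only [weight, dotProduct, Pi.star_apply, Complex.re_sum]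
  refine Finset.sum_congr rfl fun x _ => ?_
  rw [Complex.star_def, Complex.conj_mul', ← Complex.ofReal_pow, Complex.ofReal_re]

lemma weight_nonneg (ψ : QState ι) : 0 ≤ weight ψ := Finset.sum_nonneg fun _ _ => by positivity

@[simp] lemma weight_zero : weight (0 : QState ι) = 0 := by simp [weight]

lemma weight_smul (c : ℂ) (ψ : QState ι) : weight (c • ψ) = ‖c‖ ^ 2 * weight ψ := by
  simp [weight, mul_pow, Finset.mul_sum]

lemma expect_smul (E : QOp ι) (c : ℂ) (ψ : QState ι) :
    expect E (c • ψ) = ‖c‖ ^ 2 * expect E ψ := by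
  simp only [expect, mulVec_smul, star_smul, smul_dotProduct, dotProduct_smul, smul_eq_mul]
  rw [← mul_assoc, Complex.star_def, Complex.mul_conj', ← Complex.ofReal_pow, Complex.re_ofReal_mul]

lemma weight_eq_expect (ψ : QState ι) : weight ψ = expect 1 ψ := by
  rw [weight_eq, expect, one_mulVec]

lemma expect_mulVec (E A : QOp ι) (ψ : QState ι) :
    expect E (A *ᵥ ψ) = expect (Aᴴ * E * A) ψ := by
  simp only [expect, star_mulVec, ← mulVec_mulVec, ← dotProduct_mulVec]

lemma expect_add (E F : QOp ι) (ψ : QState ι) : expect (E + F) ψ = expect E ψ + expect F ψ := by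
  simp [expect, add_mulVec]

lemma expect_sub (E F : QOp ι) (ψ : QState ι) : expect (E - F) ψ = expect E ψ - expect F ψ := by
  simp [expect, sub_mulVec]

lemma weight_mulVec_of_unitary {U : QOp ι} (hU : Uᴴ * U = 1) (ψ : QState ι) :
    weight (U *ᵥ ψ) = weight ψ := by
  rw [weight_eq_expect, expect_mulVec, Matrix.mul_one, hU, weight_eq_expect]

lemma pauliOp_mul_self (P : Pauli) (i : ι) : pauliOp P i * pauliOp P i = 1 := by
  rw [pauliOp_mul]; cases P <;> simp [Pauli.phase, Pauli.mul]

@[simp] lemma weight_pa (q : V ↪ ι) (P : Pauli) (i : V) (ψ : QState ι) :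
    weight (pa q P i ψ) = weight ψ :=
  weight_mulVec_of_unitary (by rw [pauliOp_conjTranspose, pauliOp_mul_self]) ψ

/-- The projection onto the singlet in terms of Pauli operators. -/
def sgOp (i j : ι) : QOp ι :=
  (1 / 4 : ℂ) • (1 - pauliOp .X i * pauliOp .X j - pauliOp .Y i * pauliOp .Y j -
    pauliOp .Z i * pauliOp .Z j)

lemma sg_eq_mulVec (q : V ↪ ι) (i j : V) (ψ : QState ι) : sg q i j ψ = sgOp (q i) (q j) *ᵥ ψ := by
  simp only [sg_apply, sgOp, pa_apply, smul_mulVec, sub_mulVec, one_mulVec, mulVec_mulVec]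

lemma sgOp_conjTranspose {i j : ι} (h : i ≠ j) : (sgOp i j)ᴴ = sgOp i j := by
  simp only [sgOp, conjTranspose_smul, conjTranspose_sub, conjTranspose_one, conjTranspose_mul,
    pauliOp_conjTranspose, pauliOp_comm_of_ne _ _ h.symm]
  simp

lemma sgOp_mul_self {i j : ι} (h : i ≠ j) : sgOp i j * sgOp i j = sgOp i j := by
  refine op_ext fun ψ => ?_
  have := sg_idem (q := Function.Embedding.refl ι) h ψ
  rw [sg_eq_mulVec, sg_eq_mulVec, mulVec_mulVec] at this
  exact this

lemma weight_add_weight_of_proj {S : QOp ι} (hS : Sᴴ = S) (hS2 : S * S = S) (ψ : QState ι) :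
    weight ψ = weight (S *ᵥ ψ) + weight (ψ - S *ᵥ ψ) := by
  have h : ψ - S *ᵥ ψ = (1 - S) *ᵥ ψ := by rw [sub_mulVec, one_mulVec]
  rw [h, weight_eq_expect, weight_eq_expect, weight_eq_expect, expect_mulVec, expect_mulVec,
    ← expect_add]
  congr 1
  simp [hS, hS2, mul_sub, sub_mul]

lemma weight_sg (q : V ↪ ι) {i j : V} (h : i ≠ j) (ψ : QState ι) :
    weight ψ = weight (sg q i j ψ) + weight (ψ - sg q i j ψ) := by
  rw [sg_eq_mulVec]
  exact weight_add_weight_of_proj (sgOp_conjTranspose (q.injective.ne h))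
    (sgOp_mul_self (q.injective.ne h)) ψ

end Weight

/-! ### The singlet projection as an average of Pauli products -/

section Singlet

variable {ι : Type} [Fintype ι] [DecidableEq ι]

lemma pauliOp_mulVec (P : Pauli) (i : ι) (ψ : QState ι) (x : ι → Fin 2) :
    (pauliOp P i *ᵥ ψ) x =
      P.mat (x i) 0 * ψ (Function.update x i 0) + P.mat (x i) 1 * ψ (Function.update x i 1) := by
  rw [pauliOp, onQubits_mulVec]
  rw [← Equiv.sum_comp (Equiv.funUnique (Fin 1) (Fin 2)).symm, Fin.sum_univ_two]
  have h : ∀ b : Fin 2, Function.extend (oneQubit i) (fun _ => b) x = Function.update x i b := by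
    intro b; funext k
    by_cases hk : k = i
    · subst hk
      rw [Function.update_self]
      exact (oneQubit k).injective.extend_apply _ _ 0
    · rw [Function.update_of_ne hk, Function.extend_apply']
      rintro ⟨_, rfl⟩; exact hk rfl
  have h' : ∀ b : Fin 2, ((Equiv.funUnique (Fin 1) (Fin 2)).symm b) = fun _ => b := fun b => rfl
  rw [h', h', h, h]
  rfl

lemma fin_two_fun (x : Fin 2 → Fin 2) : x = ![x 0, x 1] := by
  funext i; fin_cases i <;> rfl

lemma singlet_apply (a b : Fin 2) :
    singlet ![a, b] = if a = b then 0 else (if a = 0 then 1 else -1) * (1 / (Real.sqrt 2 : ℂ)) := by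
  fin_cases a <;> fin_cases b <;> simp [singlet, funext_iff, Fin.forall_fin_two]

lemma sqrt_two_inv_mul : (1 / (Real.sqrt 2 : ℂ)) * (1 / (Real.sqrt 2 : ℂ)) = 1 / 2 := by
  rw [div_mul_div_comm, one_mul, ← Complex.ofReal_mul, Real.mul_self_sqrt (by norm_num)]
  norm_num

lemma sum_fin_two_fun {M : Type*} [AddCommMonoid M] (f : (Fin 2 → Fin 2) → M) :
    ∑ x, f x = f ![0, 0] + f ![0, 1] + f ![1, 0] + f ![1, 1] := by
  rw [← Equiv.sum_comp (finTwoArrowEquiv (Fin 2)).symm, Fintype.sum_prod_type]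
  simp [Fin.sum_univ_two, finTwoArrowEquiv, add_assoc]

/-- This connects the measurement of the model with the Pauli form of the projection, so that the
protocols can be analysed by commutation rules without reference to amplitudes of the singlet. -/
lemma singletProj_eq : singletProj = sgOp (0 : Fin 2) 1 := by
  refine op_ext fun ψ => ?_
  funext x
  rw [fin_two_fun x]
  generalize x 0 = a
  generalize x 1 = b
  have h0 : ∀ a b c : Fin 2, Function.update ![a, b] 0 c = ![c, b] := by decide
  have h1 : ∀ a b c : Fin 2, Function.update ![a, b] 1 c = ![a, c] := by decide
  have e1 : (singletProj *ᵥ ψ) ![a, b] =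
      singlet ![a, b] * (1 / (Real.sqrt 2 : ℂ)) * (ψ ![0, 1] - ψ ![1, 0]) := by
    have hs : star (1 / (Real.sqrt 2 : ℂ)) = 1 / (Real.sqrt 2 : ℂ) := by
      rw [Complex.star_def, map_div₀, map_one, Complex.conj_ofReal]
    rw [singletProj, vecMulVec_mulVec, dotProduct, sum_fin_two_fun]
    simp only [Pi.smul_apply, Pi.star_apply, singlet_apply]
    generalize (1 / (Real.sqrt 2 : ℂ)) = s at *
    simp [hs]
    ring_nf
  have e2 : singlet ![a, b] * (1 / (Real.sqrt 2 : ℂ)) =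
      if a = b then 0 else (if a = 0 then 1 else -1) * (1 / 2) := by
    rw [singlet_apply]; split_ifs <;> simp only [zero_mul, mul_assoc, sqrt_two_inv_mul]
  rw [e1, e2]
  simp only [sgOp, smul_mulVec, sub_mulVec, one_mulVec, ← mulVec_mulVec, Pi.smul_apply,
    Pi.sub_apply, pauliOp_mulVec, h0, h1, smul_eq_mul]
  fin_cases a <;> fin_cases b <;> simp [Pauli.mat] <;> ring_nf <;> simp <;> ring_nf

lemma onQubits_singletProj {i j : ι} (h : i ≠ j) :
    onQubits (twoQubits i j h) singletProj = sgOp i j := by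
  rw [singletProj_eq, sgOp]
  simp only [onQubits_smul, onQubits_sub, onQubits_one, onQubits_mul, onQubits_pauliOp]
  rfl

lemma onQubits_tripletProj {i j : ι} (h : i ≠ j) :
    onQubits (twoQubits i j h) tripletProj = 1 - sgOp i j := by
  rw [tripletProj, onQubits_sub, onQubits_one, onQubits_singletProj]

end Singlet

end

noncomputable section

set_option linter.unusedSectionVars false

/-! ## Programs for the classical controller -/

/-- Programs on the qubits labelled by `V`.  The body of a loop is repeated until it
returns `true`. -/
inductive Prog (V : Type)
  | ret (b : Bool)
  | x (i : V) (k : Prog V)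
  | z (i : V) (k : Prog V)
  | st (i j : V) (k : Bool → Prog V)
  | loop (body k : Prog V)

/-- The loops that are being executed: their bodies and what follows them. -/
abbrev Stack (V : Type) : Type := List (Prog V × Prog V)

/-- A function of programs and states that is at most the total of its values after the next
operation plus `κ` times the number of operations.  Such are, with `κ = 1`, the expected number
of operations, and, with `κ = 0`, the acceptance probability and its negative. -/
structure Val {V ι : Type} [Fintype ι] [DecidableEq ι] (q : V ↪ ι) (κ : ℝ) where
  f : Prog V → Stack V → QState ι → ℝ
  nonneg : 0 ≤ κ
  smul : ∀ P s (c : ℂ) ψ, f P s (c • ψ) = ‖c‖ ^ 2 * f P s ψ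
  x_le : ∀ i P s ψ, f (.x i P) s ψ ≤ κ * weight ψ + f P s (pa q .X i ψ)
  z_le : ∀ i P s ψ, f (.z i P) s ψ ≤ κ * weight ψ + f P s (pa q .Z i ψ)
  st_le : ∀ i j P s ψ, i ≠ j →
    f (.st i j P) s ψ ≤ κ * weight ψ + f (P true) s (sg q i j ψ) + f (P false) s (ψ - sg q i j ψ)
  loop_push : ∀ b k s ψ, f (.loop b k) s ψ ≤ κ * (2 * weight ψ) + f b ((b, k) :: s) ψ
  ret_true : ∀ b k s ψ, f (.ret true) ((b, k) :: s) ψ ≤ κ * (2 * weight ψ) + f k s ψ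
  ret_false : ∀ b k s ψ,
    f (.ret false) ((b, k) :: s) ψ ≤ κ * (2 * weight ψ) + f b ((b, k) :: s) ψ

namespace Val

variable {V ι : Type} [Fintype ι] [DecidableEq ι] {q : V ↪ ι} {κ : ℝ} (G : Val q κ)

variable (q) in
/-- The total weight never increases. -/
def negWeight : Val q 0 where
  f _ _ ψ := -weight ψ
  nonneg := le_rfl
  smul _ _ c ψ := by rw [weight_smul]; ring
  x_le _ _ _ ψ := by simp
  z_le _ _ _ ψ := by simp
  st_le i j P s ψ h := by rw [weight_sg q h ψ]; linarith
  loop_push _ _ _ _ := by linarith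
  ret_true _ _ _ _ := by linarith
  ret_false _ _ _ _ := by linarith

lemma zero (P : Prog V) (s : Stack V) : G.f P s 0 = 0 := by
  have := G.smul P s 0 0
  simpa using this

lemma smul_unit (P : Prog V) (s : Stack V) {c : ℂ} (hc : ‖c‖ = 1) (ψ : QState ι) :
    G.f P s (c • ψ) = G.f P s ψ := by rw [G.smul, hc]; ring

lemma bsign_smul (P : Prog V) (s : Stack V) (b : Bool) (ψ : QState ι) :
    G.f P s (bsign b • ψ) = G.f P s ψ := G.smul_unit P s (norm_bsign b) ψ

include G in
lemma cost_nonneg (ψ : QState ι) : 0 ≤ κ * weight ψ := mul_nonneg G.nonneg (weight_nonneg ψ)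

include G in
lemma cost_mono {φ ψ : QState ι} (h : weight φ ≤ weight ψ) : κ * weight φ ≤ κ * weight ψ :=
  mul_le_mul_of_nonneg_left h G.nonneg

/-- Here `p` and `r` are coefficients of unnormalised branches: failure returns to `ψ` itself with
coefficient `r`, so the loop is a geometric series. No limit is needed, because its value satisfies
a linear inequality in itself. -/
lemma loop_le {body k : Prog V} {ψ φ : QState ι} {c p r : ℝ} (hr : r < 1)
    (hw : p * weight φ + r * weight ψ ≤ weight ψ) (hp : 0 ≤ p) (hr0 : 0 ≤ r)
    (h : ∀ s, G.f body s ψ ≤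
      κ * (c * weight ψ) + p * G.f (.ret true) s φ + r * G.f (.ret false) s ψ)
    (s : Stack V) :
    G.f (.loop body k) s ψ ≤
      κ * ((2 + (c + 2) / (1 - r)) * weight ψ) + p / (1 - r) * G.f k s φ := by
  have h1 := h ((body, k) :: s)
  have h2 := mul_le_mul_of_nonneg_left (G.ret_true body k s φ) hp
  have h3 := mul_le_mul_of_nonneg_left (G.ret_false body k s ψ) hr0
  have h4 := G.loop_push body k s ψ
  have h5 := mul_le_mul_of_nonneg_left hw G.nonneg
  have hr' : 0 < 1 - r := by linarith
  -- The value of the body at `ψ`, with the loop on the stack, occurs on both sides, on the right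
  -- with the coefficient `r < 1`. Being a real number, it can be isolated.
  have h6 : G.f body ((body, k) :: s) ψ ≤
      (κ * ((c + 2) * weight ψ) + p * G.f k s φ) / (1 - r) := by
    rw [le_div_iff₀ hr']; linarith
  refine h4.trans ((add_le_add_right h6 _).trans_eq ?_)
  field_simp
  ring

end Val

/-- Apply the Pauli matrix `P` to the qubit `i`. -/
def pauliProg {V : Type} (P : Pauli) (i : V) (k : Prog V) : Prog V :=
  match P with
  | .I => k
  | .X => .x i k
  | .Y => .z i (.x i k)
  | .Z => .z i k

/-- Test for the Bell state obtained from the singlet of `i` and `j` by the Pauli matrix `P`.  If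
the test succeeds, the result is a singlet. -/
def bellTest {V : Type} (P : Pauli) (i j : V) (k : Bool → Prog V) : Prog V :=
  pauliProg P i (.st i j fun b => if b then k true else pauliProg P i (k false))

/-- The Bell measurement of `i` and `j`, which leaves a singlet. -/
def bell {V : Type} (i j : V) (k : Pauli → Prog V) : Prog V :=
  bellTest .I i j fun b => if b then k .I else
    bellTest .X i j fun b => if b then k .X else
      bellTest .Y i j fun b => if b then k .Y else
        bellTest .Z i j fun _ => k .Z

namespace Val

variable {V ι : Type} [Fintype ι] [DecidableEq ι] {q : V ↪ ι} {κ : ℝ} (G : Val q κ)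

lemma pauli_le (P : Pauli) (i : V) (k : Prog V) (s : Stack V) (ψ : QState ι) :
    G.f (pauliProg P i k) s ψ ≤ κ * (2 * weight ψ) + G.f k s (pa q P i ψ) := by
  have h0 := G.cost_nonneg ψ
  cases P with
  | I => simp only [pauliProg, pa_I]; linarith
  | X => have := G.x_le i k s ψ; simp only [pauliProg]; linarith
  | Y =>
    have h1 := G.z_le i (.x i k) s ψ
    have h2 := G.x_le i k s (pa q .Z i ψ)
    rw [pa_mul, weight_pa, G.smul_unit _ _ (Pauli.norm_phase _ _)] at h2
    simp only [pauliProg, Pauli.mul] at h2 ⊢; linarith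
  | Z => have := G.z_le i k s ψ; simp only [pauliProg]; linarith

lemma bellTest_le (P : Pauli) {i j : V} (h : i ≠ j) (k : Bool → Prog V) (s : Stack V)
    (ψ : QState ι) :
    G.f (bellTest P i j k) s ψ ≤ κ * (5 * weight ψ) + G.f (k true) s (sg q i j (pa q P i ψ)) +
      G.f (k false) s (ψ - pa q P i (sg q i j (pa q P i ψ))) := by
  have h1 := G.pauli_le P i (.st i j fun b => if b then k true else pauliProg P i (k false)) s ψ
  have h2 := G.st_le i j (fun b => if b then k true else pauliProg P i (k false)) s (pa q P i ψ) h
  have h3 := G.pauli_le P i (k false) s (pa q P i ψ - sg q i j (pa q P i ψ))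
  have h4 := weight_sg q h (pa q P i ψ)
  have h5 := G.cost_mono (φ := pa q P i ψ - sg q i j (pa q P i ψ)) (ψ := ψ) (by
    have := weight_nonneg (sg q i j (pa q P i ψ)); rw [weight_pa] at h4; linarith)
  simp only [map_sub, pa_self, weight_pa, if_true, Bool.false_eq_true, if_false] at h1 h2 h3
  rw [bellTest]
  linarith

lemma sg_pa_pa_sg {P Q : Pauli} (hPQ : P ≠ Q) {i j : V} (h : i ≠ j) (ψ : QState ι) :
    sg q i j (pa q P i (pa q Q i (sg q i j ψ))) = 0 := by
  rw [pa_mul, map_smul, sg_pa_sg _ h, smul_zero]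
  revert hPQ; cases P <;> cases Q <;> decide

/-- The four Bell states are a basis of two qubits, so their projections add up to the identity. -/
lemma bell_complete {i j : V} (h : i ≠ j) (ψ : QState ι) :
    ψ - sg q i j ψ - pa q .X i (sg q i j (pa q .X i ψ)) - pa q .Y i (sg q i j (pa q .Y i ψ)) -
      pa q .Z i (sg q i j (pa q .Z i ψ)) = 0 := by
  simp only [sg_apply, map_smul, map_sub, pa_comm q _ _ h.symm, pa_mul, Pauli.phase, Pauli.mul,
    pa_I, smul_smul]
  simp only [mul_neg, neg_mul, Complex.I_mul_I, neg_neg]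
  module

lemma bell_le {i j : V} (h : i ≠ j) (k : Pauli → Prog V) (s : Stack V) (ψ : QState ι) :
    G.f (bell i j k) s ψ ≤ κ * (20 * weight ψ) + ∑ Q, G.f (k Q) s (sg q i j (pa q Q i ψ)) := by
  have key : ∀ {κ' : ℝ} (G : Val q κ') (P : Pauli) (k : Bool → Prog V) (ψ φ : QState ι),
      sg q i j (pa q P i φ) = sg q i j (pa q P i ψ) →
      G.f (bellTest P i j k) s φ ≤ κ' * (5 * weight φ) + G.f (k true) s (sg q i j (pa q P i ψ)) +
        G.f (k false) s (φ - pa q P i (sg q i j (pa q P i ψ))) := by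
    intro κ' G P k ψ φ e
    have := G.bellTest_le P h k s φ
    rwa [e] at this
  set φ0 := ψ - sg q i j ψ with hφ0
  set φ1 := φ0 - pa q .X i (sg q i j (pa q .X i ψ)) with hφ1
  set φ2 := φ1 - pa q .Y i (sg q i j (pa q .Y i ψ)) with hφ2
  have h3 : φ2 - pa q .Z i (sg q i j (pa q .Z i ψ)) = 0 := bell_complete h ψ
  -- By orthogonality of the Bell states, the earlier failed tests do not change the component that
  -- a later test selects.
  have e1 : sg q i j (pa q .X i φ0) = sg q i j (pa q .X i ψ) := by
    rw [hφ0, map_sub, map_sub, sg_pa_sg (by decide) h, sub_zero]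
  have e2 : sg q i j (pa q .Y i φ1) = sg q i j (pa q .Y i ψ) := by
    rw [hφ1, hφ0]
    simp only [map_sub, sg_pa_sg (P := .Y) (by decide) h, sg_pa_pa_sg (P := .Y) (Q := .X)
      (by decide) h, sub_zero]
  have e3 : sg q i j (pa q .Z i φ2) = sg q i j (pa q .Z i ψ) := by
    rw [hφ2, hφ1, hφ0]
    simp only [map_sub, sg_pa_sg (P := .Z) (by decide) h, sg_pa_pa_sg (P := .Z) (Q := .X)
      (by decide) h, sg_pa_pa_sg (P := .Z) (Q := .Y) (by decide) h, sub_zero]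
  have t1 := key G .I (fun b => if b then k .I else
    bellTest .X i j fun b => if b then k .X else
      bellTest .Y i j fun b => if b then k .Y else
        bellTest .Z i j fun _ => k .Z) ψ ψ rfl
  have t2 := key G .X (fun b => if b then k .X else
      bellTest .Y i j fun b => if b then k .Y else
        bellTest .Z i j fun _ => k .Z) ψ φ0 e1
  have t3 := key G .Y (fun b => if b then k .Y else
        bellTest .Z i j fun _ => k .Z) ψ φ1 e2
  have t4 := key G .Z (fun _ => k .Z) ψ φ2 e3
  -- Applied to the negative weight, the same estimate shows that the weights of the remainders
  -- decrease; this bounds the cost of the later tests.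
  have w1 := key (negWeight q) .I (fun _ => k .I) ψ ψ rfl
  have w2 := key (negWeight q) .X (fun _ => k .I) ψ φ0 e1
  have w3 := key (negWeight q) .Y (fun _ => k .I) ψ φ1 e2
  -- Nothing remains after the fourth test, so its negative outcome, on which the program also
  -- reports `Z`, contributes nothing.
  rw [h3, G.zero] at t4
  simp only [pa_I, if_true, Bool.false_eq_true, if_false, ← hφ0, ← hφ1, ← hφ2, negWeight] at *
  have n1 := weight_nonneg (sg q i j ψ)
  have n2 := weight_nonneg (sg q i j (pa q .X i ψ))
  have n3 := weight_nonneg (sg q i j (pa q .Y i ψ))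
  have m1 := G.cost_mono (φ := φ0) (ψ := ψ) (by linarith)
  have m2 := G.cost_mono (φ := φ1) (ψ := ψ) (by linarith)
  have m3 := G.cost_mono (φ := φ2) (ψ := ψ) (by linarith)
  rw [Pauli.sum_univ, bell, pa_I]
  linarith

end Val

/-! ## Measurement of `P ⊗ P` -/

/-- Turn the singlets on `c 0, c 2` and on `c 1, c 3` into the state that is their projection
to the eigenvalue `1` of `P ⊗ P` on `c 0, c 1`. -/
def catProg {V : Type} (P : Pauli) (c : Fin 4 → V) (k : Prog V) : Prog V :=
  let restore (R : Pauli) : Prog V :=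
    bell (c 0) (c 2) fun Q => pauliProg Q (c 1) (pauliProg R (c 1) (.ret false))
  .loop (bellTest .I (c 0) (c 1) fun b => if b then restore .I else
    bellTest P (c 0) (c 1) fun b => if b then restore P else .ret true) k

/-- Bell measurement of `i` and `j`, and again of `j` and `l`. -/
def tele {V : Type} (i j l : V) (k : Pauli → Prog V) : Prog V :=
  bell i j fun Q => bell j l fun A => pauliProg A i (k Q)

/-- The measurement of `P ⊗ P` on `a` and `b`, by means of the singlets of `c 0, c 2` and of
`c 1, c 3`. -/
def pairMeas {V : Type} (c : Fin 4 → V) (P : Pauli) (a b : V) (k : Bool → Prog V) : Prog V :=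
  catProg P c <| tele a (c 0) (c 2) fun Q => tele b (c 1) (c 3) fun R =>
    pauliProg Q a (pauliProg R b (k (P.anti Q ^^ P.anti R)))

/-! ### Identities for entanglement swapping and teleportation -/

section PairMeas

variable {V ι : Type} [Fintype ι] [DecidableEq ι] {q : V ↪ ι}

/-- The singlet and its image under `P` span the eigenspace of `P ⊗ P` with eigenvalue -1. Removing
both leaves the projection to the eigenvalue 1. -/
lemma sg_pair_complement {P : Pauli} (hP : P ≠ .I) {i j : V} (h : i ≠ j) (ψ : QState ι) :
    ψ - sg q i j ψ - pa q P i (sg q i j (pa q P i ψ)) =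
      (1 / 2 : ℂ) • (ψ + pa q P i (pa q P j ψ)) := by
  cases P <;>
  simp only [sg_apply, map_smul, map_sub, pa_comm q _ _ h.symm, pa_mul, Pauli.phase, Pauli.mul,
    pa_I, smul_smul, mul_neg, neg_mul, Complex.I_mul_I, neg_neg] at hP ⊢
  · exact absurd rfl hP
  all_goals module

/-- This is entanglement swapping: a Bell state found on `i, j` destroys the singlet on `i, l`, and
a Bell measurement of `i, l` brings it back. Both Pauli factors can be carried to `j`, where the
corrections remove them; what is left is the relation `e f e = e / 4`. -/
lemma restore_eq {i j l : V} (hij : i ≠ j) (hil : i ≠ l) (hjl : j ≠ l) (P Q : Pauli)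
    {ψ : QState ι} (hψ : sg q i l ψ = ψ) :
    ∃ c : ℂ, ‖c‖ = 1 ∧ pa q P j (pa q Q j (sg q i l (pa q Q i (sg q i j (pa q P i ψ))))) =
      c • (1 / 4 : ℂ) • ψ := by
  refine ⟨bsign (Q ≠ .I) * bsign (P ≠ .I), by simp, ?_⟩
  have h1 : sg q i l (pa q P j ψ) = pa q P j ψ := by rw [sg_comm_pa _ hij hjl.symm, hψ]
  have h2 : sg q i l (sg q i j (pa q P j ψ)) = (1 / 4 : ℂ) • pa q P j ψ := by
    conv_lhs => rw [← h1]
    rw [sg_symm hil, sg_symm hil, sg_sg_sg hil.symm hij hjl.symm, ← sg_symm hil, h1]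
  rw [sg_pa hij, map_smul, pa_sg hij]
  simp only [map_smul, sg_comm_pa _ hij hjl.symm, h2, pa_self, smul_smul]
  congr 1
  ring

/-- The first projection moves the state of `i` to `l` and the second moves it back, so that the
pair `j, l` is a singlet again. -/
lemma sg_sg_fixed {i j l : V} (hij : i ≠ j) (hil : i ≠ l) (hjl : j ≠ l) (Q : Pauli)
    {χ : QState ι} (hχ : sg q j l χ = χ) :
    sg q j l (sg q i j (pa q Q i χ)) = (1 / 4 : ℂ) • pa q Q i χ := by
  have h1 : sg q j l (pa q Q i χ) = pa q Q i χ := by rw [sg_comm_pa _ hij.symm hil.symm, hχ]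
  conv_lhs => rw [← h1]
  rw [sg_symm hij, sg_symm hjl, sg_symm hjl, sg_sg_sg hjl.symm hij.symm hil.symm,
    ← sg_symm hjl, h1]

/-- The singlet carries `P` from `j` to `l`, where it joins the state that has been sent there; on
the way back it ends on `i`. Each of the three transfers across a singlet changes the sign. -/
lemma sg_sg_pa_fixed {i j l : V} (hij : i ≠ j) (hil : i ≠ l) (hjl : j ≠ l) {P : Pauli}
    (hP : P ≠ .I) (Q : Pauli) {χ : QState ι} (hχ : sg q j l χ = χ) :
    sg q j l (sg q i j (pa q Q i (pa q P j χ))) = -((1 / 4 : ℂ) • pa q P i (pa q Q i χ)) := by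
  have h1 : pa q P j χ = -pa q P l χ := by
    have := pa_sg (P := P) (q := q) hjl χ
    rw [hχ] at this
    simpa [hP] using this
  have h2 : ∀ φ : QState ι, sg q j l (pa q P l φ) = -sg q j l (pa q P j φ) := by
    intro φ
    have := sg_pa (P := P) (q := q) hjl φ
    rw [this]; simp [hP]
  have h3 : ∀ φ : QState ι, pa q P j (sg q i j φ) = -pa q P i (sg q i j φ) := by
    intro φ
    rw [pa_sg hij]; simp [hP]
  rw [h1, map_neg, map_neg, map_neg, pa_comm q _ _ hil, sg_comm_pa _ hil hjl, h2, h3, map_neg,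
    neg_neg, sg_comm_pa _ hij.symm hil.symm, sg_sg_fixed hij hil hjl _ hχ, map_smul]

end PairMeas

namespace Val

variable {V ι : Type} [Fintype ι] [DecidableEq ι] {q : V ↪ ι} {κ : ℝ} (G : Val q κ)

/-- Each of the four results `Q` leads back to `ψ` with amplitude 1/4, hence with coefficient 1/16.
-/
lemma restore_le {i j l : V} (hij : i ≠ j) (hil : i ≠ l) (hjl : j ≠ l) (P : Pauli)
    {ψ : QState ι} (hψ : sg q i l ψ = ψ) (s : Stack V) :
    G.f (bell i l fun Q => pauliProg Q j (pauliProg P j (.ret false))) s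
      (sg q i j (pa q P i ψ)) ≤ κ * (24 * weight ψ) + 1 / 4 * G.f (.ret false) s ψ := by
  have h1 := G.bell_le hil (fun Q => pauliProg Q j (pauliProg P j (.ret false))) s
    (sg q i j (pa q P i ψ))
  have hw := (negWeight q).bell_le hil (fun Q => .ret false) s (sg q i j (pa q P i ψ))
  have h2 : ∀ Q : Pauli, G.f (pauliProg Q j (pauliProg P j (.ret false))) s
      (sg q i l (pa q Q i (sg q i j (pa q P i ψ)))) ≤
      κ * (4 * weight (sg q i l (pa q Q i (sg q i j (pa q P i ψ))))) +
        1 / 16 * G.f (.ret false) s ψ := by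
    intro Q
    have a1 := G.pauli_le Q j (pauliProg P j (.ret false)) s
      (sg q i l (pa q Q i (sg q i j (pa q P i ψ))))
    have a2 := G.pauli_le P j (.ret false) s
      (pa q Q j (sg q i l (pa q Q i (sg q i j (pa q P i ψ)))))
    obtain ⟨c, hc, e⟩ := restore_eq hij hil hjl P Q hψ
    rw [e, G.smul_unit _ _ hc, G.smul, weight_pa] at a2
    norm_num at a2 ⊢
    linarith
  have h3 := Finset.sum_le_sum fun Q (_ : Q ∈ Finset.univ) => h2 Q
  have h4 := weight_sg q hij (pa q P i ψ)
  have h5 := weight_nonneg (pa q P i ψ - sg q i j (pa q P i ψ))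
  rw [weight_pa] at h4
  simp only [Pauli.sum_univ, negWeight] at *
  have h6 := G.cost_mono (φ := sg q i j (pa q P i ψ)) (ψ := ψ) (by linarith)
  have h7 := mul_le_mul_of_nonneg_left hw G.nonneg
  linarith

/-- A round succeeds when both Bell tests fail. The factor 2 normalises the projected state, because
the two unsuccessful branches return to `ψ` with total coefficient 1/2. -/
lemma cat_le {P : Pauli} (hP : P ≠ .I) {c : Fin 4 → V} (hc : Function.Injective c)
    {ψ : QState ι} (hψ : sg q (c 0) (c 2) ψ = ψ) (k : Prog V) (s : Stack V) :
    G.f (catProg P c k) s ψ ≤ κ * (130 * weight ψ) +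
      2 * G.f k s ((1 / 2 : ℂ) • (ψ + pa q P (c 0) (pa q P (c 1) ψ))) := by
  have n01 : c 0 ≠ c 1 := hc.ne (by decide)
  have n02 : c 0 ≠ c 2 := hc.ne (by decide)
  have n12 : c 1 ≠ c 2 := hc.ne (by decide)
  set φ := (1 / 2 : ℂ) • (ψ + pa q P (c 0) (pa q P (c 1) ψ)) with hφ
  have e1 : sg q (c 0) (c 1) (pa q P (c 0) (ψ - sg q (c 0) (c 1) ψ)) =
      sg q (c 0) (c 1) (pa q P (c 0) ψ) := by
    rw [map_sub, map_sub, sg_pa_sg hP n01, sub_zero]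
  have body : ∀ {κ : ℝ} (G : Val q κ) s, G.f (bellTest .I (c 0) (c 1) fun b =>
      if b then bell (c 0) (c 2) fun Q => pauliProg Q (c 1) (pauliProg .I (c 1) (.ret false)) else
      bellTest P (c 0) (c 1) fun b =>
        if b then bell (c 0) (c 2) fun Q => pauliProg Q (c 1) (pauliProg P (c 1) (.ret false))
        else .ret true) s ψ ≤
      κ * (58 * weight ψ) + 1 * G.f (.ret true) s φ + 1 / 2 * G.f (.ret false) s ψ := by
    intro κ G s
    have t1 := G.bellTest_le .I n01 (fun b =>
      if b then bell (c 0) (c 2) fun Q => pauliProg Q (c 1) (pauliProg .I (c 1) (.ret false)) else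
      bellTest P (c 0) (c 1) fun b =>
        if b then bell (c 0) (c 2) fun Q => pauliProg Q (c 1) (pauliProg P (c 1) (.ret false))
        else .ret true) s ψ
    have t2 := G.bellTest_le P n01 (fun b =>
        if b then bell (c 0) (c 2) fun Q => pauliProg Q (c 1) (pauliProg P (c 1) (.ret false))
        else .ret true) s (ψ - sg q (c 0) (c 1) ψ)
    have t3 := G.restore_le n01 n02 n12 .I hψ s
    have t4 := G.restore_le n01 n02 n12 P hψ s
    have h4 := weight_sg q n01 ψ
    have h5 := weight_nonneg (sg q (c 0) (c 1) ψ)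
    have h6 := G.cost_mono (φ := ψ - sg q (c 0) (c 1) ψ) (ψ := ψ) (by linarith)
    rw [e1, sg_pair_complement hP n01, ← hφ] at t2
    simp only [pa_I, if_true, Bool.false_eq_true, if_false] at t1 t2 t3 t4
    linarith
  have hw := body (negWeight q) s
  simp only [negWeight] at hw
  -- The value `r = 1 / 2` is the sum of the coefficients 1/4 of the two restored branches.
  have := G.loop_le (k := k) (c := 58) (p := 1) (r := 1 / 2) (φ := φ) (ψ := ψ) (by norm_num)
    (by linarith) (by norm_num) (by norm_num) (body G) s
  rw [catProg]
  norm_num at this ⊢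
  have := G.cost_nonneg ψ
  linarith

/-- The second Bell measurement yields the same state for each of its four results, up to a Pauli
matrix that is corrected; this is the factor 4. -/
lemma tele_le {i j l : V} (hij : i ≠ j) (hil : i ≠ l) (hjl : j ≠ l) (k : Pauli → Prog V)
    (s : Stack V) (ψ : QState ι) :
    G.f (tele i j l k) s ψ ≤ κ * (42 * weight ψ) +
      4 * ∑ Q, G.f (k Q) s (sg q j l (sg q i j (pa q Q i ψ))) := by
  have h1 := G.bell_le hij (fun Q => bell j l fun A => pauliProg A i (k Q)) s ψ
  have w1 := (negWeight q).bell_le hij (fun Q => .ret true) s ψ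
  have h2 : ∀ Q, G.f (bell j l fun A => pauliProg A i (k Q)) s (sg q i j (pa q Q i ψ)) ≤
      κ * (22 * weight (sg q i j (pa q Q i ψ))) +
        4 * G.f (k Q) s (sg q j l (sg q i j (pa q Q i ψ))) := by
    intro Q
    have a1 := G.bell_le hjl (fun A => pauliProg A i (k Q)) s (sg q i j (pa q Q i ψ))
    have a2 := (negWeight q).bell_le hjl (fun A => k Q) s (sg q i j (pa q Q i ψ))
    have a3 : ∀ A, G.f (pauliProg A i (k Q)) s (sg q j l (pa q A j (sg q i j (pa q Q i ψ)))) ≤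
        κ * (2 * weight (sg q j l (pa q A j (sg q i j (pa q Q i ψ))))) +
          G.f (k Q) s (sg q j l (sg q i j (pa q Q i ψ))) := by
      intro A
      have b := G.pauli_le A i (k Q) s (sg q j l (pa q A j (sg q i j (pa q Q i ψ))))
      -- The first projection carries the Pauli matrix `A` from `j` to `i`, up to a sign, and there
      -- the correction cancels it.
      have e : pa q A i (sg q j l (pa q A j (sg q i j (pa q Q i ψ)))) =
          bsign (A ≠ .I) • sg q j l (sg q i j (pa q Q i ψ)) := by
        rw [sg_symm hij, pa_sg hij.symm, map_smul, map_smul, sg_comm_pa _ hij.symm hil.symm,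
          pa_self]
      rwa [e, G.bsign_smul] at b
    have a4 := Finset.sum_le_sum fun Q (_ : Q ∈ Finset.univ) => a3 Q
    simp only [Pauli.sum_univ, negWeight] at *
    have a5 := mul_le_mul_of_nonneg_left a2 G.nonneg
    linarith
  have h3 := Finset.sum_le_sum fun Q (_ : Q ∈ Finset.univ) => h2 Q
  simp only [Pauli.sum_univ, negWeight] at *
  have h4 := mul_le_mul_of_nonneg_left w1 G.nonneg
  rw [tele]
  linarith

end Val

end

noncomputable section

set_option linter.unusedSectionVars false

/-! ## The qubits of the simulation, and measurements of Pauli operators -/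

/-- Labels of the physical qubits on which the simulation acts: the logical qubits, a qubit in the
`1`-eigenstate of `P` for each Pauli matrix `P` that serves as a reference, another such qubit that
serves as an ancilla, four qubits in two singlets, and `m + 2` ancillas in the state `|0⟩`. -/
inductive Lab (n m : ℕ)
  | data (i : Fin n)
  | ref (P : Pauli)
  | scr (P : Pauli)
  | cat (k : Fin 4)
  | w
  | x
  | y (j : Fin m)

/-- The labels of the logical qubits and of the ancillas in the state `|0⟩`. -/
def Lab.Sys {n m : ℕ} : Lab n m → Prop
  | .data _ => True
  | .w => True
  | .x => True
  | .y _ => True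
  | _ => False

section Spaces

variable {n m : ℕ} {ι : Type} [Fintype ι] [DecidableEq ι]

/-- The fixed vectors of a linear map. -/
def fixedSpace (A : QState ι →ₗ[ℂ] QState ι) : Submodule ℂ (QState ι) :=
  LinearMap.eqLocus A LinearMap.id

lemma mem_fixedSpace {A : QState ι →ₗ[ℂ] QState ι} {ψ : QState ι} :
    ψ ∈ fixedSpace A ↔ A ψ = ψ := Iff.rfl

lemma fixedSpace_of_comm {A B : QState ι →ₗ[ℂ] QState ι} (h : ∀ ψ, A (B ψ) = B (A ψ))
    {ψ : QState ι} (hψ : ψ ∈ fixedSpace A) : B ψ ∈ fixedSpace A := by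
  rw [mem_fixedSpace] at *; rw [h, hψ]

/-- The states in which the four qubits `cat k` are in two singlets. -/
def catSpace (q : Lab n m ↪ ι) : Submodule ℂ (QState ι) :=
  fixedSpace (sg q (.cat 0) (.cat 2)) ⊓ fixedSpace (sg q (.cat 1) (.cat 3))

/-- The states in which moreover the reference qubits are in their eigenstates. -/
def refSpace (q : Lab n m ↪ ι) : Submodule ℂ (QState ι) :=
  catSpace q ⊓ ⨅ P, fixedSpace (pa q P (.ref P))

/-- The states in which moreover the ancillas `scr P` are in their eigenstates. -/
def sysSpace (q : Lab n m ↪ ι) : Submodule ℂ (QState ι) :=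
  refSpace q ⊓ ⨅ P, fixedSpace (pa q P (.scr P))

variable {q : Lab n m ↪ ι}

lemma catSpace.pa_mem {ψ : QState ι} (hψ : ψ ∈ catSpace q) (P : Pauli) {i : Lab n m}
    (hi : ∀ k, i ≠ .cat k) : pa q P i ψ ∈ catSpace q :=
  ⟨fixedSpace_of_comm (fun _ => sg_comm_pa P (hi _).symm (hi _).symm _) hψ.1,
    fixedSpace_of_comm (fun _ => sg_comm_pa P (hi _).symm (hi _).symm _) hψ.2⟩

lemma refSpace.pa_mem {ψ : QState ι} (hψ : ψ ∈ refSpace q) (P : Pauli) {i : Lab n m}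
    (hi : ∀ k, i ≠ .cat k) (hi' : ∀ P, i ≠ .ref P) : pa q P i ψ ∈ refSpace q := by
  refine ⟨catSpace.pa_mem hψ.1 P hi, ?_⟩
  rw [SetLike.mem_coe, Submodule.mem_iInf]
  exact fun Q => fixedSpace_of_comm (fun _ => pa_comm q _ _ (hi' Q).symm _)
    ((Submodule.mem_iInf _).1 hψ.2 Q)

lemma sysSpace.pa_mem {ψ : QState ι} (hψ : ψ ∈ sysSpace q) (P : Pauli) {i : Lab n m}
    (hi : i.Sys) : pa q P i ψ ∈ sysSpace q := by
  refine ⟨refSpace.pa_mem hψ.1 P ?_ ?_, ?_⟩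
  · rintro k rfl; exact hi
  · rintro k rfl; exact hi
  · rw [SetLike.mem_coe, Submodule.mem_iInf]
    exact fun Q => fixedSpace_of_comm (fun _ => pa_comm q _ _ (by rintro rfl; exact hi) _)
      ((Submodule.mem_iInf _).1 hψ.2 Q)

lemma refSpace.ref_eq {ψ : QState ι} (hψ : ψ ∈ refSpace q) (P : Pauli) :
    pa q P (.ref P) ψ = ψ := (Submodule.mem_iInf _).1 hψ.2 P

lemma sysSpace.scr_eq {ψ : QState ι} (hψ : ψ ∈ sysSpace q) (P : Pauli) :
    pa q P (.scr P) ψ = ψ := (Submodule.mem_iInf _).1 hψ.2 P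

end Spaces

section Programs

variable {n m : ℕ}

/-- The measurement of the Pauli matrix `P` on the qubit `i`. -/
def meas (P : Pauli) (i : Lab n m) (k : Bool → Prog (Lab n m)) : Prog (Lab n m) :=
  pairMeas .cat P i (.ref P) k

/-- The measurement of `A` on the qubit `a`, followed by a projection to the `1`-eigenstate of `B`,
where `A` and `B` anticommute. -/
def erase (A B : Pauli) (a : Lab n m) (k : Bool → Prog (Lab n m)) : Prog (Lab n m) :=
  meas A a fun b => meas B a fun b' => if b' then pauliProg A a (k b) else k b

/-- The operator `(1 + A + B - A B) / 2` for the Pauli matrices `A` on `i` and `B` on `j`. -/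
def ctlProg (A B : Pauli) (i j : Lab n m) (k : Prog (Lab n m)) : Prog (Lab n m) :=
  pairMeas .cat A i (.scr B) fun b₁ => pairMeas .cat B j (.scr B) fun b₂ =>
    erase A B (.scr B) fun b₃ =>
      let k' := if b₂ then pauliProg A i k else k
      if b₁ ^^ b₃ then pauliProg B j k' else k'

/-- A Pauli matrix other than `P` and `1`. -/
def Pauli.other : Pauli → Pauli
  | .X => .Z
  | .Y => .Z
  | _ => .X

/-- The operator `(1 - i R) / √2` for the Pauli matrix `R` on `i`. -/
def rotProg (R : Pauli) (i : Lab n m) (k : Prog (Lab n m)) : Prog (Lab n m) :=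
  pairMeas .cat R i (.scr R.other) fun b => erase (R.mul R.other) R.other (.scr R.other) fun b' =>
    if b ^^ b' ^^ decide (R ≠ .X) then pauliProg R i k else k

end Programs

namespace Val

variable {n m : ℕ} {ι : Type} [Fintype ι] [DecidableEq ι] {q : Lab n m ↪ ι} {κ : ℝ}
  (G : Val q κ)

/-- The resource is the sum of two singlet pairs and of their image under `P ⊗ P`. Sending `a` and
`b` through it and back converts the second term into `P ⊗ P` on `a` and `b`. The Pauli corrections
`Q` and `R` change its sign if they anticommute with `P`, so the parity of these two events is the
measured bit. -/
lemma pairMeas_le {P : Pauli} (hP : P ≠ .I) {a b : Lab n m} (hab : a ≠ b)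
    (ha : ∀ k, a ≠ .cat k) (hb : ∀ k, b ≠ .cat k) {ψ : QState ι} (hψ : ψ ∈ catSpace q)
    (k : Bool → Prog (Lab n m)) (s : Stack (Lab n m)) :
    G.f (pairMeas .cat P a b k) s ψ ≤ κ * (220 * weight ψ) +
      ∑ t, G.f (k t) s ((1 / 2 : ℂ) • (ψ + bsign t • pa q P a (pa q P b ψ))) := by
  have hinj : Function.Injective (Lab.cat : Fin 4 → Lab n m) := fun _ _ h => by cases h; rfl
  have hn : ∀ {i j : Fin 4}, i ≠ j → (Lab.cat i : Lab n m) ≠ .cat j := fun h => hinj.ne h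
  have n02 := hn (i := 0) (j := 2) (by decide)
  have n13 := hn (i := 1) (j := 3) (by decide)
  set φ := (1 / 2 : ℂ) • (ψ + pa q P (.cat 0) (pa q P (.cat 1) ψ)) with hφ
  have s02 : sg q (.cat 0) (.cat 2) (pa q P (.cat 1) ψ) = pa q P (.cat 1) ψ := by
    rw [sg_comm_pa _ (hn (by decide)) (hn (by decide)), hψ.1]; rfl
  let φ1 : Pauli → QState ι := fun Q =>
    (1 / 8 : ℂ) • (pa q Q a ψ - pa q P (.cat 1) (pa q P a (pa q Q a ψ)))
  have e1 : ∀ Q, sg q (.cat 0) (.cat 2) (sg q a (.cat 0) (pa q Q a φ)) = φ1 Q := by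
    intro Q
    simp only [hφ, map_smul, map_add]
    rw [sg_sg_fixed (ha 0) (ha 2) n02 Q hψ.1, sg_sg_pa_fixed (ha 0) (ha 2) n02 hP Q s02,
      pa_comm q Q P (ha 1), pa_comm q P P (ha 1)]
    simp only [φ1]
    module
  have e2 : ∀ Q R, pa q R b (pa q Q a
      (sg q (.cat 1) (.cat 3) (sg q b (.cat 1) (pa q R b (φ1 Q))))) =
      (1 / 16 : ℂ) • (1 / 2 : ℂ) • (ψ + bsign (P.anti Q ^^ P.anti R) • pa q P a (pa q P b ψ)) := by
    intro Q R
    have m1 : sg q (.cat 1) (.cat 3) (pa q Q a ψ) = pa q Q a ψ :=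
      (catSpace.pa_mem hψ Q ha).2
    have m2 : sg q (.cat 1) (.cat 3) (pa q P a (pa q Q a ψ)) = pa q P a (pa q Q a ψ) :=
      (catSpace.pa_mem (catSpace.pa_mem hψ Q ha) P ha).2
    simp only [φ1, map_smul, map_sub]
    rw [sg_sg_fixed (hb 1) (hb 3) n13 R m1, sg_sg_pa_fixed (hb 1) (hb 3) n13 hP R m2]
    rw [pa_anti q P R b, pa_anti q P Q a]
    simp only [map_smul, map_neg, pa_comm q _ _ hab.symm, pa_self, bsign_xor, smul_smul]
    rw [pa_comm q P P hab]
    module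
  have t1 := G.cat_le hP hinj hψ.1 (tele a (.cat 0) (.cat 2) fun Q => tele b (.cat 1) (.cat 3)
    fun R => pauliProg Q a (pauliProg R b (k (P.anti Q ^^ P.anti R)))) s
  have w1 := (negWeight q).cat_le hP hinj hψ.1 (.ret true) s
  have t2 := G.tele_le (ha 0) (ha 2) n02 (fun Q => tele b (.cat 1) (.cat 3)
    fun R => pauliProg Q a (pauliProg R b (k (P.anti Q ^^ P.anti R)))) s φ
  have w2 := (negWeight q).tele_le (ha 0) (ha 2) n02 (fun Q => .ret true) s φ
  have t3 : ∀ Q, G.f (tele b (.cat 1) (.cat 3)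
      fun R => pauliProg Q a (pauliProg R b (k (P.anti Q ^^ P.anti R)))) s (φ1 Q) ≤
      κ * (46 * weight (φ1 Q)) + 4 * ∑ R, 1 / 256 * G.f (k (P.anti Q ^^ P.anti R)) s
        ((1 / 2 : ℂ) • (ψ + bsign (P.anti Q ^^ P.anti R) • pa q P a (pa q P b ψ))) := by
    intro Q
    have a1 := G.tele_le (hb 1) (hb 3) n13
      (fun R => pauliProg Q a (pauliProg R b (k (P.anti Q ^^ P.anti R)))) s (φ1 Q)
    have a2 := (negWeight q).tele_le (hb 1) (hb 3) n13 (fun R => .ret true) s (φ1 Q)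
    have a3 : ∀ R, G.f (pauliProg Q a (pauliProg R b (k (P.anti Q ^^ P.anti R)))) s
        (sg q (.cat 1) (.cat 3) (sg q b (.cat 1) (pa q R b (φ1 Q)))) ≤
        κ * (4 * weight (sg q (.cat 1) (.cat 3) (sg q b (.cat 1) (pa q R b (φ1 Q))))) +
        1 / 256 * G.f (k (P.anti Q ^^ P.anti R)) s
        ((1 / 2 : ℂ) • (ψ + bsign (P.anti Q ^^ P.anti R) • pa q P a (pa q P b ψ))) := by
      intro R
      have b1 := G.pauli_le Q a (pauliProg R b (k (P.anti Q ^^ P.anti R))) s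
        (sg q (.cat 1) (.cat 3) (sg q b (.cat 1) (pa q R b (φ1 Q))))
      have b2 := G.pauli_le R b (k (P.anti Q ^^ P.anti R)) s (pa q Q a
        (sg q (.cat 1) (.cat 3) (sg q b (.cat 1) (pa q R b (φ1 Q)))))
      rw [e2, G.smul, weight_pa] at b2
      norm_num at b2 ⊢
      linarith
    have a4 := Finset.sum_le_sum fun R (_ : R ∈ Finset.univ) => a3 R
    simp only [Pauli.sum_univ, negWeight] at *
    have a5 := mul_le_mul_of_nonneg_left a2 G.nonneg
    linarith
  have t4 := Finset.sum_le_sum fun Q (_ : Q ∈ Finset.univ) => t3 Q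
  simp only [e1, negWeight] at t1 t2 w1 w2
  rw [← hφ] at t1 w1
  rw [Finset.sum_add_distrib, ← Finset.mul_sum, ← Finset.mul_sum, ← Finset.mul_sum] at t4
  have w3 := mul_le_mul_of_nonneg_left w1 G.nonneg
  have w4 := mul_le_mul_of_nonneg_left w2 G.nonneg
  -- Each parity is attained by 8 of the 16 pairs `(Q, R)`, and 8/256 = 1/32 cancels the factor 2 of
  -- the resource and the factors 4 of the two round trips.
  have fin : ∀ g : Bool → ℝ, ∑ Q, ∑ R, 1 / 256 * g (P.anti Q ^^ P.anti R) =
      1 / 32 * ∑ t, g t := by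
    intro g
    cases P <;> simp [Pauli.sum_univ, Pauli.anti] at hP ⊢ <;> ring
  rw [fin fun t => G.f (k t) s ((1 / 2 : ℂ) • (ψ + bsign t • pa q P a (pa q P b ψ)))] at t4
  rw [Finset.sum_neg_distrib] at w4
  have n0 := G.cost_nonneg ψ
  rw [pairMeas]
  linarith


lemma meas_le {P : Pauli} (hP : P ≠ .I) {i : Lab n m} (hi : ∀ k, i ≠ .cat k) (hi' : i ≠ .ref P)
    {ψ : QState ι} (hψ : ψ ∈ refSpace q) (k : Bool → Prog (Lab n m)) (s : Stack (Lab n m)) :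
    G.f (meas P i k) s ψ ≤ κ * (220 * weight ψ) +
      ∑ t, G.f (k t) s ((1 / 2 : ℂ) • (ψ + bsign t • pa q P i ψ)) := by
  have := G.pairMeas_le hP hi' hi (by simp) hψ.1 k s
  rwa [refSpace.ref_eq hψ] at this

/-- On the `1`-eigenstates of `B`, the qubit `a` records which of the two terms is present.
Measuring the anticommuting `A` destroys this record and leaves a coherent sum with a known sign;
the measurement of `B` and a correction then make the ancilla reusable. -/
lemma erase_le {A B : Pauli} (hAB : A.anti B = true) {a : Lab n m} (ha : ∀ k, a ≠ .cat k)
    (ha' : ∀ P, a ≠ .ref P) {ψ φ : QState ι} (hψ : ψ ∈ refSpace q) (hφ : φ ∈ refSpace q)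
    (hψ' : pa q B a ψ = ψ) (hφ' : pa q B a φ = φ) (k : Bool → Prog (Lab n m))
    (s : Stack (Lab n m)) :
    G.f (erase A B a k) s (ψ + pa q A a φ) ≤ κ * (450 * weight (ψ + pa q A a φ)) +
      ∑ t, 1 / 2 * G.f (k t) s (ψ + bsign t • φ) := by
  have hA : A ≠ .I := by rintro rfl; simp [Pauli.anti] at hAB
  have hB : B ≠ .I := by rintro rfl; simp [Pauli.anti] at hAB
  have hBA : B.anti A = true := by revert hAB; cases A <;> cases B <;> decide
  have hm : ψ + pa q A a φ ∈ refSpace q := Submodule.add_mem _ hψ (refSpace.pa_mem hφ A ha ha')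
  have t1 := G.meas_le hA ha (ha' A) hm
    (fun b => meas B a fun b' => if b' then pauliProg A a (k b) else k b) s
  have w1 := (negWeight q).meas_le hA ha (ha' A) hm (fun b => .ret true) s
  have e : ∀ b, (1 / 2 : ℂ) • (ψ + pa q A a φ + bsign b • pa q A a (ψ + pa q A a φ)) =
      (1 / 2 : ℂ) • (ψ + bsign b • φ + bsign b • pa q A a (ψ + bsign b • φ)) := by
    intro b
    simp only [map_add, map_smul, pa_self, smul_smul, smul_add, bsign_mul_self]
    module
  simp only [e] at t1 w1
  have t2 : ∀ b, G.f (meas B a fun b' => if b' then pauliProg A a (k b) else k b) s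
      ((1 / 2 : ℂ) • (ψ + bsign b • φ + bsign b • pa q A a (ψ + bsign b • φ))) ≤
      κ * (222 * weight
        ((1 / 2 : ℂ) • (ψ + bsign b • φ + bsign b • pa q A a (ψ + bsign b • φ)))) +
      1 / 2 * G.f (k b) s (ψ + bsign b • φ) := by
    intro b
    have hχ : ψ + bsign b • φ ∈ refSpace q := Submodule.add_mem _ hψ (Submodule.smul_mem _ _ hφ)
    have hχ' : pa q B a (ψ + bsign b • φ) = ψ + bsign b • φ := by rw [map_add, map_smul, hψ', hφ']
    generalize ψ + bsign b • φ = χ at *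
    have hm' : (1 / 2 : ℂ) • (χ + bsign b • pa q A a χ) ∈ refSpace q :=
      Submodule.smul_mem _ _ (Submodule.add_mem _ hχ
        (Submodule.smul_mem _ _ (refSpace.pa_mem hχ A ha ha')))
    have a1 := G.meas_le hB ha (ha' B) hm'
      (fun b' => if b' then pauliProg A a (k b) else k b) s
    have w2 := (negWeight q).meas_le hB ha (ha' B) hm' (fun b' => .ret true) s
    -- Both results of the measurement of `B` have amplitude 1/2 and differ only by `A` on the
    -- ancilla, which gives the coefficient 1/4 twice.
    have e0 : (1 / 2 : ℂ) • ((1 / 2 : ℂ) • (χ + bsign b • pa q A a χ) +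
        bsign false • pa q B a ((1 / 2 : ℂ) • (χ + bsign b • pa q A a χ))) =
        (1 / 2 : ℂ) • χ := by
      simp only [map_smul, map_add, pa_anti q B A a, hBA, hχ', bsign_true, bsign_false]
      module
    have e1 : (1 / 2 : ℂ) • ((1 / 2 : ℂ) • (χ + bsign b • pa q A a χ) +
        bsign true • pa q B a ((1 / 2 : ℂ) • (χ + bsign b • pa q A a χ))) =
        bsign b • (1 / 2 : ℂ) • pa q A a χ := by
      simp only [map_smul, map_add, pa_anti q B A a, hBA, hχ', bsign_true]
      module
    rw [Fintype.sum_bool, e0, e1] at a1 w2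
    rw [if_pos rfl, if_neg (by decide)] at a1
    have a2 := G.pauli_le A a (k b) s ((1 / 2 : ℂ) • pa q A a χ)
    rw [map_smul, pa_self] at a2
    rw [G.bsign_smul] at a1
    have a3 : G.f (k b) s ((1 / 2 : ℂ) • χ) = 1 / 4 * G.f (k b) s χ := by
      rw [G.smul]; norm_num
    rw [(negWeight q).bsign_smul] at w2
    have n1 := weight_nonneg ((1 / 2 : ℂ) • χ)
    simp only [negWeight] at w2
    have w3 := G.cost_mono (φ := (1 / 2 : ℂ) • pa q A a χ)
      (ψ := (1 / 2 : ℂ) • (χ + bsign b • pa q A a χ)) (by linarith)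
    linarith
  have t3 := Finset.sum_le_sum fun b (_ : b ∈ Finset.univ) => t2 b
  rw [Finset.sum_add_distrib, ← Finset.mul_sum, ← Finset.mul_sum] at t3
  simp only [negWeight] at w1
  rw [Finset.sum_neg_distrib] at w1
  have w3 := mul_le_mul_of_nonneg_left w1 G.nonneg
  have n3 := G.cost_nonneg (ψ + pa q A a φ)
  rw [erase]
  linarith

end Val

/-! ## Clifford operations on the logical qubits -/

section Ctl

variable {n m : ℕ} {ι : Type} [Fintype ι] [DecidableEq ι] {q : Lab n m ↪ ι} {κ : ℝ}

variable (q) in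
/-- The operator `(1 + A + B - A B) / 2` for the Pauli matrices `A` on `i` and `B` on `j`. -/
def ctlMap (A B : Pauli) (i j : Lab n m) : QState ι →ₗ[ℂ] QState ι :=
  (1 / 2 : ℂ) • (LinearMap.id + pa q A i + pa q B j - pa q A i ∘ₗ pa q B j)

lemma ctlMap_apply (A B : Pauli) (i j : Lab n m) (ψ : QState ι) : ctlMap q A B i j ψ =
    (1 / 2 : ℂ) • (ψ + pa q A i ψ + pa q B j ψ - pa q A i (pa q B j ψ)) := rfl

lemma Lab.Sys.ne_cat {i : Lab n m} (hi : i.Sys) (k : Fin 4) : i ≠ .cat k := by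
  rintro rfl; exact hi

lemma Lab.Sys.ne_ref {i : Lab n m} (hi : i.Sys) (P : Pauli) : i ≠ .ref P := by
  rintro rfl; exact hi

lemma Lab.Sys.ne_scr {i : Lab n m} (hi : i.Sys) (P : Pauli) : i ≠ .scr P := by
  rintro rfl; exact hi

lemma refSpace.add_pair_mem {ψ : QState ι} (hψ : ψ ∈ refSpace q) (c : ℂ) (P Q : Pauli)
    {i j : Lab n m} (hi : ∀ k, i ≠ .cat k) (hi' : ∀ P, i ≠ .ref P) (hj : ∀ k, j ≠ .cat k)
    (hj' : ∀ P, j ≠ .ref P) : (1 / 2 : ℂ) • (ψ + c • pa q P i (pa q Q j ψ)) ∈ refSpace q :=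
  Submodule.smul_mem _ _ (Submodule.add_mem _ hψ
    (Submodule.smul_mem _ _ (refSpace.pa_mem (refSpace.pa_mem hψ Q hj hj') P hi hi')))

/-- The ancilla mediates the gate: it is correlated with `i` by `A ⊗ A`, with `j` by `B ⊗ B`, and
then erased. All eight combinations of outcomes have equal weight, and their states differ from the
desired one only by Pauli matrices on `i` and `j` and a phase. -/
lemma Val.ctl_le (G : Val q κ) {A B : Pauli} (hAB : A.anti B = true) {i j : Lab n m}
    (hij : i ≠ j) (hi : i.Sys) (hj : j.Sys) {ψ : QState ι} (hψ : ψ ∈ sysSpace q)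
    (k : Prog (Lab n m)) (s : Stack (Lab n m)) :
    G.f (ctlProg A B i j k) s ψ ≤ κ * (1000 * weight ψ) + G.f k s (ctlMap q A B i j ψ) := by
  have hA : A ≠ .I := by rintro rfl; simp [Pauli.anti] at hAB
  have hB : B ≠ .I := by rintro rfl; simp [Pauli.anti] at hAB
  have hBA : B.anti A = true := by revert hAB; cases A <;> cases B <;> decide
  set a : Lab n m := .scr B with ha
  have hac : ∀ k, a ≠ .cat k := by simp [ha]
  have har : ∀ k, a ≠ .ref k := by simp [ha]
  have hia : i ≠ a := hi.ne_scr B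
  have hja : j ≠ a := hj.ne_scr B
  have haψ : pa q B a ψ = ψ := sysSpace.scr_eq hψ B
  let φ : Bool → QState ι := fun b => (1 / 2 : ℂ) • (ψ + bsign b • pa q A i (pa q A a ψ))
  let ψ' : Bool → QState ι := fun b => (1 / 4 : ℂ) • (ψ + bsign b • pa q B j ψ)
  let φ' : Bool → Bool → QState ι := fun b₁ b₂ =>
    (1 / 4 : ℂ) • bsign b₁ • pa q A i (ψ - bsign b₂ • pa q B j ψ)
  have e2 : ∀ b₁ b₂, (1 / 2 : ℂ) • (φ b₁ + bsign b₂ • pa q B j (pa q B a (φ b₁))) =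
      ψ' b₂ + pa q A a (φ' b₁ b₂) := by
    intro b₁ b₂
    simp only [φ, ψ', φ', map_smul, map_add, map_sub, pa_comm q _ _ hia.symm,
      pa_comm q _ _ hja.symm, pa_anti q B A a, hBA, haψ, pa_comm q B A hij.symm, bsign_true]
    module
  have hφ : ∀ b, φ b ∈ refSpace q := fun b =>
    refSpace.add_pair_mem hψ.1 _ _ _ hi.ne_cat hi.ne_ref hac har
  have hψm : ∀ b, ψ' b ∈ refSpace q := fun b => Submodule.smul_mem _ _ (Submodule.add_mem _ hψ.1
    (Submodule.smul_mem _ _ (refSpace.pa_mem hψ.1 B hj.ne_cat hj.ne_ref)))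
  have hφm : ∀ b₁ b₂, φ' b₁ b₂ ∈ refSpace q := fun b₁ b₂ =>
    Submodule.smul_mem _ _ (Submodule.smul_mem _ _ (refSpace.pa_mem (Submodule.sub_mem _ hψ.1
    (Submodule.smul_mem _ _ (refSpace.pa_mem hψ.1 B hj.ne_cat hj.ne_ref))) A hi.ne_cat hi.ne_ref))
  have hψa : ∀ b, pa q B a (ψ' b) = ψ' b := by
    intro b; simp only [ψ', map_smul, map_add, pa_comm q _ _ hja.symm, haψ]
  have hφa : ∀ b₁ b₂, pa q B a (φ' b₁ b₂) = φ' b₁ b₂ := by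
    intro b₁ b₂
    simp only [φ', map_smul, map_sub, pa_comm q _ _ hia.symm, pa_comm q _ _ hja.symm, haψ]
  let k₃ : Bool → Bool → Bool → Prog (Lab n m) := fun b₁ b₂ b₃ =>
    if b₁ ^^ b₃ then pauliProg B j (if b₂ then pauliProg A i k else k)
    else if b₂ then pauliProg A i k else k
  have t1 := G.pairMeas_le hA hia hi.ne_cat hac hψ.1.1
    (fun b₁ => pairMeas .cat B j a fun b₂ => erase A B a (k₃ b₁ b₂)) s
  have w1 := (negWeight q).pairMeas_le hA hia hi.ne_cat hac hψ.1.1 (fun b => .ret true) s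
  have t2 : ∀ b₁, _ := fun b₁ => G.pairMeas_le hB hja hj.ne_cat hac (hφ b₁).1
    (fun b₂ => erase A B a (k₃ b₁ b₂)) s
  have w2 : ∀ b₁, _ := fun b₁ => (negWeight q).pairMeas_le hB hja hj.ne_cat hac (hφ b₁).1
    (fun b => .ret true) s
  have t3 : ∀ b₁ b₂, _ := fun b₁ b₂ => G.erase_le hAB hac har (hψm b₂) (hφm b₁ b₂) (hψa b₂)
    (hφa b₁ b₂) (k₃ b₁ b₂) s
  have w3 : ∀ b₁ b₂, _ := fun b₁ b₂ => (negWeight q).erase_le hAB hac har (hψm b₂) (hφm b₁ b₂)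
    (hψa b₂) (hφa b₁ b₂) (fun _ => .ret true) s
  have t4 : ∀ b₁ b₂ b₃, G.f (k₃ b₁ b₂ b₃) s (ψ' b₂ + bsign b₃ • φ' b₁ b₂) ≤
      κ * (4 * weight (ψ' b₂ + bsign b₃ • φ' b₁ b₂)) + 1 / 4 * G.f k s (ctlMap q A B i j ψ) := by
    intro b₁ b₂ b₃
    -- The first and the third outcome enter only through the product of their signs.
    have key : ∀ c : Bool, bsign c = bsign b₁ * bsign b₃ →
        ψ' b₂ + bsign b₃ • φ' b₁ b₂ = (1 / 4 : ℂ) • (ψ + bsign b₂ • pa q B j ψ +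
          bsign c • pa q A i (ψ - bsign b₂ • pa q B j ψ)) := by
      intro c hc
      simp only [ψ', φ', hc]
      module
    rw [key (b₁ ^^ b₃) (bsign_xor _ _)]
    simp only [k₃]
    generalize (b₁ ^^ b₃) = c
    set Ω := (1 / 4 : ℂ) • (ψ + bsign b₂ • pa q B j ψ +
          bsign c • pa q A i (ψ - bsign b₂ • pa q B j ψ)) with hΩ
    have n0 := G.cost_nonneg Ω
    have hu : ∀ (d : ℂ) (χ : QState ι), ‖d‖ = 1 → χ = d • (1 / 2 : ℂ) • ctlMap q A B i j ψ →
        G.f k s χ = 1 / 4 * G.f k s (ctlMap q A B i j ψ) := by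
      rintro d χ hd rfl
      rw [G.smul_unit _ _ hd, G.smul]; norm_num
    cases c <;> cases b₂ <;> simp only [if_true, if_false, Bool.false_eq_true, bsign_true,
      bsign_false] at hΩ ⊢
    · rw [hu 1 Ω (by simp) (by rw [hΩ]; simp only [ctlMap_apply, map_sub, map_smul]; module)]
      linarith
    · have b1 := G.pauli_le A i k s Ω
      rw [hu 1 (pa q A i Ω) (by simp) (by
        rw [hΩ]
        simp only [ctlMap_apply, map_sub, map_smul, map_add, pa_self]
        module)] at b1
      linarith
    · have b1 := G.pauli_le B j k s Ω
      rw [hu 1 (pa q B j Ω) (by simp) (by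
        rw [hΩ]
        simp only [ctlMap_apply, map_sub, map_smul, map_add, pa_self, pa_comm q B A hij.symm]
        module)] at b1
      linarith
    · have b1 := G.pauli_le B j (pauliProg A i k) s Ω
      have b2 := G.pauli_le A i k s (pa q B j Ω)
      rw [hu (-1) (pa q A i (pa q B j Ω)) (by simp) (by
        rw [hΩ]
        simp only [ctlMap_apply, map_sub, map_smul, map_add, pa_self, pa_comm q B A hij.symm]
        module)] at b2
      rw [weight_pa] at b2
      linarith
  have hκ := G.nonneg
  have w1' := mul_le_mul_of_nonneg_left w1 hκ
  have w2' : ∀ b₁, _ := fun b₁ => mul_le_mul_of_nonneg_left (w2 b₁) hκ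
  have w3' : ∀ b₁ b₂, _ := fun b₁ b₂ => mul_le_mul_of_nonneg_left (w3 b₁ b₂) hκ
  have e1 : ∀ b, (1 / 2 : ℂ) • (ψ + bsign b • pa q A i (pa q A a ψ)) = φ b := fun _ => rfl
  simp only [e1] at t1 w1'
  simp only [e2] at t2 w2'
  have n0 := G.cost_nonneg ψ
  change G.f (pairMeas .cat A i a fun b₁ => pairMeas .cat B j a fun b₂ =>
    erase A B a (k₃ b₁ b₂)) s ψ ≤ _
  clear_value φ ψ' φ' k₃
  simp only [Fintype.sum_bool, negWeight] at *
  linarith [t1, w1', t2 true, t2 false, w2' true, w2' false, t3 true true, t3 true false,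
    t3 false true, t3 false false, w3' true true, w3' true false, w3' false true,
    w3' false false, t4 true true true, t4 true true false, t4 true false true,
    t4 true false false, t4 false true true, t4 false true false, t4 false false true,
    t4 false false false]

end Ctl

end

noncomputable section

set_option linter.unusedSectionVars false

/-! ## Rotations and measurements of Pauli strings -/

/-- A Pauli matrix other than `A`, `B` and `1`. -/
def Pauli.avoid (A B : Pauli) : Pauli :=
  if A ≠ .X ∧ B ≠ .X then .X else if A ≠ .Y ∧ B ≠ .Y then .Y else .Z

lemma Pauli.avoid_anti_left {A : Pauli} (hA : A ≠ .I) (B : Pauli) :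
    (A.avoid B).anti A = true := by revert hA; cases A <;> cases B <;> decide

lemma Pauli.avoid_anti_right {B : Pauli} (hB : B ≠ .I) (A : Pauli) :
    (A.avoid B).anti B = true := by revert hB; cases A <;> cases B <;> decide

section StringPrograms

variable {n m : ℕ}

/-- The operator `(1 - i A B) / √2` for the Pauli matrices `A` on `i` and `B` on `j`. -/
def rotPairProg (A B : Pauli) (i j : Lab n m) (k : Prog (Lab n m)) : Prog (Lab n m) :=
  ctlProg (A.avoid B) B i j <| rotProg A i <| ctlProg (A.avoid B) B i j k

/-- The measurement of the Pauli matrices `A` on `i` and `B` on `j` together. -/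
def measPair (A B : Pauli) (i j : Lab n m) (k : Bool → Prog (Lab n m)) : Prog (Lab n m) :=
  ctlProg (A.avoid B) B i j <| meas A i fun b => ctlProg (A.avoid B) B i j (k b)

/-- The factors of a Pauli string that are not the identity. -/
def strSupport {d : ℕ} (R : Fin d → Pauli) (e : Fin d → Lab n m) : List (Pauli × Lab n m) :=
  (List.finRange d).filterMap fun a => if R a = .I then none else some (R a, e a)

/-- The operator `(1 - i R) / √2` for a Pauli string `R` on at most two qubits. -/
def rotStr {d : ℕ} (R : Fin d → Pauli) (e : Fin d → Lab n m) (k : Prog (Lab n m)) :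
    Prog (Lab n m) :=
  match strSupport R e with
  | [(A, i)] => rotProg A i k
  | [(A, i), (B, j)] => rotPairProg A B i j k
  | _ => k

/-- The measurement of a Pauli string on at most two qubits. -/
def measStr {d : ℕ} (R : Fin d → Pauli) (e : Fin d → Lab n m) (k : Bool → Prog (Lab n m)) :
    Prog (Lab n m) :=
  match strSupport R e with
  | [(A, i)] => meas A i k
  | [(A, i), (B, j)] => measPair A B i j k
  | _ => k false

/-- The Pauli string `R`. -/
def pauliStr {d : ℕ} (R : Fin d → Pauli) (e : Fin d → Lab n m) (k : Prog (Lab n m)) :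
    Prog (Lab n m) :=
  (List.finRange d).foldr (fun a k => pauliProg (R a) (e a) k) k

end StringPrograms

section Strings

variable {n m : ℕ} {ι : Type} [Fintype ι] [DecidableEq ι] {q : Lab n m ↪ ι} {κ : ℝ}

lemma norm_inv_sqrt_two_sq : ‖(1 / Real.sqrt 2 : ℂ)‖ ^ 2 = 1 / 2 := by
  rw [norm_div, norm_one, Complex.norm_real, Real.norm_of_nonneg (Real.sqrt_nonneg 2), div_pow,
    Real.sq_sqrt (by norm_num), one_pow]

lemma sysSpace.ctl_mem {ψ : QState ι} (hψ : ψ ∈ sysSpace q) (A B : Pauli) {i j : Lab n m}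
    (hi : i.Sys) (hj : j.Sys) : ctlMap q A B i j ψ ∈ sysSpace q := by
  rw [ctlMap_apply]
  exact Submodule.smul_mem _ _ (Submodule.sub_mem _ (Submodule.add_mem _ (Submodule.add_mem _ hψ
    (sysSpace.pa_mem hψ A hi)) (sysSpace.pa_mem hψ B hj))
    (sysSpace.pa_mem (sysSpace.pa_mem hψ B hj) A hi))

lemma ctlMap_ctlMap {A B : Pauli} {i j : Lab n m} (hij : i ≠ j) (ψ : QState ι) :
    ctlMap q A B i j (ctlMap q A B i j ψ) = ψ := by
  simp only [ctlMap_apply, map_smul, map_add, map_sub, pa_comm q B A hij.symm, pa_self]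
  module

/-- Conjugation by the controlled gate attaches `B` on `j` to any Pauli matrix on `i` that
anticommutes with `A`. Rotations and measurements of two-qubit strings thus reduce to those of one
qubit. -/
lemma ctlMap_pa_ctlMap {A B R : Pauli} (hAR : A.anti R = true) {i j : Lab n m} (hij : i ≠ j)
    (ψ : QState ι) : ctlMap q A B i j (pa q R i (ctlMap q A B i j ψ)) =
      pa q R i (pa q B j ψ) := by
  simp only [ctlMap_apply, map_smul, map_add, map_sub, pa_comm q B _ hij.symm, pa_self,
    pa_anti q A R i, hAR, bsign_true]
  module

namespace Val

variable (G : Val q κ)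

/-- On an eigenstate of `Q`, the matrix `R` acts as `±i` times the product matrix of `R` and `Q`,
which also anticommutes with `Q`. Measuring `R ⊗ R` and erasing the ancilla therefore leaves `ψ ∓ i
R ψ`. The wrong sign is repaired by `R`, since `R (1 + i R) = i (1 - i R)`. -/
lemma rot_le {R : Pauli} (hR : R ≠ .I) {i : Lab n m} (hi : i.Sys) {ψ : QState ι}
    (hψ : ψ ∈ sysSpace q) (k : Prog (Lab n m)) (s : Stack (Lab n m)) :
    G.f (rotProg R i k) s ψ ≤ κ * (1000 * weight ψ) +
      G.f k s ((1 / Real.sqrt 2 : ℂ) • (ψ - Complex.I • pa q R i ψ)) := by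
  set Q := R.other with hQ
  have hRQ : (R.mul Q).anti Q = true := by revert hR; rw [hQ]; cases R <;> decide
  set a : Lab n m := .scr Q with ha
  have hac : ∀ k, a ≠ .cat k := by simp [ha]
  have har : ∀ k, a ≠ .ref k := by simp [ha]
  have hia : i ≠ a := hi.ne_scr Q
  have haψ : pa q Q a ψ = ψ := sysSpace.scr_eq hψ Q
  -- The phase of the product of `R` and `R.other` is `-i` for `X` and `i` for `Y` and `Z`; this is
  -- the origin of the bit `R ≠ .X` in the program.
  obtain ⟨c, hc, hc'⟩ : ∃ c : ℂ, R.phase Q = c ∧ c = bsign (decide (R ≠ .X)) * -Complex.I := by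
    revert hR; rw [hQ]; cases R <;> simp [Pauli.phase, Pauli.other]
  let φ : Bool → QState ι := fun b => (1 / 2 : ℂ) • bsign b • c • pa q R i ψ
  have e1 : ∀ b, (1 / 2 : ℂ) • (ψ + bsign b • pa q R i (pa q R a ψ)) =
      (1 / 2 : ℂ) • ψ + pa q (R.mul Q) a (φ b) := by
    intro b
    have : pa q R a ψ = c • pa q (R.mul Q) a ψ := by rw [← hc, ← pa_mul, haψ]
    simp only [this, φ, map_smul, pa_comm q _ _ hia]
    module
  have hψm : (1 / 2 : ℂ) • ψ ∈ refSpace q := Submodule.smul_mem _ _ hψ.1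
  have hφm : ∀ b, φ b ∈ refSpace q := fun b => Submodule.smul_mem _ _ (Submodule.smul_mem _ _
    (Submodule.smul_mem _ _ (refSpace.pa_mem hψ.1 R hi.ne_cat hi.ne_ref)))
  have hψa : pa q Q a ((1 / 2 : ℂ) • ψ) = (1 / 2 : ℂ) • ψ := by rw [map_smul, haψ]
  have hφa : ∀ b, pa q Q a (φ b) = φ b := by
    intro b; simp only [φ, map_smul, pa_comm q _ _ hia.symm, haψ]
  let k₂ : Bool → Bool → Prog (Lab n m) := fun b b' =>
    if b ^^ b' ^^ decide (R ≠ .X) then pauliProg R i k else k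
  have t1 := G.pairMeas_le hR hia hi.ne_cat hac hψ.1.1
    (fun b => erase (R.mul Q) Q a (k₂ b)) s
  have w1 := (negWeight q).pairMeas_le hR hia hi.ne_cat hac hψ.1.1 (fun b => .ret true) s
  have t2 : ∀ b, _ := fun b => G.erase_le hRQ hac har hψm (hφm b) hψa (hφa b) (k₂ b) s
  have w2 : ∀ b, _ := fun b => (negWeight q).erase_le hRQ hac har hψm (hφm b) hψa (hφa b)
    (fun _ => .ret true) s
  set Ω := (1 / Real.sqrt 2 : ℂ) • (ψ - Complex.I • pa q R i ψ) with hΩ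
  have t3 : ∀ b b', G.f (k₂ b b') s ((1 / 2 : ℂ) • ψ + bsign b' • φ b) ≤
      κ * (2 * weight ((1 / 2 : ℂ) • ψ + bsign b' • φ b)) + 1 / 2 * G.f k s Ω := by
    intro b b'
    have key : ∀ d : Bool, bsign d = bsign b * (bsign b' * bsign (decide (R ≠ .X))) →
        (1 / 2 : ℂ) • ψ + bsign b' • φ b =
          (1 / 2 : ℂ) • (ψ - (bsign d * Complex.I) • pa q R i ψ) := by
      intro d hd
      simp only [φ, hc', hd]
      module
    rw [key (b ^^ b' ^^ decide (R ≠ .X)) (by simp only [bsign_xor, mul_assoc])]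
    simp only [k₂]
    generalize (b ^^ b' ^^ decide (R ≠ .X)) = d
    set Ω' := (1 / 2 : ℂ) • (ψ - (bsign d * Complex.I) • pa q R i ψ) with hΩ'
    have n0 := G.cost_nonneg Ω'
    have hs : (1 / Real.sqrt 2 : ℂ) * (1 / Real.sqrt 2 : ℂ) = 1 / 2 := sqrt_two_inv_mul
    have hu : ∀ χ : QState ι, ∀ u : ℂ, ‖u‖ = 1 → χ = u • (1 / Real.sqrt 2 : ℂ) • Ω →
        G.f k s χ = 1 / 2 * G.f k s Ω := by
      rintro χ u hu rfl
      rw [G.smul_unit _ _ hu, G.smul, norm_inv_sqrt_two_sq]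
    cases d <;> simp only [if_true, if_false, Bool.false_eq_true, bsign_true,
      bsign_false] at hΩ' ⊢
    · rw [hu Ω' 1 (by simp) (by rw [hΩ', hΩ, smul_smul _ _ (_ - _), hs]; module)]
      linarith
    · have b1 := G.pauli_le R i k s Ω'
      rw [hu (pa q R i Ω') Complex.I (by simp) (by
        rw [hΩ', hΩ, smul_smul _ _ (_ - _), hs]
        simp only [map_smul, map_sub, pa_self, smul_sub, smul_smul]
        rw [show Complex.I * (1 / 2 * Complex.I) = -(1 / 2) by
          rw [mul_left_comm, Complex.I_mul_I]; ring]
        module)] at b1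
      linarith
  have hκ := G.nonneg
  have w1' := mul_le_mul_of_nonneg_left w1 hκ
  have w2' : ∀ b, _ := fun b => mul_le_mul_of_nonneg_left (w2 b) hκ
  simp only [e1] at t1 w1'
  have n0 := G.cost_nonneg ψ
  change G.f (pairMeas .cat R i a fun b => erase (R.mul Q) Q a (k₂ b)) s ψ ≤ _
  clear_value φ k₂
  simp only [Fintype.sum_bool, negWeight] at *
  linarith [t1, w1', t2 true, t2 false, w2' true, w2' false, t3 true true, t3 true false,
    t3 false true, t3 false false]

/-- The weight bound that a reduction to a single state implies. -/
lemma weight_le_of_reduces {P k : Prog (Lab n m)} {s : Stack (Lab n m)} {ψ φ : QState ι} {c : ℝ}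
    (h : (negWeight q).f P s ψ ≤ 0 * (c * weight ψ) + (negWeight q).f k s φ) :
    weight φ ≤ weight ψ := by
  simp only [negWeight] at h; linarith

lemma rotPair_le {A B : Pauli} (hA : A ≠ .I) (hB : B ≠ .I) {i j : Lab n m} (hij : i ≠ j)
    (hi : i.Sys) (hj : j.Sys) {ψ : QState ι} (hψ : ψ ∈ sysSpace q) (k : Prog (Lab n m))
    (s : Stack (Lab n m)) :
    G.f (rotPairProg A B i j k) s ψ ≤ κ * (3000 * weight ψ) +
      G.f k s ((1 / Real.sqrt 2 : ℂ) • (ψ - Complex.I • pa q A i (pa q B j ψ))) := by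
  have hAB := Pauli.avoid_anti_right hB A
  have hAA := Pauli.avoid_anti_left hA B
  have m1 := sysSpace.ctl_mem hψ (A.avoid B) B hi hj
  set φ := ctlMap q (A.avoid B) B i j ψ with hφ
  have m2 : (1 / Real.sqrt 2 : ℂ) • (φ - Complex.I • pa q A i φ) ∈ sysSpace q :=
    Submodule.smul_mem _ _ (Submodule.sub_mem _ m1 (Submodule.smul_mem _ _
      (sysSpace.pa_mem m1 A hi)))
  have t1 := G.ctl_le hAB hij hi hj hψ (rotProg A i (ctlProg (A.avoid B) B i j k)) s
  have t2 := G.rot_le hA hi m1 (ctlProg (A.avoid B) B i j k) s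
  have t3 := G.ctl_le hAB hij hi hj m2 k s
  have w1 := weight_le_of_reduces ((negWeight q).ctl_le hAB hij hi hj hψ k s)
  have w2 := weight_le_of_reduces ((negWeight q).rot_le hA hi m1 k s)
  have e : ctlMap q (A.avoid B) B i j ((1 / Real.sqrt 2 : ℂ) • (φ - Complex.I • pa q A i φ)) =
      (1 / Real.sqrt 2 : ℂ) • (ψ - Complex.I • pa q A i (pa q B j ψ)) := by
    rw [map_smul, map_sub, map_smul, hφ, ctlMap_ctlMap hij, ctlMap_pa_ctlMap hAA hij]
  rw [e] at t3
  have w3 := G.cost_mono w1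
  have w4 := G.cost_mono (w2.trans w1)
  rw [← hφ] at *
  rw [rotPairProg]
  linarith

lemma measPair_le {A B : Pauli} (hA : A ≠ .I) (hB : B ≠ .I) {i j : Lab n m} (hij : i ≠ j)
    (hi : i.Sys) (hj : j.Sys) {ψ : QState ι} (hψ : ψ ∈ sysSpace q) (k : Bool → Prog (Lab n m))
    (s : Stack (Lab n m)) :
    G.f (measPair A B i j k) s ψ ≤ κ * (3000 * weight ψ) +
      ∑ t, G.f (k t) s ((1 / 2 : ℂ) • (ψ + bsign t • pa q A i (pa q B j ψ))) := by
  have hAB := Pauli.avoid_anti_right hB A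
  have hAA := Pauli.avoid_anti_left hA B
  have m1 := sysSpace.ctl_mem hψ (A.avoid B) B hi hj
  set φ := ctlMap q (A.avoid B) B i j ψ with hφ
  have m2 : ∀ t, (1 / 2 : ℂ) • (φ + bsign t • pa q A i φ) ∈ sysSpace q := fun t =>
    Submodule.smul_mem _ _ (Submodule.add_mem _ m1 (Submodule.smul_mem _ _
      (sysSpace.pa_mem m1 A hi)))
  have t1 := G.ctl_le hAB hij hi hj hψ (meas A i fun b => ctlProg (A.avoid B) B i j (k b)) s
  have t2 := G.meas_le hA hi.ne_cat (hi.ne_ref A) m1.1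
    (fun b => ctlProg (A.avoid B) B i j (k b)) s
  have w2 := (negWeight q).meas_le hA hi.ne_cat (hi.ne_ref A) m1.1 (fun b => .ret true) s
  have t3 : ∀ t, _ := fun t => G.ctl_le hAB hij hi hj (m2 t) (k t) s
  have w1 := weight_le_of_reduces ((negWeight q).ctl_le hAB hij hi hj hψ (.ret true) s)
  have e : ∀ t, ctlMap q (A.avoid B) B i j ((1 / 2 : ℂ) • (φ + bsign t • pa q A i φ)) =
      (1 / 2 : ℂ) • (ψ + bsign t • pa q A i (pa q B j ψ)) := by
    intro t
    rw [map_smul, map_add, map_smul, hφ, ctlMap_ctlMap hij, ctlMap_pa_ctlMap hAA hij]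
  simp only [e] at t3
  have w3 := G.cost_mono w1
  have w4 := mul_le_mul_of_nonneg_left w2 G.nonneg
  rw [← hφ] at *
  rw [measPair]
  have n0 := G.cost_nonneg ψ
  simp only [Fintype.sum_bool, negWeight] at *
  linarith [t3 true, t3 false]

end Val

/-! ### Strings -/

variable (q) in
/-- A Pauli string on the qubits `e`. -/
def strMap {d : ℕ} (R : Fin d → Pauli) (e : Fin d ↪ Lab n m) : QState ι →ₗ[ℂ] QState ι :=
  (onQubits (e.trans q) (pauliString R)).mulVecLin

lemma pauliOp_apply {κ' : Type} [Fintype κ'] [DecidableEq κ'] (P : Pauli) (i : κ')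
    (x y : κ' → Fin 2) :
    pauliOp P i x y = if ∀ a, a ≠ i → x a = y a then P.mat (x i) (y i) else 0 := by
  simp only [pauliOp, onQubits, of_apply, oneQubitOp, submatrix_apply]
  have hr : ∀ a, a ∉ Set.range (oneQubit i) ↔ a ≠ i := by
    intro a
    constructor
    · rintro h rfl; exact h ⟨0, rfl⟩
    · rintro h ⟨_, rfl⟩; exact h rfl
  simp only [hr]
  by_cases h : ∀ a, a ≠ i → x a = y a
  · rw [if_pos h, if_pos h]; rfl
  · rw [if_neg h, if_neg h]

lemma pauliString_fin_one (R : Fin 1 → Pauli) : pauliString R = pauliOp (R 0) 0 := by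
  ext x y
  rw [pauliOp_apply, if_pos (fun a ha => absurd (Subsingleton.elim a 0) ha)]
  simp [pauliString]

lemma pauliString_fin_two (R : Fin 2 → Pauli) :
    pauliString R = pauliOp (R 0) 0 * pauliOp (R 1) 1 := by
  refine op_ext fun ψ => ?_
  funext x
  rw [fin_two_fun x]
  generalize x 0 = a
  generalize x 1 = b
  have h0 : ∀ a b c : Fin 2, Function.update ![a, b] 0 c = ![c, b] := by decide
  have h1 : ∀ a b c : Fin 2, Function.update ![a, b] 1 c = ![a, c] := by decide
  rw [← mulVec_mulVec]
  simp only [pauliOp_mulVec, h0, h1]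
  simp only [mulVec, dotProduct, sum_fin_two_fun, pauliString, of_apply, Fin.prod_univ_two]
  simp
  ring

lemma strMap_one (R : Fin 1 → Pauli) (e : Fin 1 ↪ Lab n m) (ψ : QState ι) :
    strMap q R e ψ = pa q (R 0) (e 0) ψ := by
  simp only [strMap, pauliString_fin_one, onQubits_pauliOp, mulVecLin_apply, pa_apply]
  rfl

lemma strMap_two (R : Fin 2 → Pauli) (e : Fin 2 ↪ Lab n m) (ψ : QState ι) :
    strMap q R e ψ = pa q (R 0) (e 0) (pa q (R 1) (e 1) ψ) := by
  simp only [strMap, pauliString_fin_two, onQubits_mul, onQubits_pauliOp, mulVecLin_apply,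
    pa_apply, mulVec_mulVec]
  rfl

lemma strSupport_one (R : Fin 1 → Pauli) (e : Fin 1 → Lab n m) :
    strSupport R e = if R 0 = .I then [] else [(R 0, e 0)] := by
  simp only [strSupport, List.finRange_succ, List.finRange_zero]
  split_ifs <;> simp [*]

lemma strSupport_two (R : Fin 2 → Pauli) (e : Fin 2 → Lab n m) :
    strSupport R e = (if R 0 = .I then [] else [(R 0, e 0)]) ++
      (if R 1 = .I then [] else [(R 1, e 1)]) := by
  simp only [strSupport, List.finRange_succ, List.finRange_zero]
  split_ifs <;> simp [*]

lemma sysSpace.str_mem {d : ℕ} (hd : d = 1 ∨ d = 2) (R : Fin d → Pauli) {e : Fin d ↪ Lab n m}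
    (he : ∀ a, (e a).Sys) {ψ : QState ι} (hψ : ψ ∈ sysSpace q) : strMap q R e ψ ∈ sysSpace q := by
  obtain rfl | rfl := hd
  · rw [strMap_one]; exact sysSpace.pa_mem hψ _ (he _)
  · rw [strMap_two]; exact sysSpace.pa_mem (sysSpace.pa_mem hψ _ (he _)) _ (he _)

namespace Val

variable (G : Val q κ)

lemma norm_one_sub_I : ‖(1 / Real.sqrt 2 : ℂ) * (1 - Complex.I)‖ = 1 := by
  rw [← sq_eq_sq₀ (norm_nonneg _) zero_le_one, norm_mul, mul_pow, norm_inv_sqrt_two_sq,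
    Complex.sq_norm, Complex.normSq_apply]
  norm_num

lemma rotStr_le {d : ℕ} (hd : d = 1 ∨ d = 2) (R : Fin d → Pauli) {e : Fin d ↪ Lab n m}
    (he : ∀ a, (e a).Sys) {ψ : QState ι} (hψ : ψ ∈ sysSpace q) (k : Prog (Lab n m))
    (s : Stack (Lab n m)) :
    G.f (rotStr R e k) s ψ ≤ κ * (3000 * weight ψ) +
      G.f k s ((1 / Real.sqrt 2 : ℂ) • (ψ - Complex.I • strMap q R e ψ)) := by
  have n0 := G.cost_nonneg ψ
  -- A rotation about the identity string is only the global phase `(1 - i) / √2`.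
  have hI : G.f k s ((1 / Real.sqrt 2 : ℂ) • (ψ - Complex.I • ψ)) = G.f k s ψ := by
    rw [← G.smul_unit k s norm_one_sub_I ψ]
    congr 1; module
  obtain rfl | rfl := hd
  · rw [rotStr, strSupport_one, strMap_one]
    by_cases h : R 0 = .I
    · simp only [h, if_true, pa_I, hI]; linarith
    · simp only [h, if_false]
      have := G.rot_le h (he 0) hψ k s
      linarith
  · rw [rotStr, strSupport_two, strMap_two]
    by_cases h : R 0 = .I <;> by_cases h' : R 1 = .I
    · simp only [h, h', if_true, pa_I, hI, List.append_nil]; linarith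
    · simp only [h, h', if_true, if_false, pa_I, List.nil_append]
      have := G.rot_le h' (he 1) hψ k s
      linarith
    · simp only [h, h', if_true, if_false, pa_I, List.append_nil]
      have := G.rot_le h (he 0) hψ k s
      linarith
    · simp only [h, h', if_false, List.cons_append, List.nil_append]
      have := G.rotPair_le h h' (e.injective.ne (by decide)) (he 0) (he 1) hψ k s
      linarith

lemma measStr_le {d : ℕ} (hd : d = 1 ∨ d = 2) (R : Fin d → Pauli) {e : Fin d ↪ Lab n m}
    (he : ∀ a, (e a).Sys) {ψ : QState ι} (hψ : ψ ∈ sysSpace q) (k : Bool → Prog (Lab n m))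
    (s : Stack (Lab n m)) :
    G.f (measStr R e k) s ψ ≤ κ * (3000 * weight ψ) +
      ∑ t, G.f (k t) s ((1 / 2 : ℂ) • (ψ + bsign t • strMap q R e ψ)) := by
  have n0 := G.cost_nonneg ψ
  -- The identity string has the eigenvalue 1 only, so the outcome `true` carries the zero vector.
  have hI : ∑ t, G.f (k t) s ((1 / 2 : ℂ) • (ψ + bsign t • ψ)) = G.f (k false) s ψ := by
    rw [Fintype.sum_bool, show (1 / 2 : ℂ) • (ψ + bsign true • ψ) = 0 by
      rw [bsign_true]; module, G.zero, zero_add]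
    congr 1; rw [bsign_false]; module
  obtain rfl | rfl := hd
  · simp only [measStr, strSupport_one, strMap_one]
    by_cases h : R 0 = .I
    · simp only [h, if_true, pa_I, hI]; linarith
    · simp only [h, if_false]
      have := G.meas_le h (he 0).ne_cat ((he 0).ne_ref _) hψ.1 k s
      linarith
  · simp only [measStr, strSupport_two, strMap_two]
    by_cases h : R 0 = .I <;> by_cases h' : R 1 = .I
    · simp only [h, h', if_true, pa_I, hI, List.append_nil]; linarith
    · simp only [h, h', if_true, if_false, pa_I, List.nil_append]
      have := G.meas_le h' (he 1).ne_cat ((he 1).ne_ref _) hψ.1 k s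
      linarith
    · simp only [h, h', if_true, if_false, pa_I, List.append_nil]
      have := G.meas_le h (he 0).ne_cat ((he 0).ne_ref _) hψ.1 k s
      linarith
    · simp only [h, h', if_false, List.cons_append, List.nil_append]
      have := G.measPair_le h h' (e.injective.ne (by decide)) (he 0) (he 1) hψ k s
      linarith

lemma pauliStr_le {d : ℕ} (hd : d = 1 ∨ d = 2) (R : Fin d → Pauli) {e : Fin d ↪ Lab n m}
    (ψ : QState ι) (k : Prog (Lab n m)) (s : Stack (Lab n m)) :
    G.f (pauliStr R e k) s ψ ≤ κ * (4 * weight ψ) + G.f k s (strMap q R e ψ) := by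
  have n0 := G.cost_nonneg ψ
  obtain rfl | rfl := hd
  · have t1 := G.pauli_le (R 0) (e 0) k s ψ
    rw [strMap_one]
    simp only [pauliStr, List.finRange_succ, List.finRange_zero, List.map_nil, List.foldr]
    linarith
  · have t1 := G.pauli_le (R 0) (e 0) (pauliProg (R 1) (e 1) k) s ψ
    have t2 := G.pauli_le (R 1) (e 1) k s (pa q (R 0) (e 0) ψ)
    rw [pa_comm q _ _ (e.injective.ne (by decide)), weight_pa] at t2
    rw [strMap_two]
    simp only [pauliStr, List.finRange_succ, List.finRange_zero, List.map_nil, List.map_cons,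
      List.foldr]
    simp only [Fin.succ_zero_eq_one]
    linarith

end Val

end Strings

end

noncomputable section

set_option linter.unusedSectionVars false

/-! ## Decomposition of Clifford unitaries -/

section Decomposition

variable {κ : Type} [Fintype κ] [DecidableEq κ]

/-- The sign by which two Pauli strings commute. -/
def strSign (R S : κ → Pauli) : ℂ := ∏ a, bsign ((R a).anti (S a))

lemma pauliString_mul (R S : κ → Pauli) : pauliString R * pauliString S =
    (∏ a, (R a).phase (S a)) • pauliString fun a => (R a).mul (S a) := by
  ext x z
  simp only [pauliString, mul_apply, of_apply, Matrix.smul_apply, smul_eq_mul, ← Finset.prod_mul_distrib]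
  have h : ∀ a, (R a).phase (S a) * ((R a).mul (S a)).mat (x a) (z a) =
      ∑ b, (R a).mat (x a) b * (S a).mat b (z a) := by
    intro a
    rw [← Matrix.mul_apply, Pauli.mat_mul, Matrix.smul_apply, smul_eq_mul]
  simp only [h, Finset.prod_univ_sum, Fintype.piFinset_univ]

lemma pauliString_comm (R S : κ → Pauli) :
    pauliString R * pauliString S = strSign R S • (pauliString S * pauliString R) := by
  rw [pauliString_mul, pauliString_mul, smul_smul, strSign, ← Finset.prod_mul_distrib]
  simp only [← Pauli.phase_comm, Pauli.mul_comm]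

lemma pauliString_mul_self (R : κ → Pauli) : pauliString R * pauliString R = 1 := by
  have h1 : ∀ P : Pauli, P.phase P = 1 := by intro P; cases P <;> rfl
  have h2 : ∀ P : Pauli, P.mul P = .I := by intro P; cases P <;> rfl
  simp only [pauliString_mul, h1, h2, Finset.prod_const_one, one_smul]
  ext x y
  simp only [pauliString, of_apply, Pauli.mat, one_apply, Finset.prod_ite_zero, Finset.mem_univ,
    true_implies, Finset.prod_const_one, funext_iff]

lemma strSign_cases (R S : κ → Pauli) : strSign R S = 1 ∨ strSign R S = -1 := by
  refine Finset.prod_induction _ (fun c : ℂ => c = 1 ∨ c = -1) ?_ (Or.inl rfl) ?_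
  · rintro a b (rfl | rfl) (rfl | rfl) <;> simp
  · intro a _; cases (R a).anti (S a) <;> simp

/-- The operator `(1 - i R) / √2`. -/
def rotOp (R : κ → Pauli) : QOp κ := (1 / Real.sqrt 2 : ℂ) • (1 - Complex.I • pauliString R)

/-- The operator `(1 + i R) / √2`. -/
def rotInv (R : κ → Pauli) : QOp κ := (1 / Real.sqrt 2 : ℂ) • (1 + Complex.I • pauliString R)

lemma rotOp_mul_rotInv (R : κ → Pauli) : rotOp R * rotInv R = 1 := by
  simp only [rotOp, rotInv, smul_mul_smul_comm, sqrt_two_inv_mul, mul_add, sub_mul, one_mul,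
    mul_one, pauliString_mul_self, Complex.I_mul_I]
  module

lemma rotInv_mul_rotOp (R : κ → Pauli) : rotInv R * rotOp R = 1 := by
  simp only [rotOp, rotInv, smul_mul_smul_comm, sqrt_two_inv_mul, mul_sub, add_mul, one_mul,
    mul_one, pauliString_mul_self, Complex.I_mul_I]
  module

/-- Conjugation by `U` maps the Pauli string `R` to a multiple of the Pauli string `S`. -/
def MapsStr (U : QOp κ) (R S : κ → Pauli) : Prop :=
  ∃ c : ℂ, U * pauliString R = c • (pauliString S * U)

/-- The rotation commutes with `S` if `T` does. Otherwise conjugation by it multiplies `S` by `T` up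
to a phase. Thus the effect on labels is purely combinatorial. -/
lemma MapsStr.rotInv {U : QOp κ} {R S T : κ → Pauli} (h : MapsStr U R S) :
    MapsStr (rotInv T * U) R (if strSign T S = 1 then S else fun a => (T a).mul (S a)) := by
  obtain ⟨c, hc⟩ := h
  have hTS := pauliString_comm T S
  split_ifs with h1
  · refine ⟨c, ?_⟩
    rw [h1, one_smul] at hTS
    rw [Matrix.mul_assoc, hc, Matrix.mul_smul, ← Matrix.mul_assoc, ← Matrix.mul_assoc]
    congr 2
    simp only [_root_.rotInv, smul_mul_assoc, mul_smul_comm, add_mul, mul_add, one_mul, mul_one,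
      hTS]
  · have h2 := (strSign_cases T S).resolve_left h1
    have h3 : pauliString T * pauliString S * pauliString T = -pauliString S := by
      rw [hTS, h2, smul_mul_assoc, Matrix.mul_assoc, pauliString_mul_self, Matrix.mul_one,
        neg_smul, one_smul]
    have h4 : _root_.rotInv T * pauliString S =
        Complex.I • (pauliString T * pauliString S * _root_.rotInv T) := by
      simp only [_root_.rotInv, smul_mul_assoc, mul_smul_comm, add_mul, mul_add, one_mul, mul_one,
        h3, smul_add, smul_neg, smul_smul]
      rw [mul_left_comm, Complex.I_mul_I]
      module
    refine ⟨c * (Complex.I * ∏ a, (T a).phase (S a)), ?_⟩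
    rw [Matrix.mul_assoc, hc, Matrix.mul_smul, ← Matrix.mul_assoc, h4, pauliString_mul]
    simp only [smul_mul_assoc, smul_smul, mul_assoc]

/-- Pauli strings are involutions, so conjugating twice gives `c ^ 2 = 1`. -/
lemma MapsStr.coeff {U : QOp κ} (hU : IsUnit U) {R S : κ → Pauli} {c : ℂ}
    (h : U * pauliString R = c • (pauliString S * U)) : c = 1 ∨ c = -1 := by
  have h1 : U = (c * c) • U := by
    calc U = U * pauliString R * pauliString R := by
          rw [Matrix.mul_assoc, pauliString_mul_self, Matrix.mul_one]
      _ = (c * c) • U := by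
          rw [h, smul_mul_assoc, Matrix.mul_assoc, h, mul_smul_comm, ← Matrix.mul_assoc,
            pauliString_mul_self, Matrix.one_mul, smul_smul]
  have h2 : (1 - c * c) • U = 0 := by rw [sub_smul, one_smul, ← h1, sub_self]
  rcases smul_eq_zero.1 h2 with h3 | h3
  · exact mul_self_eq_one_iff.1 (sub_eq_zero.1 h3).symm
  · exact absurd h3 hU.ne_zero

/-- Conjugation preserves commutation relations: moving `U` past the product of the two strings in
both orders and comparing coefficients of an invertible operator gives the equality. -/
lemma MapsStr.strSign_eq {U : QOp κ} (hU : IsUnit U) {R S R' S' : κ → Pauli}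
    (h : MapsStr U R S) (h' : MapsStr U R' S') : strSign R R' = strSign S S' := by
  obtain ⟨c, hc⟩ := h
  obtain ⟨d, hd⟩ := h'
  have hc0 : c ≠ 0 := by rcases MapsStr.coeff hU hc with rfl | rfl <;> simp
  have hd0 : d ≠ 0 := by rcases MapsStr.coeff hU hd with rfl | rfl <;> simp
  have h1 : U * (pauliString R * pauliString R') =
      (c * d * strSign S S') • (pauliString S' * pauliString S * U) := by
    rw [← Matrix.mul_assoc, hc, smul_mul_assoc, Matrix.mul_assoc, hd, mul_smul_comm,
      ← Matrix.mul_assoc, pauliString_comm S S', smul_mul_assoc, smul_smul, smul_smul]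
  have h2 : U * (pauliString R * pauliString R') =
      (c * d * strSign R R') • (pauliString S' * pauliString S * U) := by
    rw [pauliString_comm R R', mul_smul_comm, ← Matrix.mul_assoc, hd, smul_mul_assoc,
      Matrix.mul_assoc, hc, mul_smul_comm, ← Matrix.mul_assoc, smul_smul, smul_smul]
    congr 1; ring
  have hne : pauliString S' * pauliString S * U ≠ 0 := by
    refine (((IsUnit.of_mul_eq_one _ (pauliString_mul_self S')).mul
      (IsUnit.of_mul_eq_one _ (pauliString_mul_self S))).mul hU).ne_zero
  have h3 := smul_left_injective ℂ hne (h2.symm.trans h1)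
  exact mul_left_cancel₀ (mul_ne_zero hc0 hd0) h3

/-- This is Schur's lemma for the Pauli group: commuting with every `Z` makes the matrix diagonal,
and commuting with every `X` makes the diagonal constant. -/
lemma scalar_of_commutes {M : QOp κ}
    (hX : ∀ i, M * pauliOp .X i = pauliOp .X i * M)
    (hZ : ∀ i, M * pauliOp .Z i = pauliOp .Z i * M) : M = M 0 0 • 1 := by
  have left : ∀ (P : Pauli) (i : κ) (N : QOp κ) (x y), (pauliOp P i * N) x y =
      P.mat (x i) 0 * N (Function.update x i 0) y +
        P.mat (x i) 1 * N (Function.update x i 1) y := by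
    intro P i N x y
    exact pauliOp_mulVec P i (fun z => N z y) x
  have right : ∀ (P : Pauli) (i : κ) (N : QOp κ) (x y), (N * pauliOp P i) x y =
      star (P.mat (y i) 0) * N x (Function.update y i 0) +
        star (P.mat (y i) 1) * N x (Function.update y i 1) := by
    intro P i N x y
    have h1 : (N * pauliOp P i) = (pauliOp P i * Nᴴ)ᴴ := by
      rw [conjTranspose_mul, conjTranspose_conjTranspose, pauliOp_conjTranspose]
    rw [h1, conjTranspose_apply, left, star_add, star_mul', star_mul', conjTranspose_apply,
      conjTranspose_apply, star_star, star_star]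
  have off : ∀ x y i, x i ≠ y i → M x y = 0 := by
    intro x y i hxy
    have h := congrFun (congrFun (hZ i) x) y
    rw [left, right] at h
    have hx : ∀ b, x i = b → Function.update x i b = x := by
      rintro b rfl; exact Function.update_eq_self _ _
    have hy : ∀ b, y i = b → Function.update y i b = y := by
      rintro b rfl; exact Function.update_eq_self _ _
    have f2 : ∀ b : Fin 2, b = 0 ∨ b = 1 := by decide
    rcases f2 (x i) with h0 | h0 <;> rcases f2 (y i) with h1 | h1
    · rw [h0, h1] at hxy; exact absurd rfl hxy
    · rw [h0, h1, hx 0 h0, hy 1 h1] at h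
      simp [Pauli.mat] at h
      exact self_eq_neg.1 h.symm
    · rw [h0, h1, hx 1 h0, hy 0 h1] at h
      simp [Pauli.mat] at h
      exact self_eq_neg.1 h
    · rw [h0, h1] at hxy; exact absurd rfl hxy
  have diag : ∀ x i b, M x x = M (Function.update x i b) (Function.update x i b) := by
    intro x i b
    have f2 : ∀ b c : Fin 2, b = c ∨ (b = 0 ∧ c = 1) ∨ (b = 1 ∧ c = 0) := by decide
    have hx : ∀ b, x i = b → Function.update x i b = x := by
      rintro b rfl; exact Function.update_eq_self _ _
    rcases f2 (x i) b with h0 | ⟨h0, rfl⟩ | ⟨h0, rfl⟩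
    · rw [hx b h0]
    · have h := congrFun (congrFun (hX i) x) (Function.update x i 1)
      rw [left, right, h0, Function.update_self] at h
      simpa [Pauli.mat, hx 0 h0] using h
    · have h := congrFun (congrFun (hX i) x) (Function.update x i 0)
      rw [left, right, h0, Function.update_self] at h
      simpa [Pauli.mat, hx 1 h0] using h
  have const : ∀ (s : Finset κ) x, (∀ i ∉ s, x i = 0) → M x x = M 0 0 := by
    intro s
    induction s using Finset.induction_on with
    | empty =>
      intro x hx
      have : x = 0 := funext fun i => hx i (by simp)
      rw [this]
    | insert i s _ ih =>
      intro x hx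
      rw [diag x i 0]
      refine ih _ fun j hj => ?_
      by_cases hij : j = i
      · subst hij; simp
      · rw [Function.update_of_ne hij]; exact hx j (by simp [hij, hj])
  ext x y
  by_cases hxy : x = y
  · subst hxy
    rw [const Finset.univ x (by simp)]; simp
  · obtain ⟨i, hi⟩ := Function.ne_iff.1 hxy
    rw [off x y i hi]; simp [hxy]

/-- `U` is, up to a phase, the product of a Pauli string and at most `N` rotations. -/
def IsWord (N : ℕ) (U : QOp κ) : Prop :=
  ∃ (ws : List (κ → Pauli)) (T : κ → Pauli) (c : ℂ), ws.length ≤ N ∧ ‖c‖ = 1 ∧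
    U = c • ws.foldl (fun M S => rotOp S * M) (pauliString T)

lemma IsWord.of_rotInv_mul {N : ℕ} {U : QOp κ} {S : κ → Pauli} (h : IsWord N (rotInv S * U)) :
    IsWord (N + 1) U := by
  obtain ⟨ws, T, c, hl, hc, h⟩ := h
  refine ⟨ws ++ [S], T, c, by simpa using hl, hc, ?_⟩
  rw [List.foldl_append, List.foldl_cons, List.foldl_nil, ← mul_smul_comm, ← h, ← Matrix.mul_assoc,
    rotOp_mul_rotInv, Matrix.one_mul]

lemma isUnit_rotInv_mul {U : QOp κ} (hU : U ∈ unitaryGroup (κ → Fin 2) ℂ) (S : κ → Pauli) :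
    rotInv S * U ∈ unitaryGroup (κ → Fin 2) ℂ := by
  refine mul_mem ?_ hU
  have hp : (pauliString S)ᴴ = pauliString S := by
    ext x y
    simp only [conjTranspose_apply, pauliString, of_apply, star_prod]
    refine Finset.prod_congr rfl fun a _ => ?_
    rw [← conjTranspose_apply, Pauli.mat_conjTranspose]
  have h : (rotInv S)ᴴ = rotOp S := by
    rw [rotInv, rotOp, conjTranspose_smul, conjTranspose_add, conjTranspose_one,
      conjTranspose_smul, hp]
    simp [sub_eq_add_neg]
  rw [mem_unitaryGroup_iff, star_eq_conjTranspose, h, rotInv_mul_rotOp]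

/-- A unitary that maps the Pauli matrices to multiples of themselves is a Pauli string. -/
lemma IsWord.of_fixes {U : QOp κ} (hU : U ∈ unitaryGroup (κ → Fin 2) ℂ)
    (hX : ∀ i, ∃ c : ℂ, U * pauliOp .X i = c • (pauliOp .X i * U) ∧ (c = 1 ∨ c = -1))
    (hZ : ∀ i, ∃ c : ℂ, U * pauliOp .Z i = c • (pauliOp .Z i * U) ∧ (c = 1 ∨ c = -1))
    (hS : ∀ T : κ → Pauli, ∀ i P, pauliString T * pauliOp P i =
      bsign ((T i).anti P) • (pauliOp P i * pauliString T)) : IsWord 0 U := by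
  choose cX hX hX' using hX
  choose cZ hZ hZ' using hZ
  classical
  -- On each qubit, `T` is the Pauli matrix that anticommutes with `X` or with `Z` exactly where `U`
  -- changes their sign.
  let T : κ → Pauli := fun i =>
    if cX i = 1 then (if cZ i = 1 then .I else .X) else (if cZ i = 1 then .Z else .Y)
  have n1 : (-1 : ℂ) ≠ 1 := by norm_num
  have hTX : ∀ i, bsign ((T i).anti .X) * cX i = 1 := by
    intro i
    rcases hX' i with h | h <;> rcases hZ' i with h' | h' <;> simp [T, h, h', n1, Pauli.anti]
  have hTZ : ∀ i, bsign ((T i).anti .Z) * cZ i = 1 := by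
    intro i
    rcases hX' i with h | h <;> rcases hZ' i with h' | h' <;> simp [T, h, h', n1, Pauli.anti]
  -- Multiplication by `T` cancels all signs, so the product commutes with all generators and is a
  -- scalar.
  have hM := scalar_of_commutes (M := pauliString T * U)
    (fun i => by
      rw [Matrix.mul_assoc, hX, mul_smul_comm, ← Matrix.mul_assoc, hS, smul_mul_assoc, smul_smul,
        mul_comm (cX i), hTX, one_smul, Matrix.mul_assoc])
    (fun i => by
      rw [Matrix.mul_assoc, hZ, mul_smul_comm, ← Matrix.mul_assoc, hS, smul_mul_assoc, smul_smul,
        mul_comm (cZ i), hTZ, one_smul, Matrix.mul_assoc])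
  set c := (pauliString T * U) 0 0
  have hUc : U = c • pauliString T := by
    calc U = pauliString T * (pauliString T * U) := by
          rw [← Matrix.mul_assoc, pauliString_mul_self, Matrix.one_mul]
      _ = c • pauliString T := by rw [hM, mul_smul_comm, Matrix.mul_one]
  refine ⟨[], T, c, le_rfl, ?_, hUc⟩
  have hp : (pauliString T)ᴴ = pauliString T := by
    ext x y
    simp only [conjTranspose_apply, pauliString, of_apply, star_prod]
    refine Finset.prod_congr rfl fun a _ => ?_
    rw [← conjTranspose_apply, Pauli.mat_conjTranspose]
  have h1 := mem_unitaryGroup_iff.1 hU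
  rw [star_eq_conjTranspose, hUc, conjTranspose_smul, hp, smul_mul_smul_comm,
    pauliString_mul_self] at h1
  have h2 := congrFun (congrFun h1 0) 0
  rw [Matrix.smul_apply, one_apply_eq, smul_eq_mul, mul_one, Complex.star_def,
    Complex.mul_conj'] at h2
  have h3 : ‖c‖ ^ 2 = 1 := by exact_mod_cast h2
  nlinarith [norm_nonneg c]

end Decomposition

/-! ### Words for two-qubit Clifford unitaries -/

section TwoQubits

/-- A pair of Pauli matrices as a string on two qubits. -/
def pairStr (p : Pauli × Pauli) : Fin 2 → Pauli := ![p.1, p.2]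

/-- Whether two pairs of Pauli matrices anticommute. -/
def pairAnti (p q : Pauli × Pauli) : Bool := (p.1.anti q.1).xor (p.2.anti q.2)

/-- The pair to which the rotation about `t` maps `p`. -/
def pairAct (t p : Pauli × Pauli) : Pauli × Pauli :=
  if pairAnti t p then (t.1.mul p.1, t.2.mul p.2) else p

lemma exists_pairStr (S : Fin 2 → Pauli) : ∃ p, S = pairStr p :=
  ⟨(S 0, S 1), by ext a; fin_cases a <;> rfl⟩

lemma strSign_pairStr (p q : Pauli × Pauli) :
    strSign (pairStr p) (pairStr q) = bsign (pairAnti p q) := by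
  rw [strSign, Fin.prod_univ_two, pairAnti, bsign_xor]; rfl

lemma bsign_injective : Function.Injective bsign := by
  intro a b h
  cases a <;> cases b <;> first | rfl | (exfalso; norm_num at h)

lemma MapsStr.pairAct {U : QOp (Fin 2)} {R : Fin 2 → Pauli} {p : Pauli × Pauli}
    (h : MapsStr U R (pairStr p)) (t : Pauli × Pauli) :
    MapsStr (_root_.rotInv (pairStr t) * U) R (pairStr (_root_.pairAct t p)) := by
  have := h.rotInv (T := pairStr t)
  rw [strSign_pairStr] at this
  convert this using 1
  rw [_root_.pairAct]
  cases pairAnti t p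
  · simp
  · have n1 : ¬ (-1 : ℂ) = 1 := by norm_num
    simp only [bsign_true, n1, if_true, if_false]
    ext a; fin_cases a <;> rfl

-- This and the three lemmas that follow are the four stages of a Gram–Schmidt procedure for the
-- images of `Z` and `X` on the first and then on the second qubit. At each stage two rotations
-- suffice, possibly trivial ones, and they fix the generators already in place. The hypotheses
-- record the commutation relations with these generators; each claim is a check of sixteen pairs.
set_option maxRecDepth 100000 in
lemma exists_pairAct_first (p : Pauli × Pauli) : p ≠ (.I, .I) →
    ∃ t u, pairAct u (pairAct t p) = (.Z, .I) := by
  revert p; decide +kernel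

set_option maxRecDepth 100000 in
lemma exists_pairAct_second (p : Pauli × Pauli) : pairAnti (.Z, .I) p = true →
    ∃ t u, pairAct t (.Z, .I) = (.Z, .I) ∧ pairAct u (.Z, .I) = (.Z, .I) ∧
      pairAct u (pairAct t p) = (.X, .I) := by
  revert p; decide +kernel

set_option maxRecDepth 100000 in
lemma exists_pairAct_third (p : Pauli × Pauli) : p ≠ (.I, .I) → pairAnti (.Z, .I) p = false →
    pairAnti (.X, .I) p = false →
    ∃ t u, pairAct t (.Z, .I) = (.Z, .I) ∧ pairAct u (.Z, .I) = (.Z, .I) ∧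
      pairAct t (.X, .I) = (.X, .I) ∧ pairAct u (.X, .I) = (.X, .I) ∧
      pairAct u (pairAct t p) = (.I, .Z) := by
  revert p; decide +kernel

set_option maxRecDepth 100000 in
lemma exists_pairAct_fourth (p : Pauli × Pauli) : pairAnti (.Z, .I) p = false →
    pairAnti (.X, .I) p = false → pairAnti (.I, .Z) p = true →
    ∃ t u, pairAct t (.Z, .I) = (.Z, .I) ∧ pairAct u (.Z, .I) = (.Z, .I) ∧
      pairAct t (.X, .I) = (.X, .I) ∧ pairAct u (.X, .I) = (.X, .I) ∧
      pairAct t (.I, .Z) = (.I, .Z) ∧ pairAct u (.I, .Z) = (.I, .Z) ∧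
      pairAct u (pairAct t p) = (.I, .X) := by
  revert p; decide +kernel

lemma isUnit_of_mem_unitaryGroup {κ : Type} [Fintype κ] [DecidableEq κ] {U : QOp κ}
    (hU : U ∈ unitaryGroup (κ → Fin 2) ℂ) : IsUnit U :=
  IsUnit.of_mul_eq_one _ (mem_unitaryGroup_iff.1 hU)

lemma IsClifford.mapsStr {κ : Type} [Fintype κ] [DecidableEq κ] {U : QOp κ} (hU : IsClifford U)
    (P : κ → Pauli) : ∃ Q, MapsStr U P Q := by
  obtain ⟨Q, c, h⟩ := hU.2 P
  refine ⟨Q, c, ?_⟩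
  have h1 : Uᴴ * U = 1 := by
    rw [← star_eq_conjTranspose]; exact mem_unitaryGroup_iff'.1 hU.1
  rw [← smul_mul_assoc, ← h, Matrix.mul_assoc, h1, Matrix.mul_one]

lemma MapsStr.exists_coeff {κ : Type} [Fintype κ] [DecidableEq κ] {U : QOp κ}
    (hU : U ∈ unitaryGroup (κ → Fin 2) ℂ) {R : κ → Pauli} (h : MapsStr U R R) :
    ∃ c : ℂ, U * pauliString R = c • (pauliString R * U) ∧ (c = 1 ∨ c = -1) := by
  obtain ⟨c, h⟩ := h
  exact ⟨c, h, MapsStr.coeff (isUnit_of_mem_unitaryGroup hU) h⟩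

lemma pauliString_single {κ : Type} [Fintype κ] [DecidableEq κ] (P : Pauli) (i : κ) :
    pauliString (fun a => if a = i then P else .I) = pauliOp P i := by
  ext x y
  rw [pauliOp_apply, pauliString, of_apply, ← Finset.mul_prod_erase _ _ (Finset.mem_univ i)]
  simp only [if_true]
  have h1 : ∀ a ∈ Finset.univ.erase i,
      (if a = i then P else Pauli.I).mat (x a) (y a) = if x a = y a then 1 else 0 := by
    intro a ha
    rw [if_neg (Finset.ne_of_mem_erase ha)]; simp [Pauli.mat, one_apply]
  rw [Finset.prod_congr rfl h1, Finset.prod_ite_zero, Finset.prod_const_one]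
  by_cases h : ∀ a, a ≠ i → x a = y a
  · rw [if_pos h, if_pos (fun a ha => h a (Finset.ne_of_mem_erase ha)), mul_one]
  · rw [if_neg h, if_neg (fun h' => h fun a ha => h' a (by simp [ha])), mul_zero]

lemma pauliString_mul_pauliOp {κ : Type} [Fintype κ] [DecidableEq κ] (T : κ → Pauli) (i : κ)
    (P : Pauli) : pauliString T * pauliOp P i =
      bsign ((T i).anti P) • (pauliOp P i * pauliString T) := by
  rw [← pauliString_single, pauliString_comm]
  congr 1
  have hI : ∀ P : Pauli, P.anti .I = false := by decide
  rw [strSign, Finset.prod_eq_single i]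
  · rw [if_pos rfl]
  · intro b _ hb
    rw [if_neg hb, hI]; rfl
  · simp

lemma MapsStr.pairAnti_eq {U : QOp (Fin 2)} (hU : U ∈ unitaryGroup (Fin 2 → Fin 2) ℂ)
    {p q p' q' : Pauli × Pauli} (h : MapsStr U (pairStr p) (pairStr q))
    (h' : MapsStr U (pairStr p') (pairStr q')) : pairAnti p p' = pairAnti q q' := by
  have := MapsStr.strSign_eq (isUnit_of_mem_unitaryGroup hU) h h'
  rw [strSign_pairStr, strSign_pairStr] at this
  exact bsign_injective this

lemma MapsStr.pairAct_fixes {U : QOp (Fin 2)} {R : Fin 2 → Pauli} {p t u : Pauli × Pauli}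
    (h : MapsStr U R (pairStr p)) (ht : _root_.pairAct t p = p) (hu : _root_.pairAct u p = p) :
    MapsStr (_root_.rotInv (pairStr u) * (_root_.rotInv (pairStr t) * U)) R (pairStr p) := by
  have h1 := h.pairAct t
  rw [ht] at h1
  have h2 := h1.pairAct u
  rwa [hu] at h2

lemma IsWord.of_rotInv_mul_mul {N : ℕ} {U : QOp (Fin 2)} {t u : Pauli × Pauli}
    (h : IsWord N (rotInv (pairStr u) * (rotInv (pairStr t) * U))) : IsWord (N + 2) U :=
  h.of_rotInv_mul.of_rotInv_mul

variable {U : QOp (Fin 2)} (hU : U ∈ unitaryGroup (Fin 2 → Fin 2) ℂ)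
include hU

lemma isWord_of_fixes_four (h1 : MapsStr U (pairStr (.Z, .I)) (pairStr (.Z, .I)))
    (h2 : MapsStr U (pairStr (.X, .I)) (pairStr (.X, .I)))
    (h3 : MapsStr U (pairStr (.I, .Z)) (pairStr (.I, .Z)))
    (h4 : MapsStr U (pairStr (.I, .X)) (pairStr (.I, .X))) : IsWord 0 U := by
  have e0 : ∀ P, pauliString (pairStr (P, .I)) = pauliOp P 0 := by
    intro P; rw [← pauliString_single]; congr 1; ext a; fin_cases a <;> rfl
  have e1 : ∀ P, pauliString (pairStr (.I, P)) = pauliOp P 1 := by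
    intro P; rw [← pauliString_single]; congr 1; ext a; fin_cases a <;> rfl
  refine IsWord.of_fixes hU (Fin.forall_fin_two.2 ⟨?_, ?_⟩) (Fin.forall_fin_two.2 ⟨?_, ?_⟩)
    fun T i P => pauliString_mul_pauliOp T i P
  · simpa only [e0] using h2.exists_coeff hU
  · simpa only [e1] using h4.exists_coeff hU
  · simpa only [e0] using h1.exists_coeff hU
  · simpa only [e1] using h3.exists_coeff hU

lemma isWord_of_fixes_three (h1 : MapsStr U (pairStr (.Z, .I)) (pairStr (.Z, .I)))
    (h2 : MapsStr U (pairStr (.X, .I)) (pairStr (.X, .I)))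
    (h3 : MapsStr U (pairStr (.I, .Z)) (pairStr (.I, .Z)))
    {p : Pauli × Pauli} (h4 : MapsStr U (pairStr (.I, .X)) (pairStr p)) : IsWord 2 U := by
  obtain ⟨t, u, a1, b1, a2, b2, a3, b3, h⟩ := exists_pairAct_fourth p
    (h1.pairAnti_eq hU h4).symm (h2.pairAnti_eq hU h4).symm (h3.pairAnti_eq hU h4).symm
  have h5 := (h4.pairAct t).pairAct u
  rw [h] at h5
  exact (isWord_of_fixes_four (isUnit_rotInv_mul (isUnit_rotInv_mul hU _) _)
    (h1.pairAct_fixes a1 b1) (h2.pairAct_fixes a2 b2) (h3.pairAct_fixes a3 b3)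
    h5).of_rotInv_mul_mul

lemma isWord_of_fixes_two (h1 : MapsStr U (pairStr (.Z, .I)) (pairStr (.Z, .I)))
    (h2 : MapsStr U (pairStr (.X, .I)) (pairStr (.X, .I)))
    {p q : Pauli × Pauli} (h3 : MapsStr U (pairStr (.I, .Z)) (pairStr p))
    (h4 : MapsStr U (pairStr (.I, .X)) (pairStr q)) : IsWord 4 U := by
  obtain ⟨t, u, a1, b1, a2, b2, h⟩ := exists_pairAct_third p
    -- The identity would commute with the image of `X` on the second qubit, whereas `Z` and `X` on
    -- that qubit anticommute.
    (by rintro rfl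
        have := h3.pairAnti_eq hU h4
        clear * - this; revert this; revert q; decide)
    (h1.pairAnti_eq hU h3).symm (h2.pairAnti_eq hU h3).symm
  have h5 := (h3.pairAct t).pairAct u
  rw [h] at h5
  exact (isWord_of_fixes_three (isUnit_rotInv_mul (isUnit_rotInv_mul hU _) _)
    (h1.pairAct_fixes a1 b1) (h2.pairAct_fixes a2 b2) h5
    ((h4.pairAct t).pairAct u)).of_rotInv_mul_mul

lemma isWord_of_fixes_one (h1 : MapsStr U (pairStr (.Z, .I)) (pairStr (.Z, .I)))
    {p q r : Pauli × Pauli} (h2 : MapsStr U (pairStr (.X, .I)) (pairStr p))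
    (h3 : MapsStr U (pairStr (.I, .Z)) (pairStr q))
    (h4 : MapsStr U (pairStr (.I, .X)) (pairStr r)) : IsWord 6 U := by
  obtain ⟨t, u, a1, b1, h⟩ := exists_pairAct_second p (h1.pairAnti_eq hU h2).symm
  have h5 := (h2.pairAct t).pairAct u
  rw [h] at h5
  exact (isWord_of_fixes_two (isUnit_rotInv_mul (isUnit_rotInv_mul hU _) _)
    (h1.pairAct_fixes a1 b1) h5 ((h3.pairAct t).pairAct u)
    ((h4.pairAct t).pairAct u)).of_rotInv_mul_mul

omit hU

lemma IsClifford.isWord_two (hU : IsClifford U) : IsWord 8 U := by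
  have m : ∀ p, ∃ q, MapsStr U (pairStr p) (pairStr q) := by
    intro p
    obtain ⟨Q, hQ⟩ := hU.mapsStr (pairStr p)
    obtain ⟨q, rfl⟩ := exists_pairStr Q
    exact ⟨q, hQ⟩
  obtain ⟨p, h1⟩ := m (.Z, .I)
  obtain ⟨q, h2⟩ := m (.X, .I)
  obtain ⟨_, h3⟩ := m (.I, .Z)
  obtain ⟨_, h4⟩ := m (.I, .X)
  obtain ⟨t, u, h⟩ := exists_pairAct_first p
    (by rintro rfl
        have := h1.pairAnti_eq hU.1 h2
        clear * - this; revert this; revert q; decide)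
  have h5 := (h1.pairAct t).pairAct u
  rw [h] at h5
  exact (isWord_of_fixes_one (isUnit_rotInv_mul (isUnit_rotInv_mul hU.1 _) _) h5
    ((h2.pairAct t).pairAct u) ((h3.pairAct t).pairAct u)
    ((h4.pairAct t).pairAct u)).of_rotInv_mul_mul

end TwoQubits

/-! ### Words for one-qubit Clifford unitaries -/

section OneQubit

/-- The Pauli matrix to which the rotation about `t` maps `p`. -/
def Pauli.act (t p : Pauli) : Pauli := if t.anti p then t.mul p else p

lemma strSign_const (p q : Pauli) :
    strSign (fun _ : Fin 1 => p) (fun _ => q) = bsign (p.anti q) := by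
  rw [strSign, Fin.prod_univ_one]

lemma MapsStr.act {U : QOp (Fin 1)} {R : Fin 1 → Pauli} {p : Pauli}
    (h : MapsStr U R fun _ => p) (t : Pauli) :
    MapsStr (_root_.rotInv (fun _ => t) * U) R fun _ => t.act p := by
  have := h.rotInv (T := fun _ => t)
  rw [strSign_const] at this
  convert this using 1
  ext a
  rw [Pauli.act]
  cases t.anti p
  · simp
  · have n1 : ¬ (-1 : ℂ) = 1 := by norm_num
    rw [bsign_true, if_neg n1, if_pos rfl]

/-- The rotations permute the anticommuting pairs transitively. Shorter words are padded with
rotations about the identity, which act trivially. -/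
lemma Pauli.exists_act (p q : Pauli) : p.anti q = true → ∃ t u v w,
    act w (act v (act u (act t p))) = .Z ∧ act w (act v (act u (act t q))) = .X := by
  revert p q; decide +kernel

lemma IsClifford.isWord_one {U : QOp (Fin 1)} (hU : IsClifford U) : IsWord 4 U := by
  have m : ∀ p : Pauli, ∃ q : Pauli, MapsStr U (fun _ => p) (fun _ => q) := by
    intro p
    obtain ⟨Q, hQ⟩ := hU.mapsStr fun _ => p
    refine ⟨Q 0, ?_⟩
    convert hQ using 1
    ext a; rw [Subsingleton.elim a 0]
  obtain ⟨p, h1⟩ := m .Z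
  obtain ⟨q, h2⟩ := m .X
  have h := MapsStr.strSign_eq (isUnit_of_mem_unitaryGroup hU.1) h1 h2
  rw [strSign_const, strSign_const] at h
  obtain ⟨t, u, v, w, h3, h4⟩ := Pauli.exists_act p q (bsign_injective h).symm
  have h5 := (((h1.act t).act u).act v).act w
  have h6 := (((h2.act t).act u).act v).act w
  rw [h3] at h5
  rw [h4] at h6
  have e0 : ∀ P, pauliString (fun _ => P) = pauliOp P (0 : Fin 1) := by
    intro P; rw [← pauliString_single]; congr 1; ext a; fin_cases a; rfl
  have hV := isUnit_rotInv_mul (isUnit_rotInv_mul (isUnit_rotInv_mul (isUnit_rotInv_mul hU.1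
    fun _ => t) fun _ => u) fun _ => v) fun _ => w
  have h7 : IsWord 0 _ := IsWord.of_fixes hV
    (fun i => by
      rw [Subsingleton.elim i 0]
      simpa only [e0] using h6.exists_coeff hV)
    (fun i => by
      rw [Subsingleton.elim i 0]
      simpa only [e0] using h5.exists_coeff hV) fun T i P => pauliString_mul_pauliOp T i P
  exact h7.of_rotInv_mul.of_rotInv_mul.of_rotInv_mul.of_rotInv_mul

end OneQubit

lemma IsWord.mono {κ : Type} [Fintype κ] [DecidableEq κ] {U : QOp κ} {N M : ℕ} (h : IsWord N U)
    (hNM : N ≤ M) : IsWord M U := by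
  obtain ⟨ws, T, c, hl, h⟩ := h
  exact ⟨ws, T, c, hl.trans hNM, h⟩

lemma IsClifford.isWord {d : ℕ} (hd : d = 1 ∨ d = 2) {U : QOp (Fin d)} (hU : IsClifford U) :
    IsWord 8 U := by
  rcases hd with rfl | rfl
  · exact hU.isWord_one.mono (by norm_num)
  · exact hU.isWord_two

/-! ## Clifford unitaries on the logical qubits -/

section CliffordProgram

variable {n m : ℕ} {ι : Type} [Fintype ι] [DecidableEq ι] {q : Lab n m ↪ ι} {κ : ℝ}

/-- A Pauli string, followed by rotations. -/
def cliffProg {d : ℕ} (ws : List (Fin d → Pauli)) (T : Fin d → Pauli) (e : Fin d → Lab n m)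
    (k : Prog (Lab n m)) : Prog (Lab n m) :=
  pauliStr T e (ws.foldr (fun S k => rotStr S e k) k)

lemma rotOp_mulVec {d : ℕ} (S : Fin d → Pauli) (e : Fin d ↪ Lab n m) (ψ : QState ι) :
    onQubits (e.trans q) (rotOp S) *ᵥ ψ =
      (1 / Real.sqrt 2 : ℂ) • (ψ - Complex.I • strMap q S e ψ) := by
  rw [rotOp, onQubits_smul, onQubits_sub, onQubits_one, onQubits_smul, smul_mulVec, sub_mulVec,
    one_mulVec, smul_mulVec]
  rfl

lemma rotOp_mem {d : ℕ} (hd : d = 1 ∨ d = 2) (S : Fin d → Pauli) {e : Fin d ↪ Lab n m}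
    (he : ∀ a, (e a).Sys) {ψ : QState ι} (hψ : ψ ∈ sysSpace q) :
    onQubits (e.trans q) (rotOp S) *ᵥ ψ ∈ sysSpace q := by
  rw [rotOp_mulVec]
  exact Submodule.smul_mem _ _ (Submodule.sub_mem _ hψ (Submodule.smul_mem _ _
    (sysSpace.str_mem hd S he hψ)))

namespace Val

variable (G : Val q κ)

lemma rotStrs_le {d : ℕ} (hd : d = 1 ∨ d = 2) {e : Fin d ↪ Lab n m} (he : ∀ a, (e a).Sys)
    (k : Prog (Lab n m)) (s : Stack (Lab n m)) (ws : List (Fin d → Pauli)) :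
    ∀ (M : QOp (Fin d)) {ψ : QState ι}, onQubits (e.trans q) M *ᵥ ψ ∈ sysSpace q →
      G.f (ws.foldr (fun S k => rotStr S e k) k) s (onQubits (e.trans q) M *ᵥ ψ) ≤
        κ * (3000 * ws.length * weight (onQubits (e.trans q) M *ᵥ ψ)) +
        G.f k s (onQubits (e.trans q) (ws.foldl (fun M S => rotOp S * M) M) *ᵥ ψ) := by
  induction ws with
  | nil => intro M ψ _; simp
  | cons S ws ih =>
    intro M ψ hψ
    have t1 := G.rotStr_le hd S he hψ (ws.foldr (fun S k => rotStr S e k) k) s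
    have w1 := weight_le_of_reduces ((negWeight q).rotStr_le hd S he hψ (.ret true) s)
    have m1 := rotOp_mem hd S he hψ
    rw [← rotOp_mulVec] at t1 w1
    rw [mulVec_mulVec, ← onQubits_mul] at t1 w1 m1
    have t2 := ih (rotOp S * M) m1
    have w2 := mul_le_mul_of_nonneg_left (G.cost_mono w1)
      (show (0 : ℝ) ≤ 3000 * ws.length by positivity)
    rw [List.foldr_cons, List.foldl_cons, List.length_cons]
    push_cast
    linarith

lemma cliffProg_le {d : ℕ} (hd : d = 1 ∨ d = 2) {e : Fin d ↪ Lab n m} (he : ∀ a, (e a).Sys)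
    {ψ : QState ι} (hψ : ψ ∈ sysSpace q) (ws : List (Fin d → Pauli)) (T : Fin d → Pauli)
    (k : Prog (Lab n m)) (s : Stack (Lab n m)) :
    G.f (cliffProg ws T e k) s ψ ≤ κ * ((3000 * ws.length + 4) * weight ψ) +
        G.f k s (onQubits (e.trans q)
          (ws.foldl (fun M S => rotOp S * M) (pauliString T)) *ᵥ ψ) := by
  have m1 := sysSpace.str_mem hd T he hψ
  have t1 := G.pauliStr_le hd T (e := e) ψ (ws.foldr (fun S k => rotStr S e k) k) s
  have w1 := weight_le_of_reduces ((negWeight q).pauliStr_le hd T (e := e) ψ (.ret true) s)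
  have t2 := G.rotStrs_le hd he k s ws (pauliString T) m1
  have w2 := mul_le_mul_of_nonneg_left (G.cost_mono w1)
    (show (0 : ℝ) ≤ 3000 * ws.length by positivity)
  rw [strMap, mulVecLin_apply] at t1 w1 w2
  rw [cliffProg]
  linarith

end Val

/-- A word for the Clifford unitary `U`. -/
def IsClifford.word {d : ℕ} {U : QOp (Fin d)} (hd : d = 1 ∨ d = 2) (hU : IsClifford U) :
    List (Fin d → Pauli) := (hU.isWord hd).choose

/-- The Pauli string with which the word for the Clifford unitary `U` begins. -/
def IsClifford.str {d : ℕ} {U : QOp (Fin d)} (hd : d = 1 ∨ d = 2) (hU : IsClifford U) :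
    Fin d → Pauli := (hU.isWord hd).choose_spec.choose

lemma Val.clifford_le (G : Val q κ) {d : ℕ} (hd : d = 1 ∨ d = 2) {U : QOp (Fin d)}
    (hU : IsClifford U) {e : Fin d ↪ Lab n m} (he : ∀ a, (e a).Sys) {ψ : QState ι}
    (hψ : ψ ∈ sysSpace q) (k : Prog (Lab n m)) (s : Stack (Lab n m)) :
    G.f (cliffProg (hU.word hd) (hU.str hd) e k) s ψ ≤
      κ * (25000 * weight ψ) + G.f k s (onQubits (e.trans q) U *ᵥ ψ) := by
  have t1 := G.cliffProg_le hd he hψ (hU.word hd) (hU.str hd) k s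
  obtain ⟨c, hl, hc, h⟩ := (hU.isWord hd).choose_spec.choose_spec
  change (hU.word hd).length ≤ 8 at hl
  change U = c • (hU.word hd).foldl (fun M S => rotOp S * M) (pauliString (hU.str hd)) at h
  conv_rhs => rw [h]
  rw [onQubits_smul, smul_mulVec, G.smul_unit _ _ hc]
  have hl' : ((hU.word hd).length : ℝ) ≤ 8 := by exact_mod_cast hl
  have n0 := G.cost_nonneg ψ
  nlinarith

end CliffordProgram

end

noncomputable section

set_option linter.unusedSectionVars false

/-! ## Superpositions of the basis states of ancillas -/

section Ancillas

variable {n m : ℕ} {ι : Type} [Fintype ι] [DecidableEq ι] {q : Lab n m ↪ ι} {κ : ℝ}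

lemma weight_parallelogram (φ χ : QState ι) :
    weight (φ + χ) + weight (φ - χ) = 2 * (weight φ + weight χ) := by
  simp only [weight, ← Finset.sum_add_distrib, Finset.mul_sum]
  refine Finset.sum_congr rfl fun x _ => ?_
  have := parallelogram_law_with_norm ℂ (φ x) (χ x)
  simp only [Pi.add_apply, Pi.sub_apply]
  linarith

lemma pa_Z_X (v : Lab n m) {ψ : QState ι} (h : pa q .Z v ψ = ψ) :
    pa q .Z v (pa q .X v ψ) = -pa q .X v ψ := by
  rw [pa_anti q .Z .X v, h]; simp [Pauli.anti]

/-- The two summands have opposite eigenvalues of `Z` on `v`. Applying `Z` shows that their sum and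
difference have equal weights, and the parallelogram law replaces an inner product. -/
lemma weight_add_pa_X {v : Lab n m} {φ χ : QState ι} (hφ : pa q .Z v φ = φ)
    (hχ : pa q .Z v χ = χ) : weight (φ + pa q .X v χ) = weight φ + weight χ := by
  have h1 := weight_pa q .Z v (φ + pa q .X v χ)
  rw [map_add, hφ, pa_Z_X v hχ, ← sub_eq_add_neg] at h1
  have h2 := weight_parallelogram φ (pa q .X v χ)
  rw [weight_pa] at h2
  linarith

variable (q) in
/-- The superposition of `ψ` and its image under `X` on `l`, with amplitudes `a` and `b`. -/
def comb₁ (l : Lab n m) (ψ : QState ι) (a b : ℝ) : QState ι :=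
  (a : ℂ) • ψ + (b : ℂ) • pa q .X l ψ

variable (q) in
/-- The superposition of the images of `ψ` under powers of `X` on `j` and `l`. -/
def comb₂ (j l : Lab n m) (ψ : QState ι) (a b c d : ℝ) : QState ι :=
  comb₁ q l ψ a b + pa q .X j (comb₁ q l ψ c d)

variable (q) in
/-- The superposition of the images of `ψ` under powers of `X` on `i`, `j` and `l`. -/
def comb₃ (i j l : Lab n m) (ψ : QState ι) (a b c d a' b' c' d' : ℝ) : QState ι :=
  comb₂ q j l ψ a b c d + pa q .X i (comb₂ q j l ψ a' b' c' d')

/-! ### Projections acting on the real amplitudes of ancillas -/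

section Comb

variable {i j l : Lab n m} {ψ : QState ι}

lemma comb₁_mem (hl : l.Sys) (hψ : ψ ∈ sysSpace q) (a b : ℝ) : comb₁ q l ψ a b ∈ sysSpace q :=
  Submodule.add_mem _ (Submodule.smul_mem _ _ hψ)
    (Submodule.smul_mem _ _ (sysSpace.pa_mem hψ _ hl))

lemma comb₂_mem (hj : j.Sys) (hl : l.Sys) (hψ : ψ ∈ sysSpace q) (a b c d : ℝ) :
    comb₂ q j l ψ a b c d ∈ sysSpace q :=
  Submodule.add_mem _ (comb₁_mem hl hψ _ _) (sysSpace.pa_mem (comb₁_mem hl hψ _ _) _ hj)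

lemma comb₃_mem (hi : i.Sys) (hj : j.Sys) (hl : l.Sys) (hψ : ψ ∈ sysSpace q)
    (a b c d a' b' c' d' : ℝ) : comb₃ q i j l ψ a b c d a' b' c' d' ∈ sysSpace q :=
  Submodule.add_mem _ (comb₂_mem hj hl hψ _ _ _ _)
    (sysSpace.pa_mem (comb₂_mem hj hl hψ _ _ _ _) _ hi)

lemma pa_Z_comb₁ (h : i ≠ l) (hi : pa q .Z i ψ = ψ) (a b : ℝ) :
    pa q .Z i (comb₁ q l ψ a b) = comb₁ q l ψ a b := by
  rw [comb₁, map_add, map_smul, map_smul, pa_comm q _ _ h, hi]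

lemma pa_Z_comb₂ (h : i ≠ j) (h' : i ≠ l) (hi : pa q .Z i ψ = ψ) (a b c d : ℝ) :
    pa q .Z i (comb₂ q j l ψ a b c d) = comb₂ q j l ψ a b c d := by
  rw [comb₂, map_add, pa_comm q _ _ h, pa_Z_comb₁ h' hi, pa_Z_comb₁ h' hi]

lemma weight_real_smul (a : ℝ) (ψ : QState ι) : weight ((a : ℂ) • ψ) = a ^ 2 * weight ψ := by
  rw [weight_smul, Complex.norm_real, Real.norm_eq_abs, sq_abs]

lemma weight_comb₁ (hl : pa q .Z l ψ = ψ) (a b : ℝ) :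
    weight (comb₁ q l ψ a b) = (a ^ 2 + b ^ 2) * weight ψ := by
  rw [comb₁, ← map_smul, weight_add_pa_X (by rw [map_smul, hl]) (by rw [map_smul, hl]),
    weight_real_smul, weight_real_smul]
  ring

lemma weight_comb₂ (hjl : j ≠ l) (hj : pa q .Z j ψ = ψ) (hl : pa q .Z l ψ = ψ) (a b c d : ℝ) :
    weight (comb₂ q j l ψ a b c d) = (a ^ 2 + b ^ 2 + c ^ 2 + d ^ 2) * weight ψ := by
  rw [comb₂, weight_add_pa_X (pa_Z_comb₁ hjl hj _ _) (pa_Z_comb₁ hjl hj _ _), weight_comb₁ hl,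
    weight_comb₁ hl]
  ring

lemma weight_comb₃ (hij : i ≠ j) (hil : i ≠ l) (hjl : j ≠ l) (hi : pa q .Z i ψ = ψ)
    (hj : pa q .Z j ψ = ψ) (hl : pa q .Z l ψ = ψ) (a b c d a' b' c' d' : ℝ) :
    weight (comb₃ q i j l ψ a b c d a' b' c' d') =
      (a ^ 2 + b ^ 2 + c ^ 2 + d ^ 2 + a' ^ 2 + b' ^ 2 + c' ^ 2 + d' ^ 2) * weight ψ := by
  rw [comb₃, weight_add_pa_X (pa_Z_comb₂ hij hil hi _ _ _ _) (pa_Z_comb₂ hij hil hi _ _ _ _),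
    weight_comb₂ hjl hj hl, weight_comb₂ hjl hj hl]
  ring

lemma comb₂_swap (hjl : j ≠ l) (a b c d : ℝ) :
    comb₂ q j l ψ a b c d = comb₂ q l j ψ a c b d := by
  simp only [comb₂, comb₁, map_add, map_smul, pa_comm q _ _ hjl]
  module

lemma pa_Y (i : Lab n m) (ψ : QState ι) :
    pa q .Y i ψ = Complex.I • pa q .X i (pa q .Z i ψ) := by
  rw [pa_mul, smul_smul, Pauli.phase, mul_neg, Complex.I_mul_I, neg_neg, one_smul]; rfl

/-- On a joint eigenvector, `Y ⊗ Y` equals `-c` times `X ⊗ X`. Equal bits (`c = 1`) are annihilated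
and different bits (`c = -1`) are antisymmetrised. -/
lemma sg_of_pa_Z_pa_Z (hij : i ≠ j) {c : ℂ} (h : pa q .Z i (pa q .Z j ψ) = c • ψ) :
    sg q i j ψ = ((1 - c) / 4) • (ψ - pa q .X i (pa q .X j ψ)) := by
  have h1 : pa q .Y i (pa q .Y j ψ) = -c • pa q .X i (pa q .X j ψ) := by
    rw [pa_Y, pa_Y, map_smul, map_smul, pa_comm q .Z .X hij, h, map_smul, map_smul, smul_smul,
      smul_smul, Complex.I_mul_I]
    congr 1; ring
  rw [sg_apply, h1, h]
  module

lemma sg_comb₂ (hjl : j ≠ l) (hj : pa q .Z j ψ = ψ) (hl : pa q .Z l ψ = ψ) (a b c d : ℝ) :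
    sg q j l (comb₂ q j l ψ a b c d) = comb₂ q j l ψ 0 ((b - c) / 2) ((c - b) / 2) 0 := by
  have h1 := sg_of_pa_Z_pa_Z (q := q) hjl (ψ := ψ) (c := 1) (by rw [hl, hj, one_smul])
  have h2 := sg_of_pa_Z_pa_Z (q := q) hjl (ψ := pa q .X l ψ) (c := -1) (by
    rw [pa_Z_X l hl, map_neg, pa_comm q _ _ hjl, hj, neg_one_smul])
  have h3 := sg_of_pa_Z_pa_Z (q := q) hjl (ψ := pa q .X j ψ) (c := -1) (by
    rw [pa_comm q _ _ hjl.symm, hl, pa_Z_X j hj, neg_one_smul])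
  have h4 := sg_of_pa_Z_pa_Z (q := q) hjl (ψ := pa q .X j (pa q .X l ψ)) (c := 1) (by
    rw [pa_comm q _ _ hjl.symm, pa_Z_X l hl, map_neg, map_neg, pa_Z_X j (by
      rw [pa_comm q _ _ hjl, hj]), neg_neg, one_smul])
  have h5 : pa q .X j (pa q .X l (pa q .X j ψ)) = pa q .X l ψ := by
    rw [pa_comm q _ _ hjl.symm, pa_self]
  simp only [comb₂, comb₁, map_add, map_smul, h1, h2, h3, h4, h5, pa_self]
  push_cast
  module

lemma pa_X_comb₂ (a b c d : ℝ) :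
    pa q .X j (comb₂ q j l ψ a b c d) = comb₂ q j l ψ c d a b := by
  rw [comb₂, comb₂, map_add, pa_self, add_comm]

lemma pa_Z_left_comb₂ (hjl : j ≠ l) (hj : pa q .Z j ψ = ψ) (a b c d : ℝ) :
    pa q .Z j (comb₂ q j l ψ a b c d) = comb₂ q j l ψ a b (-c) (-d) := by
  rw [comb₂, comb₂, map_add, pa_Z_X j (pa_Z_comb₁ hjl hj _ _), pa_Z_comb₁ hjl hj]
  simp only [comb₁, map_add, map_smul]
  push_cast
  module

lemma pa_Z_right_comb₂ (hjl : j ≠ l) (hl : pa q .Z l ψ = ψ) (a b c d : ℝ) :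
    pa q .Z l (comb₂ q j l ψ a b c d) = comb₂ q j l ψ a (-b) c (-d) := by
  rw [comb₂_swap hjl, pa_Z_left_comb₂ hjl.symm hl, comb₂_swap hjl]

lemma comb₂_add_smul (t a b c d a' b' c' d' : ℝ) :
    comb₂ q j l ψ a b c d + (t : ℂ) • comb₂ q j l ψ a' b' c' d' =
      comb₂ q j l ψ (a + t * a') (b + t * b') (c + t * c') (d + t * d') := by
  simp only [comb₂, comb₁, map_add, map_smul]
  push_cast
  module

lemma comb₂_smul (t a b c d : ℝ) : (t : ℂ) • comb₂ q j l ψ a b c d =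
      comb₂ q j l ψ (t * a) (t * b) (t * c) (t * d) := by
  simp only [comb₂, comb₁, map_add, map_smul]
  push_cast
  module

lemma comb₃_add_smul (t a b c d a' b' c' d' x y z w x' y' z' w' : ℝ) :
    comb₃ q i j l ψ a b c d a' b' c' d' + (t : ℂ) • comb₃ q i j l ψ x y z w x' y' z' w' =
      comb₃ q i j l ψ (a + t * x) (b + t * y) (c + t * z) (d + t * w) (a' + t * x') (b' + t * y')
        (c' + t * z') (d' + t * w') := by
  simp only [comb₃, ← comb₂_add_smul, map_add, map_smul]
  module

lemma comb₃_smul (t a b c d a' b' c' d' : ℝ) : (t : ℂ) • comb₃ q i j l ψ a b c d a' b' c' d' =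
      comb₃ q i j l ψ (t * a) (t * b) (t * c) (t * d) (t * a') (t * b') (t * c') (t * d') := by
  simp only [comb₃, ← comb₂_smul, map_smul, smul_add]

lemma comb₃_sub (a b c d a' b' c' d' x y z w x' y' z' w' : ℝ) :
    comb₃ q i j l ψ a b c d a' b' c' d' - comb₃ q i j l ψ x y z w x' y' z' w' =
      comb₃ q i j l ψ (a - x) (b - y) (c - z) (d - w) (a' - x') (b' - y') (c' - z') (d' - w') := by
  have := comb₃_add_smul (q := q) (i := i) (j := j) (l := l) (ψ := ψ) (-1) a b c d a' b' c' d'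
    x y z w x' y' z' w'
  rw [sub_eq_add_neg, ← neg_one_smul ℂ]
  push_cast at this
  rw [this]
  congr 1 <;> ring

lemma comb₃_rotate (hij : i ≠ j) (hil : i ≠ l) (hjl : j ≠ l) (a b c d a' b' c' d' : ℝ) :
    comb₃ q i j l ψ a b c d a' b' c' d' = comb₃ q l i j ψ a c a' c' b d b' d' := by
  simp only [comb₃, comb₂, comb₁, map_add, map_smul, pa_comm q .X .X hjl, pa_comm q .X .X hil,
    pa_comm q .X .X hij]
  module

variable (hij : i ≠ j) (hil : i ≠ l) (hjl : j ≠ l) (hi : pa q .Z i ψ = ψ)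
  (hj : pa q .Z j ψ = ψ) (hl : pa q .Z l ψ = ψ)

include hij hil hjl hj hl in
lemma sg_comb₃ (a b c d a' b' c' d' : ℝ) : sg q j l (comb₃ q i j l ψ a b c d a' b' c' d') =
    comb₃ q i j l ψ 0 ((b - c) / 2) ((c - b) / 2) 0 0 ((b' - c') / 2) ((c' - b') / 2) 0 := by
  rw [comb₃, map_add, sg_comm_pa _ hij.symm hil.symm, sg_comb₂ hjl hj hl, sg_comb₂ hjl hj hl]
  rfl

include hij hil hjl hi hj in
lemma sg_left_comb₃ (a b c d a' b' c' d' : ℝ) :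
    sg q i j (comb₃ q i j l ψ a b c d a' b' c' d') =
    comb₃ q i j l ψ 0 0 ((c - a') / 2) ((d - b') / 2) ((a' - c) / 2) ((b' - d) / 2) 0 0 := by
  rw [comb₃_rotate hij hil hjl, sg_comb₃ hil.symm hjl.symm hij hi hj, ← comb₃_rotate hij hil hjl]

include hij hil hjl hl in
lemma proj_right_comb₃ (t : Bool) (a b c d a' b' c' d' : ℝ) :
    (1 / 2 : ℂ) • (comb₃ q i j l ψ a b c d a' b' c' d' +
      bsign t • pa q .Z l (comb₃ q i j l ψ a b c d a' b' c' d')) =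
    if t then comb₃ q i j l ψ 0 b 0 d 0 b' 0 d' else comb₃ q i j l ψ a 0 c 0 a' 0 c' 0 := by
  have h : pa q .Z l (comb₃ q i j l ψ a b c d a' b' c' d') =
      comb₃ q i j l ψ a (-b) c (-d) a' (-b') c' (-d') := by
    rw [comb₃, map_add, pa_comm q _ _ hil.symm, pa_Z_right_comb₂ hjl hl, pa_Z_right_comb₂ hjl hl]
    rfl
  have e1 : bsign t = ((if t then -1 else 1 : ℝ) : ℂ) := by cases t <;> simp
  have e2 : (1 / 2 : ℂ) = ((1 / 2 : ℝ) : ℂ) := by push_cast; rfl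
  rw [h, e1, e2, comb₃_add_smul, comb₃_smul]
  cases t <;> simp <;> congr 1 <;> ring

include hij hjl hj in
lemma proj_mid_comb₃ (t : Bool) (a b c d a' b' c' d' : ℝ) :
    (1 / 2 : ℂ) • (comb₃ q i j l ψ a b c d a' b' c' d' +
      bsign t • pa q .Z j (comb₃ q i j l ψ a b c d a' b' c' d')) =
    if t then comb₃ q i j l ψ 0 0 c d 0 0 c' d' else comb₃ q i j l ψ a b 0 0 a' b' 0 0 := by
  have h : pa q .Z j (comb₃ q i j l ψ a b c d a' b' c' d') =
      comb₃ q i j l ψ a b (-c) (-d) a' b' (-c') (-d') := by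
    rw [comb₃, map_add, pa_comm q _ _ hij.symm, pa_Z_left_comb₂ hjl hj, pa_Z_left_comb₂ hjl hj]
    rfl
  have e1 : bsign t = ((if t then -1 else 1 : ℝ) : ℂ) := by cases t <;> simp
  have e2 : (1 / 2 : ℂ) = ((1 / 2 : ℝ) : ℂ) := by push_cast; rfl
  rw [h, e1, e2, comb₃_add_smul, comb₃_smul]
  cases t <;> simp <;> congr 1 <;> ring

include hij in
lemma pa_X_mid_comb₃ (a b c d a' b' c' d' : ℝ) :
    pa q .X j (comb₃ q i j l ψ a b c d a' b' c' d') =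
      comb₃ q i j l ψ c d a b c' d' a' b' := by
  rw [comb₃, map_add, pa_comm q _ _ hij.symm, pa_X_comb₂, pa_X_comb₂]
  rfl

end Comb

/-- Return the qubit `i` to the state `|0⟩`. -/
def reset (i : Lab n m) (k : Prog (Lab n m)) : Prog (Lab n m) :=
  meas .Z i fun b => if b then .x i k else k

namespace Val

variable (G : Val q κ)

/-- The measurement turns the superposition of the two components into a mixture, and the flip
brings the second one to the same state of `i`. -/
lemma reset_le {i : Lab n m} (hi : i.Sys) {φ χ : QState ι} (hφ : φ ∈ sysSpace q)
    (hχ : χ ∈ sysSpace q) (hφ' : pa q .Z i φ = φ) (hχ' : pa q .Z i χ = χ) (k : Prog (Lab n m))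
    (s : Stack (Lab n m)) :
    G.f (reset i k) s (φ + pa q .X i χ) ≤ κ * (221 * (weight φ + weight χ)) +
      (G.f k s φ + G.f k s χ) := by
  have t1 := G.meas_le (P := .Z) (by decide) hi.ne_cat (hi.ne_ref _)
    (Submodule.add_mem _ hφ (sysSpace.pa_mem hχ .X hi)).1 (fun b => if b then .x i k else k) s
  have t2 := G.x_le i k s (pa q .X i χ)
  have e1 : (1 / 2 : ℂ) • (φ + pa q .X i χ + bsign true • pa q .Z i (φ + pa q .X i χ)) =
      pa q .X i χ := by
    rw [map_add, hφ', pa_Z_X i hχ', bsign_true]; module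
  have e0 : (1 / 2 : ℂ) • (φ + pa q .X i χ + bsign false • pa q .Z i (φ + pa q .X i χ)) = φ := by
    rw [map_add, hφ', pa_Z_X i hχ', bsign_false]; module
  rw [Fintype.sum_bool, e1, e0, if_pos rfl, if_neg (by decide), weight_add_pa_X hφ' hχ'] at t1
  rw [pa_self, weight_pa] at t2
  have n1 := G.cost_nonneg φ
  rw [reset]
  linarith

variable {i j l : Lab n m} {ψ : QState ι}

lemma reset_comb₁_le (hl : l.Sys) (hψ : ψ ∈ sysSpace q) (hl' : pa q .Z l ψ = ψ)
    (k : Prog (Lab n m)) (s : Stack (Lab n m)) (a b : ℝ) :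
    G.f (reset l k) s (comb₁ q l ψ a b) ≤ κ * (221 * ((a ^ 2 + b ^ 2) * weight ψ)) +
      (a ^ 2 + b ^ 2) * G.f k s ψ := by
  have h := G.reset_le hl (Submodule.smul_mem _ (a : ℂ) hψ) (Submodule.smul_mem _ (b : ℂ) hψ)
    (by rw [map_smul, hl']) (by rw [map_smul, hl']) k s
  rw [weight_real_smul, weight_real_smul, G.smul, G.smul, map_smul, Complex.norm_real,
    Complex.norm_real, Real.norm_eq_abs, Real.norm_eq_abs, sq_abs, sq_abs] at h
  rw [comb₁]
  linarith

lemma reset_comb₂_le (hj : j.Sys) (hl : l.Sys) (hjl : j ≠ l) (hψ : ψ ∈ sysSpace q)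
    (hj' : pa q .Z j ψ = ψ) (hl' : pa q .Z l ψ = ψ) (k : Prog (Lab n m)) (s : Stack (Lab n m))
    (a b c d : ℝ) :
    G.f (reset j (reset l k)) s (comb₂ q j l ψ a b c d) ≤
      κ * (442 * ((a ^ 2 + b ^ 2 + c ^ 2 + d ^ 2) * weight ψ)) +
      (a ^ 2 + b ^ 2 + c ^ 2 + d ^ 2) * G.f k s ψ := by
  have h := G.reset_le hj (comb₁_mem hl hψ a b) (comb₁_mem hl hψ c d) (pa_Z_comb₁ hjl hj' _ _)
    (pa_Z_comb₁ hjl hj' _ _) (reset l k) s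
  have h1 := G.reset_comb₁_le hl hψ hl' k s a b
  have h2 := G.reset_comb₁_le hl hψ hl' k s c d
  rw [weight_comb₁ hl', weight_comb₁ hl'] at h
  rw [comb₂]
  linarith

lemma reset_comb₃_le (hi : i.Sys) (hj : j.Sys) (hl : l.Sys) (hij : i ≠ j) (hil : i ≠ l)
    (hjl : j ≠ l) (hψ : ψ ∈ sysSpace q) (hi' : pa q .Z i ψ = ψ) (hj' : pa q .Z j ψ = ψ)
    (hl' : pa q .Z l ψ = ψ) (k : Prog (Lab n m)) (s : Stack (Lab n m))
    (a b c d a' b' c' d' : ℝ) :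
    G.f (reset i (reset j (reset l k))) s (comb₃ q i j l ψ a b c d a' b' c' d') ≤
      κ * (663 * ((a ^ 2 + b ^ 2 + c ^ 2 + d ^ 2 + a' ^ 2 + b' ^ 2 + c' ^ 2 + d' ^ 2) *
        weight ψ)) +
      (a ^ 2 + b ^ 2 + c ^ 2 + d ^ 2 + a' ^ 2 + b' ^ 2 + c' ^ 2 + d' ^ 2) * G.f k s ψ := by
  have h := G.reset_le hi (comb₂_mem hj hl hψ a b c d) (comb₂_mem hj hl hψ a' b' c' d')
    (pa_Z_comb₂ hij hil hi' _ _ _ _) (pa_Z_comb₂ hij hil hi' _ _ _ _) (reset j (reset l k)) s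
  have h1 := G.reset_comb₂_le hj hl hjl hψ hj' hl' k s a b c d
  have h2 := G.reset_comb₂_le hj hl hjl hψ hj' hl' k s a' b' c' d'
  rw [weight_comb₂ hjl hj' hl', weight_comb₂ hjl hj' hl'] at h
  rw [comb₃]
  linarith

end Val

end Ancillas

/-! ## Magic states by Newton iteration -/

section Magic

variable {n m : ℕ} {ι : Type} [Fintype ι] [DecidableEq ι] {q : Lab n m ↪ ι} {κ : ℝ}

/-- One step of Newton's iteration: from two qubits in the state `|0⟩ + r |1⟩`, prepare `i` in
the state `|0⟩ + (1 / r + r / 2) |1⟩`, or return all qubits to `|0⟩`. -/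
def newton (i j : Lab n m) : Prog (Lab n m) :=
  let fail := reset i (reset j (reset .w (.ret false)))
  .st j .w fun b => if b then fail else meas .Z .w fun b => if b then fail else
    .x j (.st i j fun b => if b then fail else meas .Z j fun b => if b then fail else .ret true)

/-- Prepare `i` in the state `|0⟩ + r |1⟩`, where `r` is the result of `j` steps of Newton's
iteration for the square root of `2`. -/
def prep : (j : ℕ) → j ≤ m → Lab n m → Prog (Lab n m) → Prog (Lab n m)
  | 0, _, i, k => meas .X i fun b => if b then .z i k else k
  | j + 1, h, i, k =>
    .loop (prep j (Nat.le_of_succ_le h) i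
      (prep j (Nat.le_of_succ_le h) (.y ⟨j, h⟩) (newton i (.y ⟨j, h⟩)))) k

/-- Newton's iteration for the square root of `2`. -/
def newtonSeq : ℕ → ℝ
  | 0 => 1
  | j + 1 => 1 / newtonSeq j + newtonSeq j / 2

/-- The lower bound keeps the iteration away from the pole at zero; it is also used to bound the
success probabilities from below. -/
lemma newtonSeq_bounds (j : ℕ) : 1 ≤ newtonSeq j ∧ newtonSeq j ≤ 3 / 2 := by
  induction j with
  | zero => norm_num [newtonSeq]
  | succ j ih =>
    obtain ⟨h1, h2⟩ := ih
    have h0 : 0 < newtonSeq j := by linarith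
    rw [newtonSeq]
    constructor
    · rw [div_add_div _ _ h0.ne' (by norm_num), le_div_iff₀ (by positivity)]
      nlinarith [sq_nonneg (newtonSeq j - 1)]
    · rw [div_add_div _ _ h0.ne' (by norm_num), div_le_iff₀ (by positivity)]
      nlinarith

/-- Newton's step maps the error `d` at the point `r` to `d ^ 2 / (2 r)`, and `r ≥ 1`. The factor 2
in the bound makes it reproduce itself under `d ^ 2 / 2`. -/
lemma abs_newtonSeq_sub_le (j : ℕ) :
    |newtonSeq j - Real.sqrt 2| ≤ 2 * (1 / 4) ^ 2 ^ j := by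
  have h2 : Real.sqrt 2 * Real.sqrt 2 = 2 := Real.mul_self_sqrt (by norm_num)
  have h3 : 0 ≤ Real.sqrt 2 := Real.sqrt_nonneg 2
  induction j with
  | zero =>
    rw [newtonSeq, abs_le]
    constructor <;> norm_num <;> nlinarith
  | succ j ih =>
    obtain ⟨h1, -⟩ := newtonSeq_bounds j
    have h0 : 0 < newtonSeq j := by linarith
    have e : newtonSeq (j + 1) - Real.sqrt 2 =
        (newtonSeq j - Real.sqrt 2) ^ 2 / (2 * newtonSeq j) := by
      rw [newtonSeq]; field_simp; linear_combination (-1 : ℝ) * h2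
    rw [e, abs_of_nonneg (by positivity), ← sq_abs]
    calc |newtonSeq j - Real.sqrt 2| ^ 2 / (2 * newtonSeq j)
        ≤ |newtonSeq j - Real.sqrt 2| ^ 2 / 2 :=
          div_le_div_of_nonneg_left (by positivity) (by norm_num) (by linarith)
      _ ≤ (2 * (1 / 4) ^ 2 ^ j) ^ 2 / 2 := by gcongr
      _ = 2 * (1 / 4) ^ 2 ^ (j + 1) := by rw [pow_succ 2 j, pow_mul]; ring

namespace Val

variable (G : Val q κ)

/-- Follow the amplitudes of `|00⟩, |01⟩, |10⟩, |11⟩` on `i, j`, initially `1, r, r, r ^ 2`. The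
triplet outcome on `j, w` followed by `w = 0` halves those with `j = 1`, giving `1, r / 2, r, r ^ 2
/ 2`. After `X` on `j` the triplet outcome on `i, j` replaces the two middle ones by their mean `1 /
2 + r ^ 2 / 4`, and `j = 0` selects `r / 2` and this mean, whose ratio is `1 / r + r / 2`. All other
branches end in `ψ` again, with the complementary total coefficient. -/
lemma newton_le {i j : Lab n m} {ψ : QState ι} (hi : i.Sys) (hj : j.Sys) (hij : i ≠ j)
    (hil : i ≠ .w) (hjl : j ≠ .w) (hψ : ψ ∈ sysSpace q) (hi' : pa q .Z i ψ = ψ)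
    (hj' : pa q .Z j ψ = ψ) (hl' : pa q .Z .w ψ = ψ) (s : Stack (Lab n m)) (r : ℝ) :
    G.f (newton i j) s (comb₃ q i j .w ψ 1 0 r 0 r 0 (r ^ 2) 0) ≤
      κ * (3000 * ((1 + r ^ 2) ^ 2 * weight ψ)) +
      G.f (.ret true) s (comb₁ q i ψ (r / 2) (1 / 2 + r ^ 2 / 4)) +
      ((1 + r ^ 2) ^ 2 - (r ^ 2 / 4 + (1 / 2 + r ^ 2 / 4) ^ 2)) * G.f (.ret false) s ψ := by
  have hl : (Lab.w : Lab n m).Sys := trivial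
  have W := weight_comb₃ hij hil hjl hi' hj' hl'
  have F := G.reset_comb₃_le hi hj hl hij hil hjl hψ hi' hj' hl' (.ret false) s
  have M := comb₃_mem (q := q) hi hj hl hψ
  have t1 := G.st_le j .w (fun b => if b then reset i (reset j (reset .w (.ret false))) else
    meas .Z .w fun b => if b then reset i (reset j (reset .w (.ret false))) else
      .x j (.st i j fun b => if b then reset i (reset j (reset .w (.ret false))) else
        meas .Z j fun b => if b then reset i (reset j (reset .w (.ret false))) else .ret true))
    s (comb₃ q i j .w ψ 1 0 r 0 r 0 (r ^ 2) 0) hjl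
  rw [sg_comb₃ hij hil hjl hj' hl', comb₃_sub, W, if_pos rfl, if_neg (by decide)] at t1
  have t2 := F 0 ((0 - r) / 2) ((r - 0) / 2) 0 0 ((0 - r ^ 2) / 2) ((r ^ 2 - 0) / 2) 0
  have t3 := G.meas_le (P := .Z) (by decide) hl.ne_cat (hl.ne_ref _)
    (M (1 - 0) (0 - (0 - r) / 2) (r - (r - 0) / 2) (0 - 0) (r - 0) (0 - (0 - r ^ 2) / 2)
      (r ^ 2 - (r ^ 2 - 0) / 2) (0 - 0)).1
    (fun b => if b then reset i (reset j (reset .w (.ret false))) else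
      .x j (.st i j fun b => if b then reset i (reset j (reset .w (.ret false))) else
        meas .Z j fun b => if b then reset i (reset j (reset .w (.ret false))) else .ret true)) s
  simp only [proj_right_comb₃ hij hil hjl hl'] at t3
  rw [Fintype.sum_bool, W, if_pos rfl, if_pos rfl, if_neg (by decide), if_neg (by decide)] at t3
  have t4 := F 0 (0 - (0 - r) / 2) 0 (0 - 0) 0 (0 - (0 - r ^ 2) / 2) 0 (0 - 0)
  have t5 := G.x_le j (.st i j fun b => if b then reset i (reset j (reset .w (.ret false))) else
        meas .Z j fun b => if b then reset i (reset j (reset .w (.ret false))) else .ret true) s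
    (comb₃ q i j .w ψ (1 - 0) 0 (r - (r - 0) / 2) 0 (r - 0) 0 (r ^ 2 - (r ^ 2 - 0) / 2) 0)
  rw [pa_X_mid_comb₃ hij, W] at t5
  have t6 := G.st_le i j (fun b => if b then reset i (reset j (reset .w (.ret false))) else
        meas .Z j fun b => if b then reset i (reset j (reset .w (.ret false))) else .ret true) s
    (comb₃ q i j .w ψ (r - (r - 0) / 2) 0 (1 - 0) 0 (r ^ 2 - (r ^ 2 - 0) / 2) 0 (r - 0) 0) hij
  rw [sg_left_comb₃ hij hil hjl hi' hj', comb₃_sub, W, if_pos rfl, if_neg (by decide)] at t6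
  have t7 := F 0 0 ((1 - 0 - (r ^ 2 - (r ^ 2 - 0) / 2)) / 2) ((0 - 0) / 2)
    ((r ^ 2 - (r ^ 2 - 0) / 2 - (1 - 0)) / 2) ((0 - 0) / 2) 0 0
  have t8 := G.meas_le (P := .Z) (by decide) hj.ne_cat (hj.ne_ref _)
    (M (r - (r - 0) / 2 - 0) (0 - 0) (1 - 0 - (1 - 0 - (r ^ 2 - (r ^ 2 - 0) / 2)) / 2)
      (0 - (0 - 0) / 2)
      (r ^ 2 - (r ^ 2 - 0) / 2 - (r ^ 2 - (r ^ 2 - 0) / 2 - (1 - 0)) / 2) (0 - (0 - 0) / 2)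
      (r - 0 - 0) (0 - 0)).1
    (fun b => if b then reset i (reset j (reset .w (.ret false))) else .ret true) s
  simp only [proj_mid_comb₃ hij hjl hj'] at t8
  rw [Fintype.sum_bool, W, if_pos rfl, if_pos rfl, if_neg (by decide), if_neg (by decide)] at t8
  have t9 := F 0 0 (1 - 0 - (1 - 0 - (r ^ 2 - (r ^ 2 - 0) / 2)) / 2)
      (0 - (0 - 0) / 2) 0 0 (r - 0 - 0) (0 - 0)
  have e : comb₃ q i j .w ψ (r - (r - 0) / 2 - 0) (0 - 0) 0 0
      (r ^ 2 - (r ^ 2 - 0) / 2 - (r ^ 2 - (r ^ 2 - 0) / 2 - (1 - 0)) / 2) (0 - (0 - 0) / 2) 0 0 =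
      comb₁ q i ψ (r / 2) (1 / 2 + r ^ 2 / 4) := by
    simp only [comb₃, comb₂, comb₁, map_add, map_smul]
    push_cast
    module
  rw [e] at t8
  have n0 := G.cost_nonneg ψ
  have n2 : 0 ≤ r ^ 2 * (κ * weight ψ) := by positivity
  have n4 : 0 ≤ r ^ 4 * (κ * weight ψ) := by positivity
  rw [newton]
  clear W F M
  ring_nf at *
  linarith

lemma comb₁_smul (l : Lab n m) (ψ : QState ι) (t a b : ℝ) :
    (t : ℂ) • comb₁ q l ψ a b = comb₁ q l ψ (t * a) (t * b) := by
  simp only [comb₁]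
  push_cast
  module

lemma prep_zero_le {i : Lab n m} (hi : i.Sys) {ψ : QState ι} (hψ : ψ ∈ sysSpace q)
    (hi' : pa q .Z i ψ = ψ) (k : Prog (Lab n m)) (s : Stack (Lab n m)) :
    G.f (meas .X i fun b => if b then .z i k else k) s ψ ≤ κ * (221 * weight ψ) +
      1 / 2 * G.f k s (comb₁ q i ψ 1 1) := by
  have t1 := G.meas_le (P := .X) (by decide) hi.ne_cat (hi.ne_ref _) hψ.1
    (fun b => if b then .z i k else k) s
  have t2 := G.z_le i k s ((1 / 2 : ℂ) • (ψ + bsign true • pa q .X i ψ))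
  have e1 : pa q .Z i ((1 / 2 : ℂ) • (ψ + bsign true • pa q .X i ψ)) =
      (1 / 2 : ℂ) • comb₁ q i ψ 1 1 := by
    rw [map_smul, map_add, map_smul, pa_Z_X i hi', hi', comb₁, bsign_true]
    push_cast
    module
  have e0 : (1 / 2 : ℂ) • (ψ + bsign false • pa q .X i ψ) = (1 / 2 : ℂ) • comb₁ q i ψ 1 1 := by
    rw [comb₁, bsign_false]
    push_cast
    module
  have e2 : weight ((1 / 2 : ℂ) • (ψ + bsign true • pa q .X i ψ)) = 1 / 2 * weight ψ := by
    rw [← weight_pa q .Z i, e1, weight_smul, weight_comb₁ hi']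
    norm_num
    ring
  have e3 : G.f k s ((1 / 2 : ℂ) • comb₁ q i ψ 1 1) = 1 / 4 * G.f k s (comb₁ q i ψ 1 1) := by
    rw [G.smul]; norm_num
  rw [Fintype.sum_bool, if_pos rfl, if_neg (by decide), e0, e3] at t1
  rw [e1, e2, e3] at t2
  have n0 := G.cost_nonneg ψ
  linarith

/-- Each stage prepares two copies of the previous one. The second copy needs an ancilla of its own,
`y j`, while the two recursive preparations run one after the other and share the ancillas with
smaller indices. The coefficient normalises the state with amplitude 1 at `|0⟩`. -/
lemma prep_le : ∀ (j : ℕ) (hjm : j ≤ m) {i : Lab n m}, i.Sys → i ≠ .w →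
    (∀ a : Fin m, a.1 < j → i ≠ .y a) → ∀ {ψ : QState ι}, ψ ∈ sysSpace q →
    pa q .Z i ψ = ψ → pa q .Z .w ψ = ψ → (∀ a : Fin m, a.1 < j → pa q .Z (.y a) ψ = ψ) →
    ∀ (k : Prog (Lab n m)) (s : Stack (Lab n m)), G.f (prep j hjm i k) s ψ ≤
      κ * (50000 * 64 ^ j * weight ψ) +
      1 / (1 + newtonSeq j ^ 2) * G.f k s (comb₁ q i ψ 1 (newtonSeq j)) := by
  intro j
  induction j with
  | zero =>
    intro _ i hi _ _ ψ hψ hi' _ _ k s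
    have t := G.prep_zero_le hi hψ hi' k s
    have n0 := G.cost_nonneg ψ
    rw [prep, newtonSeq]
    norm_num at t ⊢
    linarith
  | succ j ih =>
    intro hjm i hi hiw hiy ψ hψ hi' hw' hy' k s
    obtain ⟨r, hr⟩ : ∃ r, r = newtonSeq j := ⟨_, rfl⟩
    have hr1 : 1 ≤ r := hr ▸ (newtonSeq_bounds j).1
    set N := 1 + r ^ 2 with hN
    set Q := r ^ 2 / 4 + (1 / 2 + r ^ 2 / 4) ^ 2 with hQ
    have hN0 : 0 < N := by positivity
    have hQ0 : 0 < Q := by positivity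
    let y : Lab n m := .y ⟨j, hjm⟩
    have hy : y.Sys := trivial
    have hyw : y ≠ .w := by simp [y]
    have hiy' : i ≠ y := hiy _ (Nat.lt_succ_self j)
    have hy'' : pa q .Z y ψ = ψ := hy' _ (Nat.lt_succ_self j)
    set φ := comb₁ q i ψ (r / 2) (1 / 2 + r ^ 2 / 4) with hφ
    have wφ : weight φ = Q * weight ψ := by rw [hφ, weight_comb₁ hi', hQ]; ring
    -- The quotient of `Q` by `N ^ 2` is the probability that a round succeeds; it lies between 1/16
    -- and 1.
    have hQN : Q ≤ N ^ 2 := by rw [hQ, hN]; nlinarith [sq_nonneg r]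
    have hNQ : N ^ 2 / 16 ≤ Q := by rw [hQ, hN]; nlinarith [sq_nonneg r]
    have body : ∀ s, G.f (prep j (Nat.le_of_succ_le hjm) i (prep j (Nat.le_of_succ_le hjm) y
        (newton i y))) s ψ ≤ κ * ((100000 * 64 ^ j + 3000) * weight ψ) +
        1 / N ^ 2 * G.f (.ret true) s φ + (1 - Q / N ^ 2) * G.f (.ret false) s ψ := by
      intro s
      have hlt : ∀ a : Fin m, a.1 < j → a.1 < j + 1 := fun a h => Nat.lt_succ_of_lt h
      have t1 := ih (Nat.le_of_succ_le hjm) hi hiw (fun a h => hiy a (hlt a h)) hψ hi' hw'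
        (fun a h => hy' a (hlt a h)) (prep j (Nat.le_of_succ_le hjm) y (newton i y)) s
      have t2 := ih (Nat.le_of_succ_le hjm) hy hyw
        (fun a h => by
          intro e
          simp only [y, Lab.y.injEq] at e
          rw [← e] at h
          exact lt_irrefl _ h)
        (comb₁_mem (q := q) hi hψ 1 r) (pa_Z_comb₁ hiy'.symm hy'' _ _)
        (pa_Z_comb₁ hiw.symm hw' _ _)
        (fun a h => pa_Z_comb₁ (hiy a (hlt a h)).symm (hy' a (hlt a h)) _ _) (newton i y) s
      have t3 := G.newton_le hi hy hiy' hiw hyw hψ hi' hy'' hw' s r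
      have e : comb₁ q y (comb₁ q i ψ 1 r) 1 r = comb₃ q i y .w ψ 1 0 r 0 r 0 (r ^ 2) 0 := by
        simp only [comb₃, comb₂, comb₁, map_add, map_smul, pa_comm q .X .X hiy'.symm]
        push_cast
        module
      rw [← hr] at t1 t2
      rw [e, weight_comb₁ hi', one_pow] at t2
      rw [← hN] at t1 t2 t3
      rw [← hφ, ← hQ] at t3
      have t4 := mul_le_mul_of_nonneg_left t2 (show 0 ≤ 1 / N by positivity)
      have t5 := mul_le_mul_of_nonneg_left t3 (show 0 ≤ 1 / N ^ 2 by positivity)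
      have e4 : 1 / N * (κ * (50000 * 64 ^ j * (N * weight ψ)) +
          1 / N * G.f (newton i y) s (comb₃ q i y .w ψ 1 0 r 0 r 0 (r ^ 2) 0)) =
          κ * (50000 * 64 ^ j * weight ψ) +
          1 / N ^ 2 * G.f (newton i y) s (comb₃ q i y .w ψ 1 0 r 0 r 0 (r ^ 2) 0) := by
        field_simp
      have e5 : 1 / N ^ 2 * (κ * (3000 * (N ^ 2 * weight ψ)) + G.f (.ret true) s φ +
          (N ^ 2 - Q) * G.f (.ret false) s ψ) = κ * (3000 * weight ψ) +
          1 / N ^ 2 * G.f (.ret true) s φ + (1 - Q / N ^ 2) * G.f (.ret false) s ψ := by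
        field_simp
      rw [e4] at t4
      rw [e5] at t5
      linarith
    have hp : 0 < Q / N ^ 2 := by positivity
    have hp1 : Q / N ^ 2 ≤ 1 := (div_le_one (by positivity)).2 hQN
    have hp16 : 1 / 16 ≤ Q / N ^ 2 := by rw [le_div_iff₀ (by positivity)]; linarith
    have t := G.loop_le (k := k) (φ := φ) (r := 1 - Q / N ^ 2) (by linarith)
      (by rw [wφ]; apply le_of_eq; field_simp; ring) (by positivity) (by linarith) body s
    have e6 : φ = ((r / 2 : ℝ) : ℂ) • comb₁ q i ψ 1 (newtonSeq (j + 1)) := by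
      rw [comb₁_smul, hφ, newtonSeq, ← hr]
      congr 1
      · ring
      · field_simp; ring
    have e7 : 1 / N ^ 2 / (1 - (1 - Q / N ^ 2)) * G.f k s φ =
        1 / (1 + newtonSeq (j + 1) ^ 2) * G.f k s (comb₁ q i ψ 1 (newtonSeq (j + 1))) := by
      rw [e6, G.smul, Complex.norm_real, Real.norm_eq_abs, sq_abs, ← mul_assoc]
      congr 1
      rw [newtonSeq, ← hr, sub_sub_cancel, hQ]
      have : 0 < r ^ 2 / 4 + (1 / 2 + r ^ 2 / 4) ^ 2 := hQ0
      have : 0 < 1 + (1 / r + r / 2) ^ 2 := by positivity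
      field_simp
      ring
    rw [e7] at t
    rw [prep]
    refine t.trans ?_
    refine add_le_add ?_ le_rfl
    refine mul_le_mul_of_nonneg_left (mul_le_mul_of_nonneg_right ?_ (weight_nonneg _)) G.nonneg
    have h64 : (1 : ℝ) ≤ 64 ^ j := one_le_pow₀ (by norm_num)
    -- Two preparations in at most 16 expected rounds multiply the cost by 32; the remaining factor
    -- 2 up to 64 absorbs the additive constants.
    have : (100000 * 64 ^ j + 3000 + 2) / (1 - (1 - Q / N ^ 2)) ≤
        (100000 * 64 ^ j + 3000 + 2) * 16 := by
      rw [sub_sub_cancel, div_le_iff₀ hp]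
      nlinarith
    rw [pow_succ (64 : ℝ)]
    linarith

end Val

/-- Turn the state `|0⟩ + r |1⟩` of the qubit `x` into `(1 + r / 2) |0⟩ + (r / 2) |1⟩`, or return
the qubits to `|0⟩`. -/
def magicStep : Prog (Lab n m) :=
  let fail := reset .x (reset .w (.ret false))
  .st .x .w fun b => if b then fail else meas .X .w fun b => if b then fail else
    reset .w (.ret true)

/-- Prepare an approximation of the state `cos (π / 8) |0⟩ + sin (π / 8) |1⟩` on the qubit `x`. -/
def magic (k : Prog (Lab n m)) : Prog (Lab n m) := .loop (prep m le_rfl .x magicStep) k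

namespace Val

variable (G : Val q κ)

/-- With `w` in `|0⟩`, the triplet outcome leaves the amplitudes `1, r / 2, r / 2` on `|00⟩, |01⟩,
|10⟩`. Finding `w` in the `1`-eigenstate of `X` adds the amplitudes for `w = 0` and `w = 1`, which
gives `1 + r / 2` and `r / 2` on `x`. -/
lemma magicStep_le {ψ : QState ι} (hψ : ψ ∈ sysSpace q) (hi' : pa q .Z .x ψ = ψ)
    (hl' : pa q .Z .w ψ = ψ) (s : Stack (Lab n m)) (r : ℝ) :
    G.f magicStep s (comb₁ q .x ψ 1 r) ≤ κ * (2000 * ((1 + r ^ 2) * weight ψ)) +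
      1 / 2 * G.f (.ret true) s (comb₁ q .x ψ (1 + r / 2) (r / 2)) +
      (1 + r ^ 2 - 1 / 2 * ((1 + r / 2) ^ 2 + (r / 2) ^ 2)) * G.f (.ret false) s ψ := by
  have hi : (Lab.x : Lab n m).Sys := trivial
  have hl : (Lab.w : Lab n m).Sys := trivial
  have hil : (Lab.x : Lab n m) ≠ .w := by simp
  have W := weight_comb₂ hil hi' hl'
  have F := G.reset_comb₂_le hi hl hil hψ hi' hl' (.ret false) s
  have M := comb₂_mem (q := q) hi hl hψ
  have e0 : comb₁ q .x ψ 1 r = comb₂ q .x .w ψ 1 0 r 0 := by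
    simp only [comb₂, comb₁, map_add, map_smul]; push_cast; module
  have e1 : comb₂ q .x .w ψ 1 0 r 0 - comb₂ q .x .w ψ 0 ((0 - r) / 2) ((r - 0) / 2) 0 =
      comb₂ q .x .w ψ 1 (r / 2) (r / 2) 0 := by
    simp only [comb₂, comb₁, map_add, map_smul]; push_cast; module
  have e2 : (1 / 2 : ℂ) • (comb₂ q .x .w ψ 1 (r / 2) (r / 2) 0 + bsign true •
      pa q .X .w (comb₂ q .x .w ψ 1 (r / 2) (r / 2) 0)) =
      comb₂ q .x .w ψ (1 / 2 - r / 4) (-(1 / 2 - r / 4)) (r / 4) (-(r / 4)) := by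
    rw [comb₂_swap hil, pa_X_comb₂, comb₂_swap hil (1 / 2 - r / 4)]
    simp only [comb₂, comb₁, map_add, map_smul, bsign_true]; push_cast; module
  have e3 : (1 / 2 : ℂ) • (comb₂ q .x .w ψ 1 (r / 2) (r / 2) 0 + bsign false •
      pa q .X .w (comb₂ q .x .w ψ 1 (r / 2) (r / 2) 0)) =
      comb₁ q .x ((1 / 2 : ℂ) • ψ) (1 + r / 2) (r / 2) +
        pa q .X .w (comb₁ q .x ((1 / 2 : ℂ) • ψ) (1 + r / 2) (r / 2)) := by
    rw [comb₂_swap hil, pa_X_comb₂]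
    simp only [comb₂, comb₁, map_add, map_smul, bsign_false]; push_cast; module
  have e4 : comb₁ q .x ((1 / 2 : ℂ) • ψ) (1 + r / 2) (r / 2) =
      (1 / 2 : ℂ) • comb₁ q .x ψ (1 + r / 2) (r / 2) := by
    simp only [comb₁, map_smul]; module
  have e5 : ∀ χ, G.f (.ret true) s ((1 / 2 : ℂ) • χ) = 1 / 4 * G.f (.ret true) s χ := by
    intro χ; rw [G.smul]; norm_num
  have e6 : weight (comb₁ q .x ((1 / 2 : ℂ) • ψ) (1 + r / 2) (r / 2)) =
      1 / 4 * (((1 + r / 2) ^ 2 + (r / 2) ^ 2) * weight ψ) := by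
    rw [e4, weight_smul, weight_comb₁ hi']; norm_num
  have hψ2 : (1 / 2 : ℂ) • ψ ∈ sysSpace q := Submodule.smul_mem _ _ hψ
  have t1 := G.st_le .x .w (fun b => if b then reset .x (reset .w (.ret false)) else
    meas .X .w fun b => if b then reset .x (reset .w (.ret false)) else reset .w (.ret true)) s
    (comb₂ q .x .w ψ 1 0 r 0) hil
  rw [sg_comb₂ hil hi' hl', e1, W, if_pos rfl, if_neg (by decide)] at t1
  have t2 := F 0 ((0 - r) / 2) ((r - 0) / 2) 0
  have t3 := G.meas_le (P := .X) (by decide) hl.ne_cat (hl.ne_ref _)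
    (M 1 (r / 2) (r / 2) 0).1
    (fun b => if b then reset .x (reset .w (.ret false)) else reset .w (.ret true)) s
  rw [Fintype.sum_bool, e2, e3, W, if_pos rfl, if_neg (by decide)] at t3
  have t4 := F (1 / 2 - r / 4) (-(1 / 2 - r / 4)) (r / 4) (-(r / 4))
  have t5 := G.reset_le hl (comb₁_mem hi hψ2 (1 + r / 2) (r / 2))
    (comb₁_mem hi hψ2 (1 + r / 2) (r / 2))
    (pa_Z_comb₁ hil.symm (by rw [map_smul, hl']) _ _)
    (pa_Z_comb₁ hil.symm (by rw [map_smul, hl']) _ _) (.ret true) s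
  rw [e6, e4, e5] at t5
  rw [e4] at t3
  have n0 := G.cost_nonneg ψ
  have n2 : 0 ≤ r ^ 2 * (κ * weight ψ) := by positivity
  rw [magicStep, e0]
  clear W F M
  have n1 : 0 ≤ (1 - r) ^ 2 * (κ * weight ψ) := by positivity
  have n3 : 0 ≤ (1 + r) ^ 2 * (κ * weight ψ) := by positivity
  linarith

lemma magic_le {ψ : QState ι} (hψ : ψ ∈ sysSpace q) (hx : pa q .Z .x ψ = ψ)
    (hw : pa q .Z .w ψ = ψ) (hy : ∀ a : Fin m, pa q .Z (.y a) ψ = ψ) (k : Prog (Lab n m))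
    (s : Stack (Lab n m)) {r : ℝ} (hr : r = newtonSeq m) :
    G.f (magic k) s ψ ≤ κ * (300000 * 64 ^ m * weight ψ) +
      1 / ((1 + r / 2) ^ 2 + (r / 2) ^ 2) * G.f k s (comb₁ q .x ψ (1 + r / 2) (r / 2)) := by
  have hr1 : 1 ≤ r := hr ▸ (newtonSeq_bounds m).1
  have hi : (Lab.x : Lab n m).Sys := trivial
  set N := 1 + r ^ 2 with hN
  set S := (1 + r / 2) ^ 2 + (r / 2) ^ 2 with hS
  have hN0 : 0 < N := by positivity
  have hS0 : 0 < S := by positivity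
  have hSN : S ≤ 2 * N := by rw [hS, hN]; nlinarith [sq_nonneg (r - 1)]
  have hNS : N / 2 ≤ S := by rw [hS, hN]; nlinarith
  have wφ : weight (comb₁ q .x ψ (1 + r / 2) (r / 2)) = S * weight ψ := by rw [weight_comb₁ hx]
  have body : ∀ s, G.f (prep m le_rfl .x magicStep) s ψ ≤
      κ * ((50000 * 64 ^ m + 2000) * weight ψ) +
      1 / (2 * N) * G.f (.ret true) s (comb₁ q .x ψ (1 + r / 2) (r / 2)) +
      (1 - S / (2 * N)) * G.f (.ret false) s ψ := by
    intro s
    have t1 := G.prep_le m le_rfl hi (by simp) (by simp) hψ hx hw (fun a _ => hy a) magicStep s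
    have t2 := G.magicStep_le hψ hx hw s r
    rw [← hr, ← hN] at t1
    rw [← hN, ← hS] at t2
    have t3 := mul_le_mul_of_nonneg_left t2 (show 0 ≤ 1 / N by positivity)
    have e : 1 / N * (κ * (2000 * (N * weight ψ)) +
        1 / 2 * G.f (.ret true) s (comb₁ q .x ψ (1 + r / 2) (r / 2)) +
        (N - 1 / 2 * S) * G.f (.ret false) s ψ) = κ * (2000 * weight ψ) +
        1 / (2 * N) * G.f (.ret true) s (comb₁ q .x ψ (1 + r / 2) (r / 2)) +
        (1 - S / (2 * N)) * G.f (.ret false) s ψ := by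
      field_simp
    rw [e] at t3
    linarith
  have hp : 0 < S / (2 * N) := by positivity
  have hp1 : S / (2 * N) ≤ 1 := (div_le_one (by positivity)).2 hSN
  -- At least a quarter of the rounds succeed, so the expected number of rounds is at most 4.
  have hp4 : 1 / 4 ≤ S / (2 * N) := by rw [le_div_iff₀ (by positivity)]; linarith
  have t := G.loop_le (k := k) (r := 1 - S / (2 * N)) (by linarith)
    (by rw [wφ]; apply le_of_eq; field_simp; ring) (by positivity) (by linarith) body s
  have e : 1 / (2 * N) / (1 - (1 - S / (2 * N))) = 1 / S := by
    rw [sub_sub_cancel]; field_simp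
  rw [e] at t
  rw [magic]
  refine t.trans (add_le_add ?_ le_rfl)
  refine mul_le_mul_of_nonneg_left (mul_le_mul_of_nonneg_right ?_ (weight_nonneg _)) G.nonneg
  have h64 : (1 : ℝ) ≤ 64 ^ m := one_le_pow₀ (by norm_num)
  have : (50000 * 64 ^ m + 2000 + 2) / (1 - (1 - S / (2 * N))) ≤
      (50000 * 64 ^ m + 2000 + 2) * 4 := by
    rw [sub_sub_cancel, div_le_iff₀ hp]
    nlinarith
  linarith

end Val

end Magic

end

noncomputable section

set_option linter.unusedSectionVars false

/-! ## The `T` gate -/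

section TGate

variable {n m : ℕ} {ι : Type} [Fintype ι] [DecidableEq ι] {q : Lab n m ↪ ι} {κ : ℝ}

/-- Whether the label is that of an ancilla in the state `|0⟩`. -/
def Lab.Anc : Lab n m → Prop
  | .w => True
  | .x => True
  | .y _ => True
  | _ => False

variable (q) in
/-- The states in which all ancillas are in their initial states. -/
def restSpace : Submodule ℂ (QState ι) :=
  sysSpace q ⊓ ⨅ i : {i : Lab n m // i.Anc}, fixedSpace (pa q .Z i.1)

lemma mem_restSpace {ψ : QState ι} : ψ ∈ restSpace q ↔
    ψ ∈ sysSpace q ∧ ∀ i : Lab n m, i.Anc → pa q .Z i ψ = ψ := by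
  rw [restSpace, Submodule.mem_inf, Submodule.mem_iInf]
  exact and_congr_right fun _ => ⟨fun h i hi => h ⟨i, hi⟩, fun h i => h i.1 i.2⟩

lemma restSpace.pa_mem {ψ : QState ι} (hψ : ψ ∈ restSpace q) (P : Pauli) (d : Fin n) :
    pa q P (.data d) ψ ∈ restSpace q := by
  rw [mem_restSpace] at *
  refine ⟨sysSpace.pa_mem hψ.1 P trivial, fun i hi => ?_⟩
  rw [pa_comm q _ _ (by rintro rfl; exact hi), hψ.2 i hi]

/-- The `T` gate on the logical qubit `d`. -/
def tProg (d : Fin n) (k : Prog (Lab n m)) : Prog (Lab n m) :=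
  magic (measPair .Z .Y (.data d) .x fun t =>
    let k' := if t then rotProg .Z (.data d) k else k
    meas .Z .x fun b => if b then .x .x (.z (.data d) k') else k')

/-- The amplitude of `|0⟩` in the approximate magic state. -/
def magicCos (m : ℕ) : ℝ :=
  (1 + newtonSeq m / 2) / Real.sqrt ((1 + newtonSeq m / 2) ^ 2 + (newtonSeq m / 2) ^ 2)

/-- The amplitude of `|1⟩` in the approximate magic state. -/
def magicSin (m : ℕ) : ℝ :=
  (newtonSeq m / 2) / Real.sqrt ((1 + newtonSeq m / 2) ^ 2 + (newtonSeq m / 2) ^ 2)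

lemma magicCos_sq_add_magicSin_sq (m : ℕ) : magicCos m ^ 2 + magicSin m ^ 2 = 1 := by
  have h1 := (newtonSeq_bounds m).1
  have h : 0 < (1 + newtonSeq m / 2) ^ 2 + (newtonSeq m / 2) ^ 2 := by positivity
  rw [magicCos, magicSin, div_pow (1 + newtonSeq m / 2), div_pow (newtonSeq m / 2),
    Real.sq_sqrt h.le, ← add_div, div_self h.ne']

/-- The error in the direction of the magic state. -/
def errSin (m : ℕ) : ℝ :=
  magicSin m * Real.cos (Real.pi / 8) - magicCos m * Real.sin (Real.pi / 8)

/-- The overlap of the approximate and the exact magic states. -/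
def errCos (m : ℕ) : ℝ :=
  magicCos m * Real.cos (Real.pi / 8) + magicSin m * Real.sin (Real.pi / 8)

lemma errCos_sq_add_errSin_sq (m : ℕ) : errCos m ^ 2 + errSin m ^ 2 = 1 := by
  have h1 := magicCos_sq_add_magicSin_sq m
  have h2 := Real.sin_sq_add_cos_sq (Real.pi / 8)
  rw [errCos, errSin]
  linear_combination (Real.sin (Real.pi / 8) ^ 2 + Real.cos (Real.pi / 8) ^ 2) * h1 + h2

/-- This says `tan (π / 8) = √2 / (2 + √2)`: for `r = √2` the amplitudes `1 + r / 2` and `r / 2` are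
in the ratio of the exact magic state. -/
lemma sqrt_two_mul_sin_pi_div_eight :
    (2 + Real.sqrt 2) * Real.sin (Real.pi / 8) = Real.sqrt 2 * Real.cos (Real.pi / 8) := by
  have h1 : Real.cos (Real.pi / 4) = 2 * Real.cos (Real.pi / 8) ^ 2 - 1 := by
    rw [← Real.cos_two_mul]; congr 1; ring
  have h2 : Real.sin (Real.pi / 4) = 2 * Real.sin (Real.pi / 8) * Real.cos (Real.pi / 8) := by
    rw [← Real.sin_two_mul]; congr 1; ring
  rw [Real.cos_pi_div_four] at h1
  rw [Real.sin_pi_div_four] at h2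
  have h0 : Real.cos (Real.pi / 8) ≠ 0 := (Real.cos_pos_of_mem_Ioo
    ⟨by linarith [Real.pi_pos], by linarith [Real.pi_pos]⟩).ne'
  have h3 : Real.sqrt 2 * Real.sqrt 2 = 2 := Real.mul_self_sqrt (by norm_num)
  refine mul_right_cancel₀ h0 ?_
  linear_combination -(2 + Real.sqrt 2) / 2 * h2 + Real.sqrt 2 / 2 * h1 - 0 * h3

/-- The sine of the angular error is `r - √2` times a bounded factor, because it vanishes for the
exact ratio. The convergence of Newton's iteration therefore carries over. -/
lemma errSin_sq_le (m : ℕ) : errSin m ^ 2 ≤ (1 / 2) ^ 2 ^ m := by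
  set r := newtonSeq m with hr
  have h1 : 1 ≤ r := (newtonSeq_bounds m).1
  have hS : 0 < (1 + r / 2) ^ 2 + (r / 2) ^ 2 := by positivity
  have e1 : errSin m = ((r - Real.sqrt 2) / 2 *
      (Real.cos (Real.pi / 8) - Real.sin (Real.pi / 8))) /
      Real.sqrt ((1 + r / 2) ^ 2 + (r / 2) ^ 2) := by
    have h := sqrt_two_mul_sin_pi_div_eight
    have hS' := Real.sqrt_pos.2 hS
    rw [errSin, magicSin, magicCos, ← hr, eq_div_iff hS'.ne', sub_mul, mul_right_comm,
      div_mul_cancel₀ _ hS'.ne', mul_right_comm, div_mul_cancel₀ _ hS'.ne']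
    linear_combination (-1 / 2 : ℝ) * h
  have h2 := abs_newtonSeq_sub_le m
  have h3 := Real.sin_sq_add_cos_sq (Real.pi / 8)
  have h4 : (Real.cos (Real.pi / 8) - Real.sin (Real.pi / 8)) ^ 2 ≤ 2 := by
    nlinarith [sq_nonneg (Real.cos (Real.pi / 8) + Real.sin (Real.pi / 8))]
  have h5 : ((1 / 4 : ℝ)) ^ 2 ^ m ≤ 1 / 4 := by
    calc ((1 / 4 : ℝ)) ^ 2 ^ m ≤ (1 / 4) ^ 1 :=
          pow_le_pow_of_le_one (by norm_num) (by norm_num) Nat.one_le_two_pow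
      _ = 1 / 4 := pow_one _
  have h6 : ((1 / 4 : ℝ)) ^ 2 ^ m ≤ (1 / 2) ^ 2 ^ m :=
    pow_le_pow_left₀ (by norm_num) (by norm_num) _
  have h7 : (r - Real.sqrt 2) ^ 2 ≤ (1 / 4 : ℝ) ^ 2 ^ m := by
    rw [← sq_abs]
    have h8 : |r - Real.sqrt 2| ^ 2 ≤ (2 * (1 / 4 : ℝ) ^ 2 ^ m) ^ 2 := by gcongr
    have h9 : (0 : ℝ) ≤ (1 / 4) ^ 2 ^ m := by positivity
    nlinarith
  rw [e1, div_pow, Real.sq_sqrt hS.le, div_le_iff₀ hS, mul_pow, div_pow]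
  have h8 : (1 : ℝ) ≤ (1 + r / 2) ^ 2 + (r / 2) ^ 2 := by nlinarith
  have h9 : (0 : ℝ) ≤ (1 / 2) ^ 2 ^ m := by positivity
  have h10 := sq_nonneg (r - Real.sqrt 2)
  nlinarith

/-- Here `z` stands for an eigenvalue of `Z`; the two cases are the diagonal entries of the `T` gate
up to the common phase. -/
lemma exp_mul_cos_sub_sin (z : ℂ) (hz : z = 1 ∨ z = -1) :
    Complex.exp (Complex.I * (Real.pi / 8 : ℝ)) *
      ((Real.cos (Real.pi / 8) : ℂ) - Complex.I * (Real.sin (Real.pi / 8) : ℂ) * z) =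
    if z = 1 then 1 else Complex.exp (Complex.I * (Real.pi / 4 : ℝ)) := by
  have n1 : ¬ (-1 : ℂ) = 1 := by norm_num
  rw [Complex.ofReal_cos, Complex.ofReal_sin]
  rcases hz with rfl | rfl
  · have h : Complex.cos (Real.pi / 8 : ℝ) - Complex.I * Complex.sin (Real.pi / 8 : ℝ) * 1 =
        Complex.exp (-(Complex.I * (Real.pi / 8 : ℝ))) := by
      rw [show -(Complex.I * ((Real.pi / 8 : ℝ) : ℂ)) = (-(Real.pi / 8 : ℝ) : ℂ) * Complex.I by
        ring, Complex.exp_mul_I, Complex.cos_neg, Complex.sin_neg]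
      ring
    rw [h, ← Complex.exp_add, add_neg_cancel, Complex.exp_zero, if_pos rfl]
  · have h : Complex.cos (Real.pi / 8 : ℝ) - Complex.I * Complex.sin (Real.pi / 8 : ℝ) * -1 =
        Complex.exp (Complex.I * (Real.pi / 8 : ℝ)) := by
      rw [mul_comm Complex.I ((Real.pi / 8 : ℝ) : ℂ), Complex.exp_mul_I]
      ring
    rw [h, ← Complex.exp_add, if_neg n1]
    congr 1
    push_cast
    ring

lemma tMat_eq : tMat = Complex.exp (Complex.I * (Real.pi / 8 : ℝ)) •
    ((Real.cos (Real.pi / 8) : ℂ) • (1 : Matrix (Fin 2) (Fin 2) ℂ) -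
      (Complex.I * (Real.sin (Real.pi / 8) : ℂ)) • Pauli.Z.mat) := by
  have h1 := exp_mul_cos_sub_sin 1 (Or.inl rfl)
  have h2 := exp_mul_cos_sub_sin (-1) (Or.inr rfl)
  rw [if_pos rfl] at h1
  rw [if_neg (by norm_num)] at h2
  ext i j
  fin_cases i <;> fin_cases j <;> simp [tMat, Pauli.mat] at h1 h2 ⊢
  · exact h1.symm
  · exact h2.symm

variable (q) in
/-- The operator `exp (-i π / 8 Z)` on the logical qubit `d`. -/
def tMap (d : Fin n) (ψ : QState ι) : QState ι :=
  (Real.cos (Real.pi / 8) : ℂ) • ψ -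
    (Complex.I * (Real.sin (Real.pi / 8) : ℂ)) • pa q .Z (.data d) ψ

lemma tMat_mulVec (d : Fin n) (ψ : QState ι) :
    onQubits (oneQubit (q (.data d))) (oneQubitOp tMat) *ᵥ ψ =
      Complex.exp (Complex.I * (Real.pi / 8 : ℝ)) • tMap q d ψ := by
  rw [tMat_eq, oneQubitOp_smul, sub_eq_add_neg, ← neg_smul, oneQubitOp_add, oneQubitOp_smul,
    oneQubitOp_smul, oneQubitOp_one, onQubits_smul, onQubits_add, onQubits_smul, onQubits_smul,
    onQubits_one, smul_mulVec, add_mulVec, smul_mulVec, smul_mulVec, one_mulVec, neg_smul,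
    ← sub_eq_add_neg]
  rfl

lemma tMap_mem {ψ : QState ι} (hψ : ψ ∈ restSpace q) (d : Fin n) : tMap q d ψ ∈ restSpace q :=
  Submodule.sub_mem _ (Submodule.smul_mem _ _ hψ)
    (Submodule.smul_mem _ _ (restSpace.pa_mem hψ .Z d))

namespace Val

variable (G : Val q κ)

lemma magic_le' {ψ : QState ι} (hψ : ψ ∈ restSpace q) (k : Prog (Lab n m))
    (s : Stack (Lab n m)) : G.f (magic k) s ψ ≤ κ * (300000 * 64 ^ m * weight ψ) +
      G.f k s (comb₁ q .x ψ (magicCos m) (magicSin m)) := by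
  obtain ⟨h, hz⟩ := mem_restSpace.1 hψ
  have t := G.magic_le h (hz .x trivial) (hz .w trivial) (fun a => hz (.y a) trivial) k s rfl
  have h1 := (newtonSeq_bounds m).1
  have hS : 0 < (1 + newtonSeq m / 2) ^ 2 + (newtonSeq m / 2) ^ 2 := by positivity
  have hS' := Real.sqrt_pos.2 hS
  have e : comb₁ q .x ψ (1 + newtonSeq m / 2) (newtonSeq m / 2) =
      ((Real.sqrt ((1 + newtonSeq m / 2) ^ 2 + (newtonSeq m / 2) ^ 2) : ℝ) : ℂ) •
        comb₁ q .x ψ (magicCos m) (magicSin m) := by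
    rw [comb₁_smul, magicCos, magicSin, mul_div_cancel₀ _ hS'.ne', mul_div_cancel₀ _ hS'.ne']
  rw [e, G.smul, Complex.norm_real, Real.norm_eq_abs, sq_abs, Real.sq_sqrt hS.le,
    one_div_mul_eq_div, mul_div_cancel_left₀ _ hS.ne'] at t
  exact t

/-- On `x`, the matrix `Y` takes `|0⟩` to `i |1⟩` and `|1⟩` to `-i |0⟩`. Projecting with `Z ⊗ Y`
hence makes `a ψ ∓ i b Z ψ` the coefficient of `|0⟩`, and the same vector up to `Z` and a phase the
coefficient of `|1⟩`. Measuring `x` separates the two, and a `Z` corrects the second. -/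
lemma tGadget_le {ψ : QState ι} (hψ : ψ ∈ restSpace q) (d : Fin n) (k' : Bool → Prog (Lab n m))
    (s : Stack (Lab n m)) (a b : ℝ) (hab : a ^ 2 + b ^ 2 = 1) :
    G.f (measPair .Z .Y (.data d) .x fun t =>
      meas .Z .x fun b => if b then .x .x (.z (.data d) (k' t)) else k' t) s
        (comb₁ q .x ψ a b) ≤ κ * (4000 * weight ψ) + ∑ t, 1 / 2 * G.f (k' t) s
          ((a : ℂ) • ψ - (bsign t * (Complex.I * b)) • pa q .Z (.data d) ψ) := by
  obtain ⟨h, hz⟩ := mem_restSpace.1 hψ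
  have hx : (Lab.x : Lab n m).Sys := trivial
  have hd : (Lab.data d : Lab n m).Sys := trivial
  have hxd : (Lab.data d : Lab n m) ≠ .x := by simp
  have hzx := hz .x trivial
  have hm := comb₁_mem (q := q) hx h a b
  let A : Bool → QState ι := fun t => (a : ℂ) • ψ -
    (bsign t * (Complex.I * b)) • pa q .Z (.data d) ψ
  have hA : ∀ t, A t ∈ sysSpace q := fun t => Submodule.sub_mem _ (Submodule.smul_mem _ _ h)
    (Submodule.smul_mem _ _ (sysSpace.pa_mem h .Z hd))
  have hAx : ∀ t, pa q .Z .x (A t) = A t := by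
    intro t
    simp only [A, map_sub, map_smul, pa_comm q .Z .Z hxd.symm, hzx]
  have e : ∀ t, (1 / 2 : ℂ) • (comb₁ q .x ψ a b + bsign t •
      pa q .Z (.data d) (pa q .Y .x (comb₁ q .x ψ a b))) =
      (1 / 2 : ℂ) • A t +
        pa q .X .x ((1 / 2 : ℂ) • (bsign t * Complex.I) • pa q .Z (.data d) (A t)) := by
    intro t
    have h1 : pa q .Y .x ψ = Complex.I • pa q .X .x ψ := by rw [pa_Y, hzx]
    have h2 : pa q .Y .x (pa q .X .x ψ) = -(Complex.I • ψ) := by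
      rw [pa_Y, pa_Z_X _ hzx, map_neg, pa_self, smul_neg]
    have hb := bsign_mul_self t
    simp only [A, comb₁, map_add, map_sub, map_smul, map_neg, h1, h2, pa_self,
      pa_comm q .Z .X hxd, smul_add, smul_sub, smul_neg, smul_smul]
    have h3 : bsign t * Complex.I * (bsign t * (Complex.I * b)) = -b := by
      linear_combination (Complex.I * Complex.I * b) * hb + b * Complex.I_mul_I
    rw [h3]
    module
  have t1 := G.measPair_le (A := .Z) (B := .Y) (by decide) (by decide) hxd hd hx hm
    (fun t => meas .Z .x fun b => if b then .x .x (.z (.data d) (k' t)) else k' t) s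
  have w1 := (negWeight q).measPair_le (A := .Z) (B := .Y) (by decide) (by decide) hxd hd hx hm
    (fun t => .ret true) s
  have t2 : ∀ t, G.f (meas .Z .x fun b => if b then .x .x (.z (.data d) (k' t)) else k' t) s
      ((1 / 2 : ℂ) • A t +
        pa q .X .x ((1 / 2 : ℂ) • (bsign t * Complex.I) • pa q .Z (.data d) (A t))) ≤
      κ * (222 * weight ((1 / 2 : ℂ) • A t +
        pa q .X .x ((1 / 2 : ℂ) • (bsign t * Complex.I) • pa q .Z (.data d) (A t)))) +
      1 / 2 * G.f (k' t) s (A t) := by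
    intro t
    have hB : (1 / 2 : ℂ) • (bsign t * Complex.I) • pa q .Z (.data d) (A t) ∈ sysSpace q :=
      Submodule.smul_mem _ _ (Submodule.smul_mem _ _ (sysSpace.pa_mem (hA t) .Z hd))
    have hBx : pa q .Z .x ((1 / 2 : ℂ) • (bsign t * Complex.I) • pa q .Z (.data d) (A t)) =
        (1 / 2 : ℂ) • (bsign t * Complex.I) • pa q .Z (.data d) (A t) := by
      simp only [map_smul, pa_comm q .Z .Z hxd.symm, hAx]
    have hA' : (1 / 2 : ℂ) • A t ∈ sysSpace q := Submodule.smul_mem _ _ (hA t)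
    have hAx' : pa q .Z .x ((1 / 2 : ℂ) • A t) = (1 / 2 : ℂ) • A t := by rw [map_smul, hAx]
    have hu : ‖bsign t * Complex.I‖ = 1 := by rw [norm_mul, norm_bsign]; simp
    have eB : pa q .Z (.data d) ((1 / 2 : ℂ) • (bsign t * Complex.I) •
        pa q .Z (.data d) (A t)) = (bsign t * Complex.I) • (1 / 2 : ℂ) • A t := by
      rw [map_smul, map_smul, pa_self, smul_comm]
    set B := (1 / 2 : ℂ) • (bsign t * Complex.I) • pa q .Z (.data d) (A t) with hBdef
    have a1 := G.meas_le (P := .Z) (by decide) hx.ne_cat (hx.ne_ref _)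
      (Submodule.add_mem _ hA' (sysSpace.pa_mem hB .X hx)).1
      (fun b => if b then .x .x (.z (.data d) (k' t)) else k' t) s
    have e1 : (1 / 2 : ℂ) • ((1 / 2 : ℂ) • A t + pa q .X .x B + bsign true •
        pa q .Z .x ((1 / 2 : ℂ) • A t + pa q .X .x B)) = pa q .X .x B := by
      rw [map_add, hAx', pa_Z_X .x hBx, bsign_true]; module
    have e0 : (1 / 2 : ℂ) • ((1 / 2 : ℂ) • A t + pa q .X .x B + bsign false •
        pa q .Z .x ((1 / 2 : ℂ) • A t + pa q .X .x B)) = (1 / 2 : ℂ) • A t := by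
      rw [map_add, hAx', pa_Z_X .x hBx, bsign_false]; module
    have a2 := G.x_le .x (.z (.data d) (k' t)) s (pa q .X .x B)
    have a3 := G.z_le (.data d) (k' t) s B
    rw [Fintype.sum_bool, e1, e0, if_pos rfl, if_neg (by decide)] at a1
    rw [pa_self, weight_pa] at a2
    rw [eB, G.smul_unit _ _ hu] at a3
    have e4 : G.f (k' t) s ((1 / 2 : ℂ) • A t) = 1 / 4 * G.f (k' t) s (A t) := by
      rw [G.smul]; norm_num
    rw [e4] at a1 a3
    have w2 := weight_add_pa_X hAx' hBx
    have n1 := G.cost_nonneg B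
    have n2 := G.cost_nonneg ((1 / 2 : ℂ) • A t)
    rw [w2] at a1 ⊢
    linarith
  simp only [e] at t1 w1
  simp only [negWeight] at w1
  rw [weight_comb₁ hzx, hab, one_mul] at t1 w1
  have t3 := Finset.sum_le_sum fun t (_ : t ∈ Finset.univ) => t2 t
  rw [Finset.sum_add_distrib, ← Finset.mul_sum, ← Finset.mul_sum] at t3
  rw [Finset.sum_neg_distrib] at w1
  have w3 := mul_le_mul_of_nonneg_left w1 G.nonneg
  have n0 := G.cost_nonneg ψ
  linarith

/-- If `a` and `b` are the cosine and sine of `θ`, one outcome rotates by `θ` and the other by `-θ`,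
which the rotation `(1 - i Z) / √2` turns into `π / 4 - θ`. With `θ = π / 8 + ε` the resulting
errors are `ε` and `-ε`, each with probability 1/2. -/
lemma tProg_le {ψ : QState ι} (hψ : ψ ∈ restSpace q) (d : Fin n) (k : Prog (Lab n m))
    (s : Stack (Lab n m)) :
    G.f (tProg d k) s ψ ≤ κ * (310000 * 64 ^ m * weight ψ) +
      1 / 2 * G.f k s ((errCos m : ℂ) • tMap q d ψ -
        (Complex.I * errSin m) • pa q .Z (.data d) (tMap q d ψ)) +
      1 / 2 * G.f k s ((errCos m : ℂ) • tMap q d ψ +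
        (Complex.I * errSin m) • pa q .Z (.data d) (tMap q d ψ)) := by
  obtain ⟨h, hz⟩ := mem_restSpace.1 hψ
  set α := magicCos m with hα
  set β := magicSin m with hβ
  set C := Real.cos (Real.pi / 8) with hC
  set S := Real.sin (Real.pi / 8) with hS
  have hCS : S ^ 2 + C ^ 2 = 1 := Real.sin_sq_add_cos_sq _
  have h2 : Real.sqrt 2 ≠ 0 := by positivity
  have h3 : Real.sqrt 2 * Real.sqrt 2 = 2 := Real.mul_self_sqrt (by norm_num)
  have d1 : C ^ 2 - S ^ 2 = 1 / Real.sqrt 2 := by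
    have h1 : Real.cos (Real.pi / 4) = 2 * C ^ 2 - 1 := by
      rw [hC, ← Real.cos_two_mul]; congr 1; ring
    rw [Real.cos_pi_div_four] at h1
    field_simp
    linear_combination -Real.sqrt 2 * h1 + h3 / 2 - Real.sqrt 2 * hCS
  have d2 : 2 * S * C = 1 / Real.sqrt 2 := by
    have h1 : Real.sin (Real.pi / 4) = 2 * S * C := by
      rw [hS, hC, ← Real.sin_two_mul]; congr 1; ring
    rw [Real.sin_pi_div_four] at h1
    field_simp
    linear_combination -Real.sqrt 2 * h1 + h3 / 2
  -- These four identities are addition theorems: the first two for the angle `π / 8 + ε`, the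
  -- others for `π / 8 - ε`, expressed through the amplitudes of the approximate magic state.
  have f1 : errCos m * C - errSin m * S = α := by
    rw [errCos, errSin]; linear_combination α * hCS
  have f2 : errCos m * S + errSin m * C = β := by
    rw [errCos, errSin]; linear_combination β * hCS
  have f3 : errCos m * C + errSin m * S = 1 / Real.sqrt 2 * (α + β) := by
    rw [errCos, errSin]; linear_combination α * d1 + β * d2
  have f4 : errCos m * S - errSin m * C = 1 / Real.sqrt 2 * (α - β) := by
    rw [errCos, errSin]; linear_combination α * d2 - β * d1
  have g1 : (α : ℂ) • ψ - (bsign false * (Complex.I * β)) • pa q .Z (.data d) ψ =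
      (errCos m : ℂ) • tMap q d ψ -
        (Complex.I * errSin m) • pa q .Z (.data d) (tMap q d ψ) := by
    rw [← f1, ← f2, tMap, ← hC, ← hS, map_sub, map_smul, map_smul, pa_self, bsign_false]
    match_scalars
    · linear_combination -(errSin m * S : ℂ) * Complex.I_mul_I
    · ring
  have g2 : (1 / Real.sqrt 2 : ℂ) • ((α : ℂ) • ψ - (bsign true * (Complex.I * β)) •
      pa q .Z (.data d) ψ - Complex.I • pa q .Z (.data d) ((α : ℂ) • ψ -
        (bsign true * (Complex.I * β)) • pa q .Z (.data d) ψ)) =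
      (errCos m : ℂ) • tMap q d ψ +
        (Complex.I * errSin m) • pa q .Z (.data d) (tMap q d ψ) := by
    have f3' : (errCos m * C + errSin m * S : ℂ) = 1 / Real.sqrt 2 * (α + β) := by
      exact_mod_cast f3
    have f4' : (errCos m * S - errSin m * C : ℂ) = 1 / Real.sqrt 2 * (α - β) := by
      exact_mod_cast f4
    rw [tMap, ← hC, ← hS]
    simp only [map_sub, map_smul, pa_self, bsign_true]
    match_scalars
    · linear_combination -f3' + (-(1 / Real.sqrt 2 * β) + errSin m * S : ℂ) * Complex.I_mul_I
    · linear_combination Complex.I * f4'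
  have hm : ∀ t, (α : ℂ) • ψ - (bsign t * (Complex.I * β)) • pa q .Z (.data d) ψ ∈ sysSpace q :=
    fun t => Submodule.sub_mem _ (Submodule.smul_mem _ _ h)
      (Submodule.smul_mem _ _ (sysSpace.pa_mem h .Z trivial))
  have t1 := G.magic_le' hψ (measPair .Z .Y (.data d) .x fun t =>
    meas .Z .x fun b => if b then .x .x (.z (.data d) (if t then rotProg .Z (.data d) k else k))
      else (if t then rotProg .Z (.data d) k else k)) s
  have t2 := G.tGadget_le hψ d (fun t => if t then rotProg .Z (.data d) k else k) s α β
    (magicCos_sq_add_magicSin_sq m)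
  have t3 := G.rot_le (R := .Z) (i := .data d) (by decide) trivial (hm true) k s
  -- One outcome cannot have more than the total weight of the two signs, which the parallelogram
  -- law evaluates as `2 * weight ψ`.
  have w : weight ((α : ℂ) • ψ - (bsign true * (Complex.I * β)) • pa q .Z (.data d) ψ) ≤
      2 * weight ψ := by
    have w1 := weight_parallelogram ((α : ℂ) • ψ)
      ((bsign true * (Complex.I * β)) • pa q .Z (.data d) ψ)
    have hab := magicCos_sq_add_magicSin_sq m
    have n1 := weight_nonneg ((α : ℂ) • ψ + (bsign true * (Complex.I * β)) •
      pa q .Z (.data d) ψ)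
    rw [weight_real_smul, weight_smul, weight_pa] at w1
    have e : ‖bsign true * (Complex.I * β)‖ ^ 2 = β ^ 2 := by
      rw [norm_mul, norm_bsign, norm_mul, Complex.norm_I, Complex.norm_real, Real.norm_eq_abs,
        one_mul, one_mul, sq_abs]
    rw [e, ← add_mul, hab] at w1
    linarith
  have w' := mul_le_mul_of_nonneg_left w G.nonneg
  rw [Fintype.sum_bool, if_pos rfl, if_neg (by decide), g1] at t2
  rw [g2] at t3
  have n0 := G.cost_nonneg ψ
  have h64 : (1 : ℝ) ≤ 64 ^ m := one_le_pow₀ (by norm_num)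
  have n1 := mul_le_mul_of_nonneg_right h64 n0
  rw [tProg]
  simp only at *
  linarith

end Val

end TGate

end

noncomputable section

set_option linter.unusedSectionVars false

/-! ## General facts on simulators -/

section Operators

variable {ι : Type} [Fintype ι] [DecidableEq ι]

lemma expect_parallelogram (E : QOp ι) (φ χ : QState ι) :
    expect E (φ + χ) + expect E (φ - χ) = 2 * (expect E φ + expect E χ) := by
  simp only [expect, mulVec_add, mulVec_sub, star_add, star_sub, add_dotProduct, sub_dotProduct,
    dotProduct_add, dotProduct_sub, Complex.add_re, Complex.sub_re]
  ring

lemma expect_nonneg {E : QOp ι} (hE : E.PosSemidef) (ψ : QState ι) : 0 ≤ expect E ψ :=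
  (Complex.le_def.1 (hE.dotProduct_mulVec_nonneg ψ)).1

open scoped MatrixOrder in
lemma onQubits_posSemidef {κ : Type} [Fintype κ] [DecidableEq κ] (e : κ ↪ ι) {E : QOp κ}
    (hE : E.PosSemidef) : (onQubits e E).PosSemidef := by
  obtain ⟨B, rfl⟩ := CStarAlgebra.nonneg_iff_eq_star_mul_self.mp hE.nonneg
  rw [star_eq_conjTranspose, onQubits_mul, ← onQubits_conjTranspose]
  exact Matrix.posSemidef_conjTranspose_mul_self _

lemma expect_onQubits_le_weight {κ : Type} [Fintype κ] [DecidableEq κ] (e : κ ↪ ι) {E : QOp κ}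
    (hE : (1 - E).PosSemidef) (ψ : QState ι) : expect (onQubits e E) ψ ≤ weight ψ := by
  have h := expect_nonneg (onQubits_posSemidef e hE) ψ
  rw [onQubits_sub, onQubits_one, expect_sub, ← weight_eq_expect] at h
  linarith

variable (ι) in
/-- All qubits, under their own labels. -/
abbrev allQubits : ι ↪ ι := Function.Embedding.refl ι

lemma singletProj_mulVec {i j : ι} (h : i ≠ j) (ψ : QState ι) :
    onQubits (twoQubits i j h) singletProj *ᵥ ψ = sg (allQubits ι) i j ψ := by
  rw [onQubits_singletProj, sg_eq_mulVec]; rfl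

lemma tripletProj_mulVec {i j : ι} (h : i ≠ j) (ψ : QState ι) :
    onQubits (twoQubits i j h) tripletProj *ᵥ ψ = ψ - sg (allQubits ι) i j ψ := by
  rw [onQubits_tripletProj, sub_mulVec, one_mulVec, sg_eq_mulVec]; rfl

lemma pauli_mulVec (P : Pauli) (i : ι) (ψ : QState ι) :
    onQubits (oneQubit i) (oneQubitOp P.mat) *ᵥ ψ = pa (allQubits ι) P i ψ := rfl

end Operators

namespace Simulator

variable {n p : ℕ} {σ : Type} (S : Simulator n p σ)

section Basic

variable (E : Test n)

lemma acceptFrom_succ (K : ℕ) (next : Bool → Circuit n × List Bool) (s : σ)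
    (ψ : QState (Phys p)) : S.acceptFrom E (K + 1) next s ψ =
    match S.move s with
    | .x i s' => S.acceptFrom E K next s' (pa (allQubits _) .X i ψ)
    | .z i s' => S.acceptFrom E K next s' (pa (allQubits _) .Z i ψ)
    | .st i j _ s' => S.acceptFrom E K next (s' true) (sg (allQubits _) i j ψ) +
        S.acceptFrom E K next (s' false) (ψ - sg (allQubits _) i j ψ)
    | .done b s' =>
      match next b with
      | (.halt, h) => expect (onQubits (S.loc s') (E.effect h)) ψ
      | (.step g c, h) => S.acceptFrom E K (fun b' => (c b', h ++ [b'])) (S.load g s') ψ := by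
  rw [acceptFrom]
  cases S.move s with
  | done b s' =>
    rcases next b with ⟨_ | _, _⟩ <;> rfl
  | _ => simp only [singletProj_mulVec, tripletProj_mulVec, pauli_mulVec]

lemma opsFrom_succ (K : ℕ) (next : Bool → Circuit n) (s : σ) (ψ : QState (Phys p)) :
    S.opsFrom (K + 1) next s ψ =
    match S.move s with
    | .x i s' => weight ψ + S.opsFrom K next s' (pa (allQubits _) .X i ψ)
    | .z i s' => weight ψ + S.opsFrom K next s' (pa (allQubits _) .Z i ψ)
    | .st i j _ s' => weight ψ + (S.opsFrom K next (s' true) (sg (allQubits _) i j ψ) +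
        S.opsFrom K next (s' false) (ψ - sg (allQubits _) i j ψ))
    | .done b s' =>
      match next b with
      | .halt => 0
      | .step g c => S.opsFrom K c (S.load g s') ψ := by
  rw [opsFrom]
  cases S.move s with
  | done b s' =>
    rcases next b with _ | _ <;> rfl
  | _ => simp only [singletProj_mulVec, tripletProj_mulVec, pauli_mulVec]

lemma acceptFrom_smul (K : ℕ) : ∀ (next : Bool → Circuit n × List Bool) (s : σ) (c : ℂ)
    (ψ : QState (Phys p)),
    S.acceptFrom E K next s (c • ψ) = ‖c‖ ^ 2 * S.acceptFrom E K next s ψ := by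
  induction K with
  | zero => intro next s c ψ; simp [acceptFrom]
  | succ K ih =>
    intro next s c ψ
    rw [acceptFrom_succ, acceptFrom_succ]
    cases S.move s with
    | x i s' => simp only [map_smul, ih]
    | z i s' => simp only [map_smul, ih]
    | st i j h s' => simp only [map_smul, ← smul_sub, ih, mul_add]
    | done b s' =>
      dsimp only
      obtain ⟨c', h⟩ := next b
      cases c' with
      | halt => exact expect_smul _ _ _
      | step g c' => exact ih _ _ _ _

lemma opsFrom_smul (K : ℕ) : ∀ (next : Bool → Circuit n) (s : σ) (c : ℂ) (ψ : QState (Phys p)),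
    S.opsFrom K next s (c • ψ) = ‖c‖ ^ 2 * S.opsFrom K next s ψ := by
  induction K with
  | zero => intro next s c ψ; simp [opsFrom]
  | succ K ih =>
    intro next s c ψ
    rw [opsFrom_succ, opsFrom_succ]
    cases S.move s with
    | x i s' => simp only [map_smul, ih, weight_smul, mul_add]
    | z i s' => simp only [map_smul, ih, weight_smul, mul_add]
    | st i j h s' => simp only [map_smul, ← smul_sub, ih, weight_smul, mul_add]
    | done b s' =>
      dsimp only
      cases next b with
      | halt => simp
      | step g c' => exact ih _ _ _ _

lemma acceptFrom_nonneg (K : ℕ) : ∀ (next : Bool → Circuit n × List Bool) (s : σ)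
    (ψ : QState (Phys p)), 0 ≤ S.acceptFrom E K next s ψ := by
  induction K with
  | zero => intro next s ψ; exact le_rfl
  | succ K ih =>
    intro next s ψ
    rw [acceptFrom_succ]
    cases S.move s with
    | x i s' => exact ih _ _ _
    | z i s' => exact ih _ _ _
    | st i j h s' => exact add_nonneg (ih _ _ _) (ih _ _ _)
    | done b s' =>
      dsimp only
      obtain ⟨c', h⟩ := next b
      cases c' with
      | halt => exact expect_nonneg (onQubits_posSemidef _ (E.nonneg h)) _
      | step g c' => exact ih _ _ _

lemma acceptFrom_le_succ (K : ℕ) : ∀ (next : Bool → Circuit n × List Bool) (s : σ)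
    (ψ : QState (Phys p)), S.acceptFrom E K next s ψ ≤ S.acceptFrom E (K + 1) next s ψ := by
  induction K with
  | zero => intro next s ψ; exact S.acceptFrom_nonneg E 1 next s ψ
  | succ K ih =>
    intro next s ψ
    rw [acceptFrom_succ, acceptFrom_succ S E (K + 1)]
    cases S.move s with
    | x i s' => exact ih _ _ _
    | z i s' => exact ih _ _ _
    | st i j h s' => exact add_le_add (ih _ _ _) (ih _ _ _)
    | done b s' =>
      dsimp only
      obtain ⟨c', h⟩ := next b
      cases c' with
      | halt => exact le_rfl
      | step g c' => exact ih _ _ _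

lemma acceptFrom_le_weight (K : ℕ) : ∀ (next : Bool → Circuit n × List Bool) (s : σ)
    (ψ : QState (Phys p)), S.acceptFrom E K next s ψ ≤ weight ψ := by
  induction K with
  | zero => intro next s ψ; exact weight_nonneg ψ
  | succ K ih =>
    intro next s ψ
    rw [acceptFrom_succ]
    cases S.move s with
    | x i s' => exact (ih _ _ _).trans_eq (weight_pa _ _ _ _)
    | z i s' => exact (ih _ _ _).trans_eq (weight_pa _ _ _ _)
    | st i j h s' =>
      exact (add_le_add (ih _ _ _) (ih _ _ _)).trans_eq (weight_sg (allQubits _) h ψ).symm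
    | done b s' =>
      dsimp only
      obtain ⟨c', h⟩ := next b
      cases c' with
      | halt => exact expect_onQubits_le_weight _ (E.le_one h) ψ
      | step g c' => exact ih _ _ _

lemma opsFrom_nonneg (K : ℕ) : ∀ (next : Bool → Circuit n) (s : σ) (ψ : QState (Phys p)),
    0 ≤ S.opsFrom K next s ψ := by
  induction K with
  | zero => intro next s ψ; exact le_rfl
  | succ K ih =>
    intro next s ψ
    rw [opsFrom_succ]
    cases S.move s with
    | x i s' => exact add_nonneg (weight_nonneg _) (ih _ _ _)
    | z i s' => exact add_nonneg (weight_nonneg _) (ih _ _ _)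
    | st i j h s' => exact add_nonneg (weight_nonneg _) (add_nonneg (ih _ _ _) (ih _ _ _))
    | done b s' =>
      dsimp only
      cases next b with
      | halt => exact le_rfl
      | step g c' => exact ih _ _ _

lemma opsFrom_le_succ (K : ℕ) : ∀ (next : Bool → Circuit n) (s : σ) (ψ : QState (Phys p)),
    S.opsFrom K next s ψ ≤ S.opsFrom (K + 1) next s ψ := by
  induction K with
  | zero => intro next s ψ; exact S.opsFrom_nonneg 1 next s ψ
  | succ K ih =>
    intro next s ψ
    rw [opsFrom_succ, opsFrom_succ S (K + 1)]
    cases S.move s with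
    | x i s' => exact add_le_add le_rfl (ih _ _ _)
    | z i s' => exact add_le_add le_rfl (ih _ _ _)
    | st i j h s' => exact add_le_add le_rfl (add_le_add (ih _ _ _) (ih _ _ _))
    | done b s' =>
      dsimp only
      cases next b with
      | halt => exact le_rfl
      | step g c' => exact ih _ _ _

/-- Probabilities are quadratic forms in the state. This law is all of that fact that is needed,
both for averaging errors of opposite signs and for splitting the initial state into sectors. -/
lemma acceptFrom_parallelogram (K : ℕ) : ∀ (next : Bool → Circuit n × List Bool) (s : σ)
    (φ χ : QState (Phys p)), S.acceptFrom E K next s (φ + χ) + S.acceptFrom E K next s (φ - χ) =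
      2 * (S.acceptFrom E K next s φ + S.acceptFrom E K next s χ) := by
  induction K with
  | zero => intro next s φ χ; simp [acceptFrom]
  | succ K ih =>
    intro next s φ χ
    simp only [acceptFrom_succ]
    cases S.move s with
    | x i s' => simp only [map_add, map_sub, ih]
    | z i s' => simp only [map_add, map_sub, ih]
    | st i j h s' =>
      simp only [map_add, map_sub, add_sub_add_comm, sub_sub_sub_comm φ χ]
      linarith [ih next (s' true) (sg (allQubits _) i j φ) (sg (allQubits _) i j χ),
        ih next (s' false) (φ - sg (allQubits _) i j φ) (χ - sg (allQubits _) i j χ)]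
    | done b s' =>
      dsimp only
      obtain ⟨c', h⟩ := next b
      cases c' with
      | halt => exact expect_parallelogram _ _ _
      | step g c' => exact ih _ _ _ _

lemma opsFrom_parallelogram (K : ℕ) : ∀ (next : Bool → Circuit n) (s : σ)
    (φ χ : QState (Phys p)), S.opsFrom K next s (φ + χ) + S.opsFrom K next s (φ - χ) =
      2 * (S.opsFrom K next s φ + S.opsFrom K next s χ) := by
  induction K with
  | zero => intro next s φ χ; simp [opsFrom]
  | succ K ih =>
    intro next s φ χ
    simp only [opsFrom_succ]
    have hw := weight_parallelogram φ χ
    cases S.move s with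
    | x i s' =>
      simp only [map_add, map_sub]
      linarith [ih next s' (pa (allQubits _) .X i φ) (pa (allQubits _) .X i χ)]
    | z i s' =>
      simp only [map_add, map_sub]
      linarith [ih next s' (pa (allQubits _) .Z i φ) (pa (allQubits _) .Z i χ)]
    | st i j h s' =>
      simp only [map_add, map_sub, add_sub_add_comm, sub_sub_sub_comm φ χ]
      linarith [ih next (s' true) (sg (allQubits _) i j φ) (sg (allQubits _) i j χ),
        ih next (s' false) (φ - sg (allQubits _) i j φ) (χ - sg (allQubits _) i j χ)]
    | done b s' =>
      dsimp only
      cases next b with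
      | halt => simp
      | step g c' => exact ih _ _ _ _

/-- The limit of the acceptance probabilities within `K` moves. -/
def acceptLim (next : Bool → Circuit n × List Bool) (s : σ) (ψ : QState (Phys p)) : ℝ :=
  ⨆ K, S.acceptFrom E K next s ψ

lemma tendsto_acceptFrom (next : Bool → Circuit n × List Bool) (s : σ) (ψ : QState (Phys p)) :
    Tendsto (fun K => S.acceptFrom E K next s ψ) atTop (𝓝 (S.acceptLim E next s ψ)) :=
  tendsto_atTop_ciSup (monotone_nat_of_le_succ fun K => S.acceptFrom_le_succ E K next s ψ)
    ⟨weight ψ, by rintro _ ⟨K, rfl⟩; exact S.acceptFrom_le_weight E K next s ψ⟩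

/-- In the limit the loss of one move is immaterial, so the recursion holds without a counter. -/
lemma acceptLim_eq (next : Bool → Circuit n × List Bool) (s : σ) (ψ : QState (Phys p)) :
    S.acceptLim E next s ψ =
    match S.move s with
    | .x i s' => S.acceptLim E next s' (pa (allQubits _) .X i ψ)
    | .z i s' => S.acceptLim E next s' (pa (allQubits _) .Z i ψ)
    | .st i j _ s' => S.acceptLim E next (s' true) (sg (allQubits _) i j ψ) +
        S.acceptLim E next (s' false) (ψ - sg (allQubits _) i j ψ)
    | .done b s' =>
      match next b with
      | (.halt, h) => expect (onQubits (S.loc s') (E.effect h)) ψ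
      | (.step g c, h) => S.acceptLim E (fun b' => (c b', h ++ [b'])) (S.load g s') ψ := by
  refine tendsto_nhds_unique ((tendsto_add_atTop_iff_nat 1).2 (S.tendsto_acceptFrom E next s ψ))
    ?_
  simp only [acceptFrom_succ]
  cases S.move s with
  | x i s' => exact S.tendsto_acceptFrom E _ _ _
  | z i s' => exact S.tendsto_acceptFrom E _ _ _
  | st i j h s' => exact (S.tendsto_acceptFrom E _ _ _).add (S.tendsto_acceptFrom E _ _ _)
  | done b s' =>
    dsimp only
    obtain ⟨c', h⟩ := next b
    cases c' with
    | halt => exact tendsto_const_nhds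
    | step g c' => exact S.tendsto_acceptFrom E _ _ _

lemma acceptLim_smul (next : Bool → Circuit n × List Bool) (s : σ) (c : ℂ)
    (ψ : QState (Phys p)) :
    S.acceptLim E next s (c • ψ) = ‖c‖ ^ 2 * S.acceptLim E next s ψ := by
  refine tendsto_nhds_unique (S.tendsto_acceptFrom E next s _) ?_
  simp only [acceptFrom_smul]
  exact (S.tendsto_acceptFrom E next s ψ).const_mul _

lemma acceptLim_parallelogram (next : Bool → Circuit n × List Bool) (s : σ)
    (φ χ : QState (Phys p)) : S.acceptLim E next s (φ + χ) + S.acceptLim E next s (φ - χ) =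
      2 * (S.acceptLim E next s φ + S.acceptLim E next s χ) := by
  refine tendsto_nhds_unique
    ((S.tendsto_acceptFrom E next s _).add (S.tendsto_acceptFrom E next s _)) ?_
  simp only [acceptFrom_parallelogram]
  exact ((S.tendsto_acceptFrom E next s _).add (S.tendsto_acceptFrom E next s _)).const_mul _

end Basic

/-- A transformation of the states that commutes with all operations of the simulator. -/
structure IsSymmetry (Φ : QState (Phys p) → QState (Phys p)) : Prop where
  sub : ∀ φ χ, Φ (φ - χ) = Φ φ - Φ χ
  pauli : ∀ P i ψ, ∃ c : ℂ, ‖c‖ = 1 ∧ Φ (pa (allQubits _) P i ψ) = c • pa (allQubits _) P i (Φ ψ)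
  st : ∀ s i j h next, S.move s = .st i j h next →
    ∀ ψ, Φ (sg (allQubits _) i j ψ) = sg (allQubits _) i j (Φ ψ)
  weight : ∀ ψ, weight (Φ ψ) = weight ψ

variable {S}

/-- The symmetry commutes with every move up to a phase, so it can be pushed through the run to the
final test; the controller sees the same outcomes. -/
lemma IsSymmetry.acceptFrom {Φ : QState (Phys p) → QState (Phys p)} (hΦ : S.IsSymmetry Φ)
    {E E' : Test n}
    (hE : ∀ s h ψ, expect (onQubits (S.loc s) (E.effect h)) (Φ ψ) =
      expect (onQubits (S.loc s) (E'.effect h)) ψ) (K : ℕ) :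
    ∀ (next : Bool → Circuit n × List Bool) (s : σ) (ψ : QState (Phys p)),
      S.acceptFrom E K next s (Φ ψ) = S.acceptFrom E' K next s ψ := by
  induction K with
  | zero => intro next s ψ; rfl
  | succ K ih =>
    intro next s ψ
    rw [acceptFrom_succ, acceptFrom_succ]
    cases hm : S.move s with
    | x i s' =>
      obtain ⟨c, hc, h⟩ := hΦ.pauli .X i ψ
      dsimp only
      rw [← ih, h, acceptFrom_smul, hc]; ring
    | z i s' =>
      obtain ⟨c, hc, h⟩ := hΦ.pauli .Z i ψ
      dsimp only
      rw [← ih, h, acceptFrom_smul, hc]; ring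
    | st i j h s' =>
      dsimp only
      rw [← hΦ.st _ _ _ _ _ hm, ← hΦ.sub, ih, ih]
    | done b s' =>
      dsimp only
      obtain ⟨c', h⟩ := next b
      cases c' with
      | halt => exact hE _ _ _
      | step g c' => exact ih _ _ _

lemma IsSymmetry.acceptLim {Φ : QState (Phys p) → QState (Phys p)} (hΦ : S.IsSymmetry Φ)
    {E E' : Test n}
    (hE : ∀ s h ψ, expect (onQubits (S.loc s) (E.effect h)) (Φ ψ) =
      expect (onQubits (S.loc s) (E'.effect h)) ψ)
    (next : Bool → Circuit n × List Bool) (s : σ) (ψ : QState (Phys p)) :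
      S.acceptLim E next s (Φ ψ) = S.acceptLim E' next s ψ := by
  simp only [Simulator.acceptLim, hΦ.acceptFrom hE]

lemma IsSymmetry.opsFrom {Φ : QState (Phys p) → QState (Phys p)} (hΦ : S.IsSymmetry Φ) (K : ℕ) :
    ∀ (next : Bool → Circuit n) (s : σ) (ψ : QState (Phys p)),
      S.opsFrom K next s (Φ ψ) = S.opsFrom K next s ψ := by
  induction K with
  | zero => intro next s ψ; rfl
  | succ K ih =>
    intro next s ψ
    rw [opsFrom_succ, opsFrom_succ]
    cases hm : S.move s with
    | x i s' =>
      obtain ⟨c, hc, h⟩ := hΦ.pauli .X i ψ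
      dsimp only
      rw [← ih _ _ (pa _ _ _ ψ), h, opsFrom_smul, hc, hΦ.weight]; ring
    | z i s' =>
      obtain ⟨c, hc, h⟩ := hΦ.pauli .Z i ψ
      dsimp only
      rw [← ih _ _ (pa _ _ _ ψ), h, opsFrom_smul, hc, hΦ.weight]; ring
    | st i j h s' =>
      dsimp only
      rw [← hΦ.st _ _ _ _ _ hm, ← hΦ.sub, ih, ih, hΦ.weight]
    | done b s' =>
      dsimp only
      cases next b with
      | halt => rfl
      | step g c' => exact ih _ _ _

end Simulator

end

noncomputable section

set_option linter.unusedSectionVars false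

/-! ## The simulator that executes programs -/

section Machine

variable {n m p : ℕ}

/-- The labels of the logical qubits. -/
def dataQubits (n m : ℕ) : Fin n ↪ Lab n m := ⟨.data, fun _ _ h => by cases h; rfl⟩

/-- The program that executes an instruction. -/
def compile : Instr n → Prog (Lab n m)
  | .clifford _ hk _ hU e =>
    cliffProg (hU.word hk) (hU.str hk) (e.trans (dataQubits n m)) (.ret false)
  | .measure _ _ P e => measStr P (e.trans (dataQubits n m)) fun b => .ret b
  | .t i => tProg i (.ret false)

/-- The next move in the execution of a program.  Steps that do not act on any qubit are
replaced by two applications of `X`. -/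
def execMove (q : Lab n m ↪ Phys p) :
    Prog (Lab n m) × Stack (Lab n m) → Move p (Prog (Lab n m) × Stack (Lab n m))
  | (.x i k, s) => .x (q i) (k, s)
  | (.z i k, s) => .z (q i) (k, s)
  | (.st i j k, s) =>
    -- The model has no singlet/triplet measurement of a qubit with itself. The value chosen here is
    -- immaterial, since `Val` only concerns distinct qubits.
    if h : q i = q j then .x (q i) (k false, s) else .st (q i) (q j) h fun b => (k b, s)
  | (.loop b k, s) => .x (q .w) (.x .w b, (b, k) :: s)
  | (.ret true, (_, k) :: s) => .x (q .w) (.x .w k, s)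
  | (.ret false, (b, k) :: s) => .x (q .w) (.x .w b, (b, k) :: s)
  | (.ret b, []) => .done b (.ret b, [])

/-- The simulator that executes the program `prep` and then the instructions. -/
def machine (q : Lab n m ↪ Phys p) (prep : Prog (Lab n m)) :
    Simulator n p (Prog (Lab n m) × Stack (Lab n m)) where
  init := (prep, [])
  load g _ := (compile g, [])
  move := execMove q
  loc _ := (dataQubits n m).trans q

variable (q : Lab n m ↪ Phys p) (prep : Prog (Lab n m))

section Moves

variable (s : Stack (Lab n m))

lemma move_x (i : Lab n m) (k : Prog (Lab n m)) :
    (machine q prep).move (.x i k, s) = .x (q i) (k, s) := rfl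

lemma move_z (i : Lab n m) (k : Prog (Lab n m)) :
    (machine q prep).move (.z i k, s) = .z (q i) (k, s) := rfl

lemma move_st {i j : Lab n m} (h : i ≠ j) (k : Bool → Prog (Lab n m)) :
    (machine q prep).move (.st i j k, s) =
      .st (q i) (q j) (q.injective.ne h) fun b => (k b, s) :=
  dif_neg (q.injective.ne h)

lemma move_loop (b k : Prog (Lab n m)) :
    (machine q prep).move (.loop b k, s) = .x (q .w) (.x .w b, (b, k) :: s) := rfl

lemma move_ret_true (b k : Prog (Lab n m)) :
    (machine q prep).move (.ret true, (b, k) :: s) = .x (q .w) (.x .w k, s) := rfl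

lemma move_ret_false (b k : Prog (Lab n m)) :
    (machine q prep).move (.ret false, (b, k) :: s) = .x (q .w) (.x .w b, (b, k) :: s) := rfl

lemma move_ret_nil (b : Bool) :
    (machine q prep).move (.ret b, []) = .done b (.ret b, []) := by
  cases b <;> rfl

lemma move_st_range {s : Prog (Lab n m) × Stack (Lab n m)} {i j : Phys p} {h : i ≠ j}
    {next : Bool → Prog (Lab n m) × Stack (Lab n m)}
    (hs : (machine q prep).move s = .st i j h next) :
    i ∈ Set.range q ∧ j ∈ Set.range q := by
  obtain ⟨P, s⟩ := s
  cases P with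
  | x i k => rw [move_x] at hs; cases hs
  | z i k => rw [move_z] at hs; cases hs
  | loop b k => rw [move_loop] at hs; cases hs
  | st i' j' k =>
    by_cases h' : i' = j'
    · subst h'
      have : (machine q prep).move (.st i' i' k, s) = .x (q i') (k false, s) := dif_pos rfl
      rw [this] at hs; cases hs
    · rw [move_st q prep s h'] at hs
      cases hs
      exact ⟨⟨_, rfl⟩, ⟨_, rfl⟩⟩
  | ret b =>
    rcases s with _ | ⟨⟨b', k⟩, s⟩
    · rw [move_ret_nil] at hs; cases hs
    · cases b
      · rw [move_ret_false] at hs; cases hs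
      · rw [move_ret_true] at hs; cases hs

end Moves

lemma pa_allQubits (P : Pauli) (i : Lab n m) (ψ : QState (Phys p)) :
    pa (allQubits _) P (q i) ψ = pa q P i ψ := rfl

/-! ### Acceptance probabilities of the machine as instances of `Val` -/

section Accept

variable (E : Test n) (next : Bool → Circuit n × List Bool) (s : Stack (Lab n m))

lemma acceptLim_x (i : Lab n m) (k : Prog (Lab n m)) (ψ : QState (Phys p)) :
    (machine q prep).acceptLim E next (.x i k, s) ψ =
      (machine q prep).acceptLim E next (k, s) (pa q .X i ψ) := by
  rw [Simulator.acceptLim_eq, move_x]; rfl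

lemma acceptLim_z (i : Lab n m) (k : Prog (Lab n m)) (ψ : QState (Phys p)) :
    (machine q prep).acceptLim E next (.z i k, s) ψ =
      (machine q prep).acceptLim E next (k, s) (pa q .Z i ψ) := by
  rw [Simulator.acceptLim_eq, move_z]; rfl

lemma acceptLim_st {i j : Lab n m} (h : i ≠ j) (k : Bool → Prog (Lab n m))
    (ψ : QState (Phys p)) :
    (machine q prep).acceptLim E next (.st i j k, s) ψ =
      (machine q prep).acceptLim E next (k true, s) (sg q i j ψ) +
      (machine q prep).acceptLim E next (k false, s) (ψ - sg q i j ψ) := by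
  rw [Simulator.acceptLim_eq, move_st q prep s h]; rfl

lemma acceptLim_loop (b k : Prog (Lab n m)) (ψ : QState (Phys p)) :
    (machine q prep).acceptLim E next (.loop b k, s) ψ =
      (machine q prep).acceptLim E next (b, (b, k) :: s) ψ := by
  rw [Simulator.acceptLim_eq, move_loop]
  dsimp only
  rw [acceptLim_x, pa_allQubits, pa_self]

lemma acceptLim_ret_true (b k : Prog (Lab n m)) (ψ : QState (Phys p)) :
    (machine q prep).acceptLim E next (.ret true, (b, k) :: s) ψ =
      (machine q prep).acceptLim E next (k, s) ψ := by
  rw [Simulator.acceptLim_eq, move_ret_true]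
  dsimp only
  rw [acceptLim_x, pa_allQubits, pa_self]

lemma acceptLim_ret_false (b k : Prog (Lab n m)) (ψ : QState (Phys p)) :
    (machine q prep).acceptLim E next (.ret false, (b, k) :: s) ψ =
      (machine q prep).acceptLim E next (b, (b, k) :: s) ψ := by
  rw [Simulator.acceptLim_eq, move_ret_false]
  dsimp only
  rw [acceptLim_x, pa_allQubits, pa_self]

/-- The acceptance probability as a function of the program and the state. -/
def acceptVal : Val q 0 where
  f P s ψ := (machine q prep).acceptLim E next (P, s) ψ
  nonneg := le_rfl
  smul P s c ψ := Simulator.acceptLim_smul _ _ _ _ _ _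
  x_le i P s ψ := by rw [acceptLim_x]; linarith
  z_le i P s ψ := by rw [acceptLim_z]; linarith
  st_le i j P s ψ h := by rw [acceptLim_st _ _ _ _ _ h]; linarith
  loop_push b k s ψ := by rw [acceptLim_loop]; linarith
  ret_true b k s ψ := by rw [acceptLim_ret_true]; linarith
  ret_false b k s ψ := by rw [acceptLim_ret_false]; linarith

/-- The negative of the acceptance probability. -/
def negAcceptVal : Val q 0 where
  f P s ψ := -(machine q prep).acceptLim E next (P, s) ψ
  nonneg := le_rfl
  smul P s c ψ := by rw [Simulator.acceptLim_smul]; ring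
  x_le i P s ψ := by rw [acceptLim_x]; linarith
  z_le i P s ψ := by rw [acceptLim_z]; linarith
  st_le i j P s ψ h := by rw [acceptLim_st _ _ _ _ _ h]; linarith
  loop_push b k s ψ := by rw [acceptLim_loop]; linarith
  ret_true b k s ψ := by rw [acceptLim_ret_true]; linarith
  ret_false b k s ψ := by rw [acceptLim_ret_false]; linarith

end Accept

section Ops

variable (K : ℕ) (next : Bool → Circuit n) (s : Stack (Lab n m))

/-- The cutoff `K` is kept fixed: enlarging it by one before the move is executed only increases the
count. This makes the number of operations a `Val` with finite values, as an inequality. -/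
lemma opsFrom_x_le (i : Lab n m) (k : Prog (Lab n m)) (ψ : QState (Phys p)) :
    (machine q prep).opsFrom K next (.x i k, s) ψ ≤
      weight ψ + (machine q prep).opsFrom K next (k, s) (pa q .X i ψ) := by
  refine (Simulator.opsFrom_le_succ _ K _ _ _).trans_eq ?_
  rw [Simulator.opsFrom_succ, move_x]; rfl

lemma opsFrom_silent_le {P P' : Prog (Lab n m)} {s s' : Stack (Lab n m)}
    (h : (machine q prep).move (P, s) = .x (q .w) (.x .w P', s')) (ψ : QState (Phys p)) :
    (machine q prep).opsFrom K next (P, s) ψ ≤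
      1 * (2 * weight ψ) + (machine q prep).opsFrom K next (P', s') ψ := by
  refine (Simulator.opsFrom_le_succ _ K _ _ _).trans ?_
  rw [Simulator.opsFrom_succ, h]
  dsimp only
  have := opsFrom_x_le q prep K next s' .w P' (pa q .X .w ψ)
  rw [pa_self, weight_pa] at this
  rw [pa_allQubits]
  linarith

/-- The expected number of operations among the first `K` moves. -/
def opsVal : Val q 1 where
  f P s ψ := (machine q prep).opsFrom K next (P, s) ψ
  nonneg := zero_le_one
  smul P s c ψ := Simulator.opsFrom_smul _ _ _ _ _ _
  x_le i P s ψ := by rw [one_mul]; exact opsFrom_x_le q prep K next s i P ψ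
  z_le i P s ψ := by
    rw [one_mul]
    refine (Simulator.opsFrom_le_succ _ K _ _ _).trans_eq ?_
    rw [Simulator.opsFrom_succ, move_z]; rfl
  st_le i j P s ψ h := by
    rw [one_mul, add_assoc]
    refine (Simulator.opsFrom_le_succ _ K _ _ _).trans_eq ?_
    rw [Simulator.opsFrom_succ, move_st q prep s h]; rfl
  loop_push b k s ψ := opsFrom_silent_le q prep K next (move_loop q prep s b k) ψ
  ret_true b k s ψ := opsFrom_silent_le q prep K next (move_ret_true q prep s b k) ψ
  ret_false b k s ψ := opsFrom_silent_le q prep K next (move_ret_false q prep s b k) ψ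

end Ops

/-! ## The simulation of a circuit -/

/-- The limit of the acceptance probability in the simulation of `c` after the outcomes `h`. -/
def circuitLim (E : Test n) (c : Circuit n) (h : List Bool) (ψ : QState (Phys p)) : ℝ :=
  match c with
  | .halt => expect (onQubits ((dataQubits n m).trans q) (E.effect h)) ψ
  | .step g next =>
    (machine q prep).acceptLim E (fun b => (next b, h ++ [b])) (compile g, []) ψ

lemma acceptLim_ret (E : Test n) (next : Bool → Circuit n × List Bool) (b : Bool)
    (ψ : QState (Phys p)) : (machine q prep).acceptLim E next (.ret b, []) ψ =
      circuitLim q prep E (next b).1 (next b).2 ψ := by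
  rw [Simulator.acceptLim_eq, move_ret_nil]
  dsimp only
  rcases next b with ⟨_ | _, _⟩ <;> rfl

/-- The expected number of operations in the simulation of `c`. -/
def circuitOps (K : ℕ) (c : Circuit n) (ψ : QState (Phys p)) : ℝ :=
  match c with
  | .halt => 0
  | .step g next => (machine q prep).opsFrom K next (compile g, []) ψ

lemma opsFrom_ret_le (K : ℕ) (next : Bool → Circuit n) (b : Bool) (ψ : QState (Phys p)) :
    (machine q prep).opsFrom K next (.ret b, []) ψ ≤ circuitOps q prep K (next b) ψ := by
  refine (Simulator.opsFrom_le_succ _ K _ _ _).trans_eq ?_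
  rw [Simulator.opsFrom_succ, move_ret_nil]
  dsimp only
  rcases next b with _ | _ <;> rfl

end Machine

end

noncomputable section

set_option linter.unusedSectionVars false

/-! ## Perfect circuits on a subregister -/

section Ideal

variable {n : ℕ} {ι : Type} [Fintype ι] [DecidableEq ι]

/-- The acceptance probability when the circuit is run with perfect gates on the qubits `e`, in
the identical frame. -/
def liftAccept (e : Fin n ↪ ι) (E : Test n) : Circuit n → List Bool → QState ι → ℝ
  | .halt, h, ψ => expect (onQubits e (E.effect h)) ψ
  | .step g next, h, ψ =>
      liftAccept e E (next false) (h ++ [false]) (onQubits e (g.kraus false) *ᵥ ψ) +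
        liftAccept e E (next true) (h ++ [true]) (onQubits e (g.kraus true) *ᵥ ψ)

lemma weight_onQubits_of_unitary {κ : Type} [Fintype κ] [DecidableEq κ] (e : κ ↪ ι) {U : QOp κ}
    (hU : Uᴴ * U = 1) (ψ : QState ι) : weight (onQubits e U *ᵥ ψ) = weight ψ :=
  weight_mulVec_of_unitary (by
    rw [onQubits_conjTranspose, ← onQubits_mul, hU, onQubits_one]) ψ

lemma pauliString_conjTranspose {κ : Type} [Fintype κ] (R : κ → Pauli) :
    (pauliString R)ᴴ = pauliString R := by
  ext x y
  simp only [conjTranspose_apply, pauliString, of_apply, star_prod]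
  refine Finset.prod_congr rfl fun a _ => ?_
  rw [← conjTranspose_apply, Pauli.mat_conjTranspose]

lemma pauliString_conjTranspose_mul_self {κ : Type} [Fintype κ] [DecidableEq κ]
    (R : κ → Pauli) : (pauliString R)ᴴ * pauliString R = 1 := by
  rw [pauliString_conjTranspose, pauliString_mul_self]

lemma weight_half_add_half_sub {φ χ : QState ι} (h : weight χ = weight φ) :
    weight ((1 / 2 : ℂ) • (φ + χ)) + weight ((1 / 2 : ℂ) • (φ - χ)) = weight φ := by
  have := weight_parallelogram φ χ
  rw [weight_smul, weight_smul]
  norm_num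
  linarith

lemma tMat_conjTranspose_mul_self : tMatᴴ * tMat = 1 := by
  have h : (starRingEnd ℂ) (Complex.exp (Complex.I * (Real.pi / 4 : ℝ))) *
      Complex.exp (Complex.I * (Real.pi / 4 : ℝ)) = 1 := by
    rw [← Complex.exp_conj, ← Complex.exp_add, map_mul, Complex.conj_I, Complex.conj_ofReal]
    rw [neg_mul, neg_add_cancel, Complex.exp_zero]
  ext i j
  fin_cases i <;> fin_cases j <;> simp [tMat, mul_apply, Fin.sum_univ_two]
  simpa using h

lemma oneQubitOp_conjTranspose (A : Matrix (Fin 2) (Fin 2) ℂ) :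
    (oneQubitOp A)ᴴ = oneQubitOp Aᴴ := rfl

lemma weight_kraus (e : Fin n ↪ ι) (g : Instr n) (ψ : QState ι) :
    weight (onQubits e (g.kraus false) *ᵥ ψ) + weight (onQubits e (g.kraus true) *ᵥ ψ) =
      weight ψ := by
  cases g with
  | clifford k hk U hU a =>
    have h : Uᴴ * U = 1 := by
      rw [← star_eq_conjTranspose]; exact mem_unitaryGroup_iff'.1 hU.1
    rw [Instr.kraus, Instr.kraus, onQubits_trans, onQubits_zero, zero_mulVec, weight_zero,
      add_zero, weight_onQubits_of_unitary _ h]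
  | measure k hk P a =>
    have h := weight_onQubits_of_unitary (a.trans e) (pauliString_conjTranspose_mul_self P) ψ
    rw [Instr.kraus, Instr.kraus, onQubits_smul, onQubits_smul, onQubits_add, onQubits_sub,
      onQubits_one, onQubits_trans, smul_mulVec, smul_mulVec, add_mulVec, sub_mulVec, one_mulVec]
    exact weight_half_add_half_sub h
  | t i =>
    have h : (oneQubitOp tMat)ᴴ * oneQubitOp tMat = 1 := by
      rw [oneQubitOp_conjTranspose, ← oneQubitOp_mul, tMat_conjTranspose_mul_self, oneQubitOp_one]
    rw [Instr.kraus, Instr.kraus, onQubits_trans, onQubits_zero, zero_mulVec, weight_zero,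
      add_zero, weight_onQubits_of_unitary _ h]

section LiftAccept

variable (e : Fin n ↪ ι) (E : Test n)

lemma liftAccept_smul (c : Circuit n) : ∀ (h : List Bool) (z : ℂ) (ψ : QState ι),
    liftAccept e E c h (z • ψ) = ‖z‖ ^ 2 * liftAccept e E c h ψ := by
  induction c with
  | halt => intro h z ψ; exact expect_smul _ _ _
  | step g next ih =>
    intro h z ψ
    simp only [liftAccept, mulVec_smul, ih, mul_add]

lemma liftAccept_parallelogram (c : Circuit n) : ∀ (h : List Bool) (φ χ : QState ι),
    liftAccept e E c h (φ + χ) + liftAccept e E c h (φ - χ) =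
      2 * (liftAccept e E c h φ + liftAccept e E c h χ) := by
  induction c with
  | halt => intro h φ χ; exact expect_parallelogram _ _ _
  | step g next ih =>
    intro h φ χ
    simp only [liftAccept, mulVec_add, mulVec_sub]
    linarith [ih false (h ++ [false]) (onQubits e (g.kraus false) *ᵥ φ)
        (onQubits e (g.kraus false) *ᵥ χ),
      ih true (h ++ [true]) (onQubits e (g.kraus true) *ᵥ φ) (onQubits e (g.kraus true) *ᵥ χ)]

lemma liftAccept_nonneg (c : Circuit n) : ∀ (h : List Bool) (ψ : QState ι),
    0 ≤ liftAccept e E c h ψ := by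
  induction c with
  | halt => intro h ψ; exact expect_nonneg (onQubits_posSemidef _ (E.nonneg h)) _
  | step g next ih => intro h ψ; exact add_nonneg (ih _ _ _) (ih _ _ _)

lemma liftAccept_le_weight (c : Circuit n) : ∀ (h : List Bool) (ψ : QState ι),
    liftAccept e E c h ψ ≤ weight ψ := by
  induction c with
  | halt => intro h ψ; exact expect_onQubits_le_weight _ (E.le_one h) _
  | step g next ih =>
    intro h ψ
    exact (add_le_add (ih _ _ _) (ih _ _ _)).trans_eq (weight_kraus e g ψ)

end LiftAccept

end Ideal

/-! ## The simulation of circuits -/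

section Simulation

variable {n m : ℕ} {ι : Type} [Fintype ι] [DecidableEq ι] {q : Lab n m ↪ ι} {κ : ℝ}

lemma onQubits_data_pa (A : QOp (Fin n)) (P : Pauli) {i : Lab n m} (hi : ∀ d, i ≠ .data d)
    (ψ : QState ι) : pa q P i (onQubits ((dataQubits n m).trans q) A *ᵥ ψ) =
      onQubits ((dataQubits n m).trans q) A *ᵥ pa q P i ψ := by
  rw [pa_apply, pa_apply, mulVec_mulVec, mulVec_mulVec, pauliOp, onQubits_comm]
  rintro a b h
  exact hi _ (q.injective h)

/-- All conditions that define the space concern other qubits, hence commute with operators on the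
logical ones. -/
lemma restSpace.data_mem (A : QOp (Fin n)) {ψ : QState ι} (hψ : ψ ∈ restSpace q) :
    onQubits ((dataQubits n m).trans q) A *ᵥ ψ ∈ restSpace q := by
  have hsg : ∀ {i j : Lab n m}, (∀ d, i ≠ .data d) → (∀ d, j ≠ .data d) → sg q i j ψ = ψ →
      sg q i j (onQubits ((dataQubits n m).trans q) A *ᵥ ψ) =
        onQubits ((dataQubits n m).trans q) A *ᵥ ψ := by
    intro i j hi hj h
    conv_rhs => rw [← h]
    simp only [sg_apply, onQubits_data_pa A _ hi, onQubits_data_pa A _ hj, mulVec_smul,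
      mulVec_sub]
  rw [mem_restSpace] at hψ ⊢
  obtain ⟨⟨⟨⟨h1, h2⟩, h3⟩, h4⟩, h5⟩ := hψ
  rw [SetLike.mem_coe, Submodule.mem_iInf] at h3 h4
  refine ⟨⟨⟨⟨hsg (by simp) (by simp) h1, hsg (by simp) (by simp) h2⟩, ?_⟩, ?_⟩, fun i hi => ?_⟩
  · rw [SetLike.mem_coe, Submodule.mem_iInf]
    intro P
    rw [mem_fixedSpace, onQubits_data_pa A _ (by simp), mem_fixedSpace.1 (h3 P)]
  · rw [SetLike.mem_coe, Submodule.mem_iInf]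
    intro P
    rw [mem_fixedSpace, onQubits_data_pa A _ (by simp), mem_fixedSpace.1 (h4 P)]
  · rw [onQubits_data_pa A _ (by rintro d rfl; exact hi), h5 i hi]

/-- An estimate for an instruction follows from the estimates for its outcomes. -/
lemma Val.compile_le (G : Val q κ) {Q : Bool → QState ι → ℝ} {ε : ℝ}
    (hsmul : ∀ b (c : ℂ) ψ, Q b (c • ψ) = ‖c‖ ^ 2 * Q b ψ)
    (hpar : ∀ b φ χ, Q b (φ + χ) + Q b (φ - χ) = 2 * (Q b φ + Q b χ))
    (hdiff : ∀ b φ χ, weight φ = weight χ → Q b φ - Q b χ ≤ weight χ)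
    (h : ∀ b, ∀ φ ∈ restSpace q, G.f (.ret b) [] φ ≤ Q b φ + ε * weight φ) (g : Instr n)
    {ψ : QState ι} (hψ : ψ ∈ restSpace q) :
    G.f (compile g) [] ψ ≤ κ * ((25000 + g.tCost * (310000 * 64 ^ m)) * weight ψ) +
      (Q false (onQubits ((dataQubits n m).trans q) (g.kraus false) *ᵥ ψ) +
        Q true (onQubits ((dataQubits n m).trans q) (g.kraus true) *ᵥ ψ)) +
      (ε + g.tCost * errSin m ^ 2) * weight ψ := by
  have hs := (mem_restSpace.1 hψ).1
  have h0 : ∀ b, Q b 0 = 0 := by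
    intro b
    have := hsmul b 0 0
    simpa using this
  have hw := weight_kraus ((dataQubits n m).trans q) g ψ
  have hm := fun b => restSpace.data_mem (g.kraus b) hψ
  have n0 := G.cost_nonneg ψ
  cases g with
  | clifford d hd U hU e =>
    have t := G.clifford_le hd hU (e := e.trans (dataQubits n m)) (fun _ => trivial) hs
      (.ret false) []
    have e1 : onQubits ((e.trans (dataQubits n m)).trans q) U *ᵥ ψ =
        onQubits ((dataQubits n m).trans q) (Instr.kraus (.clifford d hd U hU e) false) *ᵥ ψ := by
      rw [Instr.kraus, onQubits_trans]; rfl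
    rw [e1] at t
    have t1 := h false _ (hm false)
    have e2 : onQubits ((dataQubits n m).trans q) (Instr.kraus (.clifford d hd U hU e) true) *ᵥ ψ
        = 0 := by
      rw [Instr.kraus, onQubits_zero, zero_mulVec]
    rw [e2, weight_zero, add_zero] at hw
    rw [e2, h0]
    rw [hw] at t1
    simp only [Instr.tCost, compile, Nat.cast_zero, zero_mul, add_zero]
    linarith
  | measure d hd P e =>
    have t := G.measStr_le hd P (e := e.trans (dataQubits n m)) (fun _ => trivial) hs
      (fun b => .ret b) []
    have e1 : ∀ b, (1 / 2 : ℂ) • (ψ + bsign b • strMap q P (e.trans (dataQubits n m)) ψ) =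
        onQubits ((dataQubits n m).trans q) (Instr.kraus (.measure d hd P e) b) *ᵥ ψ := by
      intro b
      rw [strMap, mulVecLin_apply]
      have e3 : onQubits ((e.trans (dataQubits n m)).trans q) (pauliString P) =
          onQubits ((dataQubits n m).trans q) (onQubits e (pauliString P)) := by
        rw [onQubits_trans]; rfl
      cases b
      · rw [Instr.kraus, onQubits_smul, onQubits_add, onQubits_one, smul_mulVec, add_mulVec,
          one_mulVec, e3, bsign_false, one_smul]
      · rw [Instr.kraus, onQubits_smul, onQubits_sub, onQubits_one, smul_mulVec, sub_mulVec,
          one_mulVec, e3, bsign_true, neg_one_smul, sub_eq_add_neg]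
    simp only [e1, Fintype.sum_bool] at t
    have t1 := h false _ (hm false)
    have t2 := h true _ (hm true)
    have t3 : ε * weight ψ = ε * (weight (onQubits ((dataQubits n m).trans q)
      (Instr.kraus (.measure d hd P e) false) *ᵥ ψ) + weight (onQubits ((dataQubits n m).trans q)
      (Instr.kraus (.measure d hd P e) true) *ᵥ ψ)) := by rw [hw]
    simp only [Instr.tCost, compile, Nat.cast_zero, zero_mul, add_zero]
    linarith
  | t d =>
    have t := G.tProg_le hψ d (.ret false) []
    have e1 : onQubits ((dataQubits n m).trans q) (Instr.kraus (.t d) false) *ᵥ ψ =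
        Complex.exp (Complex.I * (Real.pi / 8 : ℝ)) • tMap q d ψ := by
      rw [← tMat_mulVec, Instr.kraus, onQubits_trans]; rfl
    have e2 : onQubits ((dataQubits n m).trans q) (Instr.kraus (.t d) true) *ᵥ ψ = 0 := by
      rw [Instr.kraus, onQubits_zero, zero_mulVec]
    have hu : ‖Complex.exp (Complex.I * (Real.pi / 8 : ℝ))‖ = 1 := by
      rw [mul_comm]; exact Complex.norm_exp_ofReal_mul_I _
    rw [e1, e2, weight_smul, hu, weight_zero, one_pow, one_mul, add_zero] at hw
    rw [e1, e2, h0, hsmul, hu, one_pow, one_mul, add_zero]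
    have m0 := tMap_mem hψ d
    have m1 := restSpace.pa_mem m0 .Z d
    set χ := tMap q d ψ with hχ
    have t1 := h false _ (Submodule.sub_mem _ (Submodule.smul_mem _ (errCos m : ℂ) m0)
      (Submodule.smul_mem _ (Complex.I * errSin m) m1))
    have t2 := h false _ (Submodule.add_mem _ (Submodule.smul_mem _ (errCos m : ℂ) m0)
      (Submodule.smul_mem _ (Complex.I * errSin m) m1))
    -- The two outcomes of the `T` program are the sum and the difference of the same two vectors.
    -- By the parallelogram law their average has no cross term: it is a mixture of the exact state
    -- and its image under `Z`, with weights `errCos m ^ 2` and `errSin m ^ 2`.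
    have p1 := hpar false ((errCos m : ℂ) • χ) ((Complex.I * errSin m) • pa q .Z (.data d) χ)
    have p2 := weight_parallelogram ((errCos m : ℂ) • χ)
      ((Complex.I * errSin m) • pa q .Z (.data d) χ)
    have c1 : ‖(errCos m : ℂ)‖ ^ 2 = errCos m ^ 2 := by
      rw [Complex.norm_real, Real.norm_eq_abs, sq_abs]
    have c2 : ‖Complex.I * (errSin m : ℂ)‖ ^ 2 = errSin m ^ 2 := by
      rw [norm_mul, Complex.norm_I, one_mul, Complex.norm_real, Real.norm_eq_abs, sq_abs]
    rw [hsmul, hsmul, c1, c2] at p1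
    rw [weight_smul, weight_smul, weight_pa, c1, c2, hw, ← add_mul, errCos_sq_add_errSin_sq,
      one_mul] at p2
    -- Replacing the image under `Z` by the exact state changes the value by at most the weight;
    -- this is the error of the gate.
    have d1 := mul_le_mul_of_nonneg_left (hdiff false (pa q .Z (.data d) χ) χ (weight_pa _ _ _ _))
      (sq_nonneg (errSin m))
    have d2 := errCos_sq_add_errSin_sq m
    have d3 : errCos m ^ 2 = 1 - errSin m ^ 2 := by linarith
    rw [d3] at p1
    rw [hw] at d1
    have p3 : ε * _ = ε * _ := congrArg (ε * ·) p2
    simp only [Instr.tCost, compile, Nat.cast_one, one_mul]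
    linarith

end Simulation

section Machine

variable {n m p : ℕ} (q : Lab n m ↪ Phys p) (prep : Prog (Lab n m))

/-- Induction on the circuit, with the one-instruction estimate applied to the acceptance
probability and to its negative. The errors of later gates are proportional to the weight of the
branch and add up to those of the worst branch. -/
lemma circuitLim_bounds (E : Test n) (c : Circuit n) : ∀ (h : List Bool) (ψ : QState (Phys p)),
    ψ ∈ restSpace q →
    |circuitLim q prep E c h ψ - liftAccept ((dataQubits n m).trans q) E c h ψ| ≤
      c.tCount * errSin m ^ 2 * weight ψ := by
  induction c with
  | halt => intro h ψ _; simp [circuitLim, liftAccept, Circuit.tCount]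
  | step g next ih =>
    intro h ψ hψ
    set e := (dataQubits n m).trans q with he
    set τ : ℕ := max (next false).tCount (next true).tCount with hτ
    have hmono : ∀ (b : Bool) (φ : QState (Phys p)), ((next b).tCount : ℝ) * errSin m ^ 2 * weight φ ≤
        τ * errSin m ^ 2 * weight φ := by
      intro b φ
      have : (next b).tCount ≤ τ := by cases b <;> simp [hτ]
      have n1 := weight_nonneg φ
      gcongr
    have h1 := (acceptVal q prep E fun b => (next b, h ++ [b])).compile_le
      (Q := fun b => liftAccept e E (next b) (h ++ [b])) (ε := τ * errSin m ^ 2)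
      (fun b c ψ => liftAccept_smul e E _ _ _ _) (fun b φ χ => liftAccept_parallelogram e E _ _ _ _)
      (fun b φ χ hw => by
        have := liftAccept_le_weight e E (next b) (h ++ [b]) φ
        have := liftAccept_nonneg e E (next b) (h ++ [b]) χ
        linarith)
      (fun b φ hφ => by
        change (machine q prep).acceptLim E _ (.ret b, []) φ ≤ _
        rw [acceptLim_ret]
        have := (abs_le.1 (ih b (h ++ [b]) φ hφ)).2
        linarith [hmono b φ]) g hψ
    have h2 := (negAcceptVal q prep E fun b => (next b, h ++ [b])).compile_le
      (Q := fun b ψ => -liftAccept e E (next b) (h ++ [b]) ψ) (ε := τ * errSin m ^ 2)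
      (fun b c ψ => by rw [liftAccept_smul]; ring)
      (fun b φ χ => by linarith [liftAccept_parallelogram e E (next b) (h ++ [b]) φ χ])
      (fun b φ χ hw => by
        have := liftAccept_le_weight e E (next b) (h ++ [b]) χ
        have := liftAccept_nonneg e E (next b) (h ++ [b]) φ
        linarith)
      (fun b φ hφ => by
        change -(machine q prep).acceptLim E _ (.ret b, []) φ ≤ _
        rw [acceptLim_ret]
        have := (abs_le.1 (ih b (h ++ [b]) φ hφ)).1
        linarith [hmono b φ]) g hψ
    change circuitLim q prep E (.step g next) h ψ ≤ _ at h1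
    change -circuitLim q prep E (.step g next) h ψ ≤ _ at h2
    rw [abs_le, liftAccept, Circuit.tCount]
    push_cast
    rw [← Nat.cast_max, ← hτ]
    constructor <;> linarith

lemma circuitOps_le (K : ℕ) (c : Circuit n) : ∀ ψ ∈ restSpace q,
    circuitOps q prep K c ψ ≤
      (25000 * c.depth + 320000 * 64 ^ m * c.tCount) * weight ψ := by
  induction c with
  | halt => intro ψ _; simp [circuitOps, Circuit.depth, Circuit.tCount]
  | step g next ih =>
    intro ψ hψ
    set τ : ℕ := max (next false).tCount (next true).tCount with hτ
    set d : ℕ := max (next false).depth (next true).depth with hd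
    -- With `Q = 0`, the cost of the rest of the circuit takes the place of the error term, which is
    -- also proportional to the weight.
    have h1 := (opsVal q prep K next).compile_le (Q := fun _ _ => 0)
      (ε := 25000 * d + 320000 * 64 ^ m * τ) (fun b c ψ => by simp)
      (fun b φ χ => by simp) (fun b φ χ hw => by simpa using weight_nonneg χ)
      (fun b φ hφ => by
        refine (opsFrom_ret_le q prep K next b φ).trans ((ih b φ hφ).trans ?_)
        have e1 : (next b).tCount ≤ τ := by cases b <;> simp [hτ]
        have e2 : (next b).depth ≤ d := by cases b <;> simp [hd]
        have n1 := weight_nonneg φ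
        rw [zero_add]
        gcongr) g hψ
    change circuitOps q prep K (.step g next) ψ ≤ _ at h1
    -- The estimate also adds `errSin m ^ 2` for a `T` gate, which is harmless here: it is absorbed
    -- in passing from 310000 to 320000.
    have hs : errSin m ^ 2 ≤ 1 := by
      have := errCos_sq_add_errSin_sq m
      nlinarith [sq_nonneg (errCos m)]
    have h64 : (1 : ℝ) ≤ 64 ^ m := one_le_pow₀ (by norm_num)
    have n1 := weight_nonneg ψ
    have n2 : (0 : ℝ) ≤ g.tCost * weight ψ := by positivity
    have n3 := mul_le_mul_of_nonneg_right hs n2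
    have n4 := mul_le_mul_of_nonneg_right h64 n2
    rw [Circuit.tCount, Circuit.depth, ← hτ, ← hd]
    push_cast
    linarith

end Machine

end

noncomputable section

set_option linter.unusedSectionVars false

/-! ## Preparation of the register and the ancillas -/

section Prepare

variable {n m : ℕ}

/-- Projects the qubit `i` onto an eigenvector of `P` and makes it the `1`-eigenvector. -/
def fixProg (P : Pauli) (i : Lab n m) (k : Prog (Lab n m)) : Prog (Lab n m) :=
  meas P i fun b => if b then pauliProg P.other i k else k

/-- Applies `fixProg` to the Pauli matrices and qubits of a list. -/
def fixAll : List (Pauli × Lab n m) → Prog (Lab n m) → Prog (Lab n m)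
  | [], k => k
  | e :: l, k => fixProg e.1 e.2 (fixAll l k)

variable (n m) in
/-- The eigenstates to be prepared. -/
def initList : List (Pauli × Lab n m) :=
  (.X, .scr .X) :: (.Y, .scr .Y) :: (.Z, .scr .Z) :: (.Z, .w) :: (.Z, .x) ::
    ((List.finRange m).map (fun j => (.Z, .y j)) ++ (List.finRange n).map fun d => (.Z, .data d))

variable (n m) in
/-- The program that prepares the register and the ancillas. -/
def initProg : Prog (Lab n m) := fixAll (initList n m) (.ret false)

variable (n m) in
lemma length_initList : (initList n m).length = n + m + 5 := by
  simp [initList]; omega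

lemma initList_pairwise : (initList n m).Pairwise fun a b => a.2 ≠ b.2 := by
  have hy : ((List.finRange m).map fun j => ((.Z, .y j) : Pauli × Lab n m)).Pairwise
      fun a b => a.2 ≠ b.2 :=
    List.pairwise_map.2 ((List.nodup_finRange m).imp fun h => by simpa using h)
  have hd : ((List.finRange n).map fun d => ((.Z, .data d) : Pauli × Lab n m)).Pairwise
      fun a b => a.2 ≠ b.2 :=
    List.pairwise_map.2 ((List.nodup_finRange n).imp fun h => by simpa using h)
  have := List.pairwise_append.2 ⟨hy, hd, by simp⟩
  simp only [initList, List.pairwise_cons, this, and_true, List.mem_cons, List.mem_append,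
    List.mem_map]
  refine ⟨?_, ?_, ?_, ?_, ?_⟩
  all_goals
    rintro e he
    aesop

lemma mem_initList {e : Pauli × Lab n m} (h : e ∈ initList n m) :
    e.1 ≠ .I ∧ (∀ k, e.2 ≠ .cat k) ∧ ∀ P, e.2 ≠ .ref P := by
  simp only [initList, List.mem_cons, List.mem_append, List.mem_map] at h
  rcases h with rfl | rfl | rfl | rfl | rfl | ⟨_, _, rfl⟩ | ⟨_, _, rfl⟩ <;> simp

variable {ι : Type} [Fintype ι] [DecidableEq ι] {q : Lab n m ↪ ι} {κ : ℝ}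

lemma mem_restSpace_of_initList {φ : QState ι} (hφ : φ ∈ refSpace q)
    (h : ∀ e ∈ initList n m, pa q e.1 e.2 φ = φ) :
    φ ∈ restSpace q ∧ ∀ d, pa q .Z (.data d) φ = φ := by
  refine ⟨mem_restSpace.2 ⟨⟨hφ, ?_⟩, ?_⟩, fun d => h (.Z, .data d) (by simp [initList])⟩
  · rw [SetLike.mem_coe, Submodule.mem_iInf]
    intro P
    rw [mem_fixedSpace]
    cases P with
    | I => exact pa_I q _ _
    | X => exact h (.X, .scr .X) (by simp [initList])
    | Y => exact h (.Y, .scr .Y) (by simp [initList])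
    | Z => exact h (.Z, .scr .Z) (by simp [initList])
  · intro i hi
    cases i with
    | w => exact h (.Z, .w) (by simp [initList])
    | x => exact h (.Z, .x) (by simp [initList])
    | y j => exact h (.Z, .y j) (by simp [initList])
    | _ => exact hi.elim

namespace Val

variable (G : Val q κ)

/-- The space `R` collects the eigenvalue conditions established so far. They survive because the
remaining operations act on different qubits. Both outcomes end in the same shrinking space, and
their weights add up, so no success probability is lost. -/
lemma fixAll_le {k : Prog (Lab n m)} {s : Stack (Lab n m)} {β : ℝ} :
    ∀ (l : List (Pauli × Lab n m)) (R : Submodule ℂ (QState ι)), R ≤ refSpace q →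
    (∀ e ∈ l, ∀ P, ∀ φ ∈ R, pa q P e.2 φ ∈ R) →
    (∀ e ∈ l, e.1 ≠ .I ∧ (∀ k, e.2 ≠ .cat k) ∧ ∀ P, e.2 ≠ .ref P) →
    l.Pairwise (fun a b => a.2 ≠ b.2) →
    (∀ φ ∈ R, (∀ e ∈ l, pa q e.1 e.2 φ = φ) → G.f k s φ ≤ β * weight φ) →
    ∀ ψ ∈ R, G.f (fixAll l k) s ψ ≤ (κ * (222 * l.length) + β) * weight ψ
  | [], R, _, _, _, _, hk, ψ, hψ => by simpa [fixAll] using hk ψ hψ (by simp)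
  | (P, i) :: l, R, hR, hcl, hl, hp, hk, ψ, hψ => by
    obtain ⟨hP, hc, hr⟩ := hl _ List.mem_cons_self
    rw [List.pairwise_cons] at hp
    dsimp only at hP hc hr hp
    have hpaR := hcl _ List.mem_cons_self
    dsimp only at hpaR
    have ih := fixAll_le (k := k) (s := s) (β := β) l (R ⊓ fixedSpace (pa q P i))
      (inf_le_left.trans hR)
      (fun e he Q φ hφ => ⟨hcl e (List.mem_cons_of_mem _ he) Q φ hφ.1,
        fixedSpace_of_comm (fun _ => pa_comm q _ _ (hp.1 e he) _) hφ.2⟩)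
      (fun e he => hl e (List.mem_cons_of_mem _ he)) hp.2
      (fun φ hφ h => hk φ hφ.1 fun e he => by
        rcases List.mem_cons.1 he with rfl | he
        · exact hφ.2
        · exact h e he)
    have hanti : P.anti P.other = true := by cases P <;> simp [Pauli.anti, Pauli.other] at hP ⊢
    have h := G.meas_le hP hc (hr P) (hR hψ)
      (fun b => if b then pauliProg P.other i (fixAll l k) else fixAll l k) s
    simp only [Fintype.sum_bool, bsign_true, bsign_false, one_smul, neg_smul, ← sub_eq_add_neg,
      if_true, Bool.false_eq_true, if_false] at h
    set φ₀ := (1 / 2 : ℂ) • (ψ + pa q P i ψ) with hφ₀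
    set φ₁ := (1 / 2 : ℂ) • (ψ - pa q P i ψ) with hφ₁
    have h1 := G.pauli_le P.other i (fixAll l k) s φ₁
    have m0 : φ₀ ∈ R ⊓ fixedSpace (pa q P i) := by
      refine ⟨R.smul_mem _ (R.add_mem hψ (hpaR P ψ hψ)), ?_⟩
      rw [SetLike.mem_coe, mem_fixedSpace, hφ₀, map_smul, map_add, pa_self, add_comm]
    -- The matrix `P.other` anticommutes with `P` and exchanges its two eigenspaces.
    have m1 : pa q P.other i φ₁ ∈ R ⊓ fixedSpace (pa q P i) := by
      refine ⟨hpaR _ _ (R.smul_mem _ (R.sub_mem hψ (hpaR P ψ hψ))), ?_⟩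
      rw [SetLike.mem_coe, mem_fixedSpace, pa_anti, hanti, ← map_smul]
      congr 1
      rw [hφ₁, map_smul, map_sub, pa_self, bsign_true, smul_comm]
      module
    have i0 := ih _ m0
    have i1 := ih _ m1
    rw [weight_pa] at i1
    have hw := weight_half_add_half_sub (φ := ψ) (χ := pa q P i ψ) (weight_pa _ _ _ _)
    rw [← hφ₀, ← hφ₁] at hw
    have hc0 := G.cost_nonneg φ₀
    rw [fixAll, fixProg]
    simp only [List.length_cons]
    push_cast
    rw [← hw] at h ⊢
    linarith

lemma initProg_le {s : Stack (Lab n m)} {β : ℝ}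
    (hk : ∀ φ ∈ restSpace q, (∀ d, pa q .Z (.data d) φ = φ) →
      G.f (.ret false) s φ ≤ β * weight φ) {ψ : QState ι} (hψ : ψ ∈ refSpace q) :
    G.f (initProg n m) s ψ ≤ (κ * (222 * (n + m + 5)) + β) * weight ψ := by
  have := G.fixAll_le (k := .ret false) (s := s) (β := β) (initList n m) (refSpace q) le_rfl
    (fun e he P φ hφ => refSpace.pa_mem hφ P (mem_initList he).2.1 (mem_initList he).2.2)
    (fun e he => mem_initList he) initList_pairwise
    (fun φ hφ h => hk φ (mem_restSpace_of_initList hφ h).1 (mem_restSpace_of_initList hφ h).2)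
    ψ hψ
  rw [length_initList] at this
  push_cast at this
  exact this

end Val

end Prepare

end

noncomputable section

set_option linter.unusedSectionVars false

/-! ## Frames -/

section Frames

variable {κ ι : Type} [Fintype κ] [DecidableEq κ] [Fintype ι] [DecidableEq ι]

lemma onQubits_refl (A : QOp ι) : onQubits (allQubits ι) A = A := by
  ext x y
  simp [onQubits, Function.comp_def]

lemma onQubits_pauliString (e : κ ↪ ι) {S : ι → Pauli} (hS : ∀ i ∉ Set.range e, S i = .I) :
    onQubits e (pauliString (S ∘ e)) = pauliString S := by
  ext x y
  simp only [onQubits, pauliString, of_apply]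
  split_ifs with h
  · refine Finset.prod_of_injOn e e.injective.injOn (by simp) (fun i _ hi => ?_)
      fun k _ => rfl
    have hi' : i ∉ Set.range e := by simpa using hi
    rw [hS i hi', h i hi']
    simp [Pauli.mat]
  · push Not at h
    obtain ⟨i, hi, hxy⟩ := h
    refine (Finset.prod_eq_zero (Finset.mem_univ i) ?_).symm
    rw [hS i hi]
    simp [Pauli.mat, hxy]

/-- The factors of `R` outside the range of `e` commute with the operator and square to one, so only
those inside remain. -/
lemma pauliString_conj_onQubits (R : ι → Pauli) (e : κ ↪ ι) (E : QOp κ) :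
    pauliString R * onQubits e E * pauliString R =
      onQubits e (pauliString (R ∘ e) * E * pauliString (R ∘ e)) := by
  classical
  let f : {i // i ∉ Set.range e} ↪ ι := Function.Embedding.subtype _
  let S : ι → Pauli := fun i => if i ∈ Set.range e then R i else .I
  let W : ι → Pauli := fun i => if i ∈ Set.range e then .I else R i
  have hS : onQubits e (pauliString (R ∘ e)) = pauliString S := by
    have : R ∘ e = S ∘ e := by funext k; simp [S]
    rw [this]
    exact onQubits_pauliString e fun i hi => if_neg hi
  have hW : onQubits f (pauliString (W ∘ f)) = pauliString W :=
    onQubits_pauliString f fun i hi => if_pos (by simpa [f] using hi)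
  have hSW : pauliString S * pauliString W = pauliString R := by
    rw [pauliString_mul, Finset.prod_eq_one, one_smul]
    · congr 1; funext i
      by_cases hi : i ∈ Set.range e <;> simp only [S, W, if_pos, if_neg, hi, not_false_eq_true] <;>
        cases R i <;> rfl
    · intro i _
      by_cases hi : i ∈ Set.range e <;> simp only [S, W, if_pos, if_neg, hi, not_false_eq_true] <;>
        cases R i <;> rfl
  have hc : ∀ A : QOp κ, pauliString W * onQubits e A = onQubits e A * pauliString W := fun A => by
    rw [← hW]
    exact (onQubits_comm e f (fun j k h => k.2 ⟨j, h⟩) A _).symm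
  rw [onQubits_mul, onQubits_mul, hS, ← hSW]
  calc pauliString S * pauliString W * onQubits e E * (pauliString S * pauliString W)
      = pauliString S * (pauliString W * onQubits e E) * (pauliString S * pauliString W) := by
        simp only [Matrix.mul_assoc]
    _ = pauliString S * onQubits e E * (pauliString W * pauliString S) * pauliString W := by
        rw [hc]; simp only [Matrix.mul_assoc]
    _ = pauliString S * onQubits e E * pauliString S * (pauliString W * pauliString W) := by
        rw [← hS, hc]; simp only [Matrix.mul_assoc]
    _ = _ := by rw [pauliString_mul_self, Matrix.mul_one]

/-- Complex conjugation, if `conj` is true, followed by the same Pauli matrix on every qubit. -/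
def frameMap (P : Pauli) (conj : Bool) (ψ : QState ι) : QState ι :=
  pauliString (fun _ => P) *ᵥ (if conj then star ψ else ψ)

/-- The effect `E` in another frame. -/
def frameOp (P : Pauli) (conj : Bool) (E : QOp κ) : QOp κ :=
  let F := pauliString (fun _ => P) * E * pauliString (fun _ => P)
  if conj then (Fᴴ)ᵀ else F

lemma expect_star (E : QOp ι) (ψ : QState ι) : expect E (star ψ) = expect (Eᴴ)ᵀ ψ := by
  have h : star ψ ⬝ᵥ ((Eᴴ)ᵀ *ᵥ ψ) = star (star (star ψ) ⬝ᵥ (E *ᵥ star ψ)) := by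
    simp only [dotProduct, mulVec, star_sum, star_mul', Pi.star_apply, star_star,
      transpose_apply, conjTranspose_apply]
  rw [expect, expect, h]
  exact (Complex.conj_re _).symm

lemma expect_frameMap (e : κ ↪ ι) (P : Pauli) (conj : Bool) (E : QOp κ) (ψ : QState ι) :
    expect (onQubits e E) (frameMap P conj ψ) = expect (onQubits e (frameOp P conj E)) ψ := by
  rw [frameMap, expect_mulVec, pauliString_conjTranspose, pauliString_conj_onQubits]
  cases conj with
  | false => rfl
  | true =>
    rw [if_pos rfl, expect_star]
    congr 1
    rw [onQubits_conjTranspose]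
    ext x y
    simp only [onQubits, frameOp, transpose_apply, of_apply, if_pos]
    by_cases h : ∀ q ∉ Set.range e, x q = y q
    · rw [if_pos h, if_pos fun q hq => (h q hq).symm]
      rfl
    · rw [if_neg h, if_neg fun h' => h fun q hq => (h' q hq).symm]

lemma frameOp_posSemidef (P : Pauli) (conj : Bool) {E : QOp κ} (hE : E.PosSemidef) :
    (frameOp P conj E).PosSemidef := by
  have h := hE.mul_mul_conjTranspose_same (pauliString fun _ => P)
  rw [pauliString_conjTranspose] at h
  cases conj with
  | false => exact h
  | true => exact h.conjTranspose.transpose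

lemma one_sub_frameOp (P : Pauli) (conj : Bool) (E : QOp κ) :
    1 - frameOp P conj E = frameOp P conj (1 - E) := by
  cases conj <;> simp [frameOp, Matrix.mul_sub, Matrix.sub_mul, pauliString_mul_self]

variable {n : ℕ}

/-- The test `E` in another frame. -/
def Test.frame (E : Test n) (P : Pauli) (conj : Bool) : Test n where
  effect h := frameOp P conj (E.effect h)
  nonneg h := frameOp_posSemidef P conj (E.nonneg h)
  le_one h := by rw [one_sub_frameOp]; exact frameOp_posSemidef P conj (E.le_one h)

/-- The sum over the eight frames. -/
def frameSum (f : Pauli → Bool → ℝ) : ℝ :=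
  ∑ conj : Bool, (f .I conj + f .X conj + f .Y conj + f .Z conj)

/-- The frame acts only at the end of the perfect circuit, so it can be transferred from the final
state to the test. It then suffices to compare each of the eight tests in the identical frame. -/
lemma Circuit.accept_eq (E : Test n) (c : Circuit n) : ∀ (h : List Bool) (ψ : QState (Fin n)),
    c.accept E h ψ = 1 / 8 * frameSum fun P conj =>
      liftAccept (allQubits (Fin n)) (E.frame P conj) c h ψ := by
  induction c with
  | halt =>
    intro h ψ
    have key : ∀ P conj, expect (E.effect h) (inFrame P conj ψ) =
        liftAccept (allQubits (Fin n)) (E.frame P conj) .halt h ψ := fun P conj => by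
      rw [liftAccept, Test.frame, ← expect_frameMap, onQubits_refl]; rfl
    simp only [Circuit.accept, frameExpect, frameSum, key]
  | step g next ih =>
    intro h ψ
    simp only [Circuit.accept, ih, frameSum, liftAccept, onQubits_refl, Fintype.sum_bool]
    ring

/-- If the qubits `e` are all in `|0⟩`, the state is a product, and only one matrix element of the
operator matters. -/
lemma expect_onQubits_of_zero (e : Fin n ↪ ι) (B : QOp (Fin n)) {φ : QState ι}
    (hφ : ∀ x, x ∘ e ≠ 0 → φ x = 0) : expect (onQubits e B) φ = weight φ * (B 0 0).re := by
  have h : ∀ x, star (φ x) * (onQubits e B *ᵥ φ) x = B 0 0 * ((‖φ x‖ ^ 2 : ℝ) : ℂ) := by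
    intro x
    by_cases hx : x ∘ e = 0
    · rw [onQubits_mulVec, Finset.sum_eq_single 0, hx]
      · have : Function.extend e 0 x = x := by
          funext i
          by_cases hi : ∃ k, e k = i
          · obtain ⟨k, rfl⟩ := hi
            rw [e.injective.extend_apply]
            exact (congrFun hx k).symm
          · rw [Function.extend_apply' _ _ _ hi]
        rw [this, mul_left_comm, ← starRingEnd_apply, Complex.conj_mul', Complex.ofReal_pow]
      · intro u _ hu
        rw [hφ _ (by rwa [extend_comp_self]), mul_zero]
      · simp
    · rw [hφ x hx]; simp
  have hs : star φ ⬝ᵥ (onQubits e B *ᵥ φ) = B 0 0 * ((weight φ : ℝ) : ℂ) := by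
    rw [weight, Complex.ofReal_sum, Finset.mul_sum]
    exact Finset.sum_congr rfl fun x _ => h x
  rw [expect, hs, Complex.re_mul_ofReal, mul_comm]

lemma zeroState_of_ne {x : Fin n → Fin 2} (hx : x ∘ allQubits (Fin n) ≠ 0) :
    zeroState n x = 0 := if_neg hx

lemma weight_zeroState : weight (zeroState n) = 1 := by
  simp [weight, zeroState, apply_ite]

/-- This passes from the physical register, whose other qubits are in an arbitrary state, to a
register of only `n` qubits. Carrying the accumulated operator `A` makes the induction work. -/
lemma liftAccept_of_zero (e : Fin n ↪ ι) (E : Test n) {φ : QState ι}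
    (hφ : ∀ x, x ∘ e ≠ 0 → φ x = 0) (c : Circuit n) : ∀ (h : List Bool) (A : QOp (Fin n)),
    liftAccept e E c h (onQubits e A *ᵥ φ) =
      liftAccept (allQubits (Fin n)) E c h (A *ᵥ zeroState n) * weight φ := by
  induction c with
  | halt =>
    intro h A
    have h1 := expect_onQubits_of_zero e (Aᴴ * E.effect h * A) hφ
    have h2 := expect_onQubits_of_zero (allQubits (Fin n)) (Aᴴ * E.effect h * A)
      (fun x => zeroState_of_ne)
    rw [weight_zeroState, one_mul, onQubits_refl] at h2
    rw [liftAccept, liftAccept, onQubits_refl, expect_mulVec, expect_mulVec, h2, mul_comm, ← h1,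
      onQubits_mul, onQubits_mul, onQubits_conjTranspose]
  | step g next ih =>
    intro h A
    simp only [liftAccept, onQubits_refl, mulVec_mulVec, ← onQubits_mul, ih, add_mul]

lemma eq_zero_of_pa_Z {V : Type} (q : V ↪ ι) {i : V} {φ : QState ι} (h : pa q .Z i φ = φ)
    {x : ι → Fin 2} (hx : x (q i) ≠ 0) : φ x = 0 := by
  have h1 := congrFun h x
  have hx1 : x (q i) = 1 := by omega
  have hu : Function.update x (q i) 1 = x := by rw [← hx1, Function.update_eq_self]
  rw [pa_apply, pauliOp_mulVec, hx1, hu] at h1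
  simp only [Pauli.mat, of_apply, cons_val', cons_val_zero, cons_val_one, cons_val_fin_one,
    zero_mul, zero_add, neg_mul, one_mul] at h1
  exact self_eq_neg.1 h1.symm

end Frames

end

noncomputable section

set_option linter.unusedSectionVars false

/-! ## The product of singlets -/

section Singlets

variable {p : ℕ}

lemma sum_prod_pairs (f : Fin p → (Fin 2 → Fin 2) → ℂ) :
    ∑ x : Phys p → Fin 2, ∏ a, f a (fun b => x (a, b)) = ∏ a, ∑ u, f a u := by
  rw [Finset.prod_univ_sum, Fintype.piFinset_univ, ← Equiv.sum_comp (Equiv.curry _ _ _)]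
  rfl

lemma star_singlet : star singlet = singlet := by
  funext x
  simp only [Pi.star_apply, singlet]
  split_ifs <;> simp

lemma singlet_normalized : ∑ u, singlet u * singlet u = 1 := by
  rw [sum_fin_two_fun]
  simp only [singlet_apply]
  have h := sqrt_two_inv_mul
  rw [one_div] at h
  simp [h]
  norm_num

/-- The singlet is antisymmetric, so `P ⊗ P` multiplies it by the determinant of `P`, which is -1
unless `P` is the identity. -/
lemma pauli_pair_singlet (P : Pauli) (x : Fin 2 → Fin 2) :
    ∑ u, (∏ b, P.mat (x b) (u b)) * singlet u = bsign (P.anti .X || P.anti .Z) * singlet x := by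
  rw [sum_fin_two_fun, fin_two_fun x]
  generalize x 0 = a
  generalize x 1 = b
  simp only [singlet_apply, Fin.prod_univ_two]
  fin_cases a <;> fin_cases b <;> cases P <;> simp [Pauli.mat, Pauli.anti, one_fin_two]

lemma star_singletsState : star (singletsState p) = singletsState p := by
  funext x
  rw [Pi.star_apply, singletsState, star_prod]
  exact Finset.prod_congr rfl fun a _ => congrFun star_singlet _

lemma pauliString_singletsState (P : Pauli) :
    ∃ c : ℂ, ‖c‖ = 1 ∧ pauliString (fun _ => P) *ᵥ singletsState p = c • singletsState p := by
  refine ⟨bsign (P.anti .X || P.anti .Z) ^ p, by simp, ?_⟩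
  funext x
  rw [mulVec, dotProduct, Pi.smul_apply, smul_eq_mul]
  simp only [pauliString, of_apply, singletsState, Fintype.prod_prod_type,
    ← Finset.prod_mul_distrib]
  rw [sum_prod_pairs fun a u => (∏ b, P.mat (x (a, b)) (u b)) * singlet u]
  simp only [pauli_pair_singlet P fun b => x (_, b), Finset.prod_mul_distrib, Finset.prod_const,
    Finset.card_univ, Fintype.card_fin]

lemma weight_singletsState : weight (singletsState p) = 1 := by
  have h : ((weight (singletsState p) : ℝ) : ℂ) = 1 := by
    rw [weight, Complex.ofReal_sum]
    have : ∀ x : Phys p → Fin 2, ((‖singletsState p x‖ ^ 2 : ℝ) : ℂ) =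
        ∏ a, singlet (fun b => x (a, b)) * singlet fun b => x (a, b) := fun x => by
      rw [Finset.prod_mul_distrib, Complex.ofReal_pow, ← Complex.conj_mul', starRingEnd_apply,
        ← Pi.star_apply, star_singletsState]
      rfl
    rw [Finset.sum_congr rfl fun x _ => this x, sum_prod_pairs fun _ u => singlet u * singlet u]
    simp [singlet_normalized]
  exact_mod_cast h

lemma sg_singletsState (a : Fin p) :
    sg (allQubits (Phys p)) (a, 0) (a, 1) (singletsState p) = singletsState p := by
  have hne : ((a, 0) : Phys p) ≠ (a, 1) := by simp
  have hx : ∀ y : Phys p → Fin 2, singletsState p y = singlet (y ∘ twoQubits _ _ hne) *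
      ∏ a' ∈ Finset.univ.erase a, singlet fun b => y (a', b) := fun y => by
    rw [singletsState, ← Finset.mul_prod_erase _ _ (Finset.mem_univ a)]
    congr 2
    funext b; fin_cases b <;> rfl
  rw [← singletProj_mulVec hne]
  funext x
  have hu : ∀ u, singletsState p (Function.extend (twoQubits _ _ hne) u x) = singlet u *
      ∏ a' ∈ Finset.univ.erase a, singlet fun b => x (a', b) := fun u => by
    rw [hx, extend_comp_self]
    congr 1
    refine Finset.prod_congr rfl fun a' ha' => ?_
    congr 1
    funext b
    rw [Function.extend_apply']
    rintro ⟨k, hk⟩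
    have : a = a' := by
      fin_cases k
      · exact congrArg Prod.fst hk
      · exact congrArg Prod.fst hk
    exact Finset.ne_of_mem_erase ha' this.symm
  rw [onQubits_mulVec, hx x]
  simp only [hu, singletProj, vecMulVec_apply, star_singlet, mul_assoc]
  rw [← Finset.mul_sum]
  simp only [← mul_assoc]
  rw [← Finset.sum_mul, singlet_normalized]
  ring

lemma pa_pa_singletsState {P : Pauli} (hP : P ≠ .I) (a : Fin p) :
    pa (allQubits (Phys p)) P (a, 0) (pa (allQubits _) P (a, 1) (singletsState p)) =
      -singletsState p := by
  rw [← sg_singletsState a, pa_pair_sg hP (by simp)]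

lemma frameMap_singletsState (P : Pauli) (conj : Bool) :
    ∃ c : ℂ, ‖c‖ = 1 ∧ frameMap P conj (singletsState p) = c • singletsState p := by
  rw [frameMap, star_singletsState, ite_self]
  exact pauliString_singletsState P

end Singlets

/-! ## Symmetries of the operations -/

section Symmetry

variable {ι : Type} [Fintype ι] [DecidableEq ι]

/-- Among the Pauli matrices only `Y` is not real, and its complex conjugate is `-Y`. -/
lemma star_pa (Q : Pauli) (i : ι) (ψ : QState ι) :
    star (pa (allQubits ι) Q i ψ) = bsign (decide (Q = .Y)) • pa (allQubits ι) Q i (star ψ) := by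
  funext x
  rw [Pi.star_apply, Pi.smul_apply, pa_apply, pa_apply, pauliOp_mulVec, pauliOp_mulVec]
  generalize x ((allQubits ι) i) = b
  simp only [Pi.star_apply, star_add, star_mul', smul_eq_mul, mul_add, ← mul_assoc]
  fin_cases b <;> cases Q <;> simp [Pauli.mat, one_fin_two]

/-- The sign by which a symmetry commutes with a Pauli matrix. -/
def frameSign (P : Pauli) (conj : Bool) (Q : Pauli) : Bool :=
  P.anti Q ^^ (conj && decide (Q = .Y))

lemma pauliString_const_pa (P Q : Pauli) (i : ι) (ψ : QState ι) :
    pauliString (fun _ => P) *ᵥ pa (allQubits ι) Q i ψ =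
      bsign (P.anti Q) • pa (allQubits ι) Q i (pauliString (fun _ => P) *ᵥ ψ) := by
  rw [pa_apply, mulVec_mulVec, pauliString_mul_pauliOp, smul_mulVec, ← mulVec_mulVec]
  rfl

lemma frameMap_pa (P : Pauli) (conj : Bool) (Q : Pauli) (i : ι) (ψ : QState ι) :
    frameMap P conj (pa (allQubits ι) Q i ψ) =
      bsign (frameSign P conj Q) • pa (allQubits ι) Q i (frameMap P conj ψ) := by
  cases conj with
  | false => simpa [frameMap, frameSign] using pauliString_const_pa P Q i ψ
  | true =>
    simp only [frameMap, if_pos, frameSign, Bool.true_and, bsign_xor, star_pa, mulVec_smul,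
      pauliString_const_pa, smul_smul]
    rw [mul_comm]

lemma frameMap_add (P : Pauli) (conj : Bool) (φ χ : QState ι) :
    frameMap P conj (φ + χ) = frameMap P conj φ + frameMap P conj χ := by
  cases conj <;> simp [frameMap, mulVec_add]

lemma frameMap_sub (P : Pauli) (conj : Bool) (φ χ : QState ι) :
    frameMap P conj (φ - χ) = frameMap P conj φ - frameMap P conj χ := by
  cases conj <;> simp [frameMap, mulVec_sub]

lemma frameMap_smul (P : Pauli) (conj : Bool) {c : ℂ} (hc : star c = c) (φ : QState ι) :
    frameMap P conj (c • φ) = c • frameMap P conj φ := by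
  cases conj <;> simp only [frameMap, if_pos, Bool.false_eq_true, if_false, star_smul, hc,
    mulVec_smul]

lemma frameMap_sg (P : Pauli) (conj : Bool) (i j : ι) (ψ : QState ι) :
    frameMap P conj (sg (allQubits ι) i j ψ) = sg (allQubits ι) i j (frameMap P conj ψ) := by
  simp only [sg_apply]
  rw [frameMap_smul _ _ (by simp)]
  simp only [frameMap_sub, frameMap_pa, map_smul, smul_smul, bsign_mul_self, one_smul]

lemma weight_star (ψ : QState ι) : weight (star ψ) = weight ψ := by
  simp [weight]

lemma weight_frameMap (P : Pauli) (conj : Bool) (ψ : QState ι) :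
    weight (frameMap P conj ψ) = weight ψ := by
  rw [frameMap, weight_mulVec_of_unitary
    (by rw [pauliString_conjTranspose, pauliString_mul_self])]
  cases conj
  · rfl
  · exact weight_star ψ

lemma frameMap_isSymmetry {n p : ℕ} {σ : Type} (S : Simulator n p σ) (P : Pauli) (conj : Bool) :
    S.IsSymmetry (frameMap P conj) where
  sub := frameMap_sub P conj
  pauli Q i ψ := ⟨_, norm_bsign _, frameMap_pa P conj Q i ψ⟩
  st _ i j _ _ _ ψ := frameMap_sg P conj i j ψ
  weight := weight_frameMap P conj

/-- A qubit without a label never takes part in a singlet/triplet measurement, so a Pauli matrix on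
it cannot be noticed. It will be applied to the partners of the reference qubits. -/
lemma pa_isSymmetry {n m p : ℕ} (q : Lab n m ↪ Phys p) (prep : Prog (Lab n m)) (P : Pauli)
    {z : Phys p} (hz : z ∉ Set.range q) :
    (machine q prep).IsSymmetry (pa (allQubits _) P z) where
  sub := map_sub _
  pauli Q i ψ := by
    by_cases h : z = i
    · subst h; exact ⟨_, norm_bsign _, pa_anti _ P Q z ψ⟩
    · exact ⟨1, norm_one, by rw [one_smul, pa_comm _ _ _ h]⟩
  st s i j h next hs ψ := by
    obtain ⟨hi, hj⟩ := move_st_range q prep hs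
    exact (sg_comm_pa P (by rintro rfl; exact hz hi) (by rintro rfl; exact hz hj) ψ).symm
  weight := weight_pa _ P z

lemma expect_pa_of_notMem {κ : Type} [Fintype κ] [DecidableEq κ] (e : κ ↪ ι) (B : QOp κ)
    (P : Pauli) {z : ι} (hz : z ∉ Set.range e) (ψ : QState ι) :
    expect (onQubits e B) (pa (allQubits ι) P z ψ) = expect (onQubits e B) ψ := by
  rw [pa_apply, expect_mulVec, pauliOp_conjTranspose, pauliOp,
    onQubits_comm _ e fun _ k h => hz ⟨k, h.symm⟩, Matrix.mul_assoc, ← pauliOp, pauliOp_mul_self,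
    Matrix.mul_one]

end Symmetry

end

noncomputable section

set_option linter.unusedSectionVars false

/-! ## Decomposition of the initial state into sectors -/

section Sectors

variable {ι : Type} [Fintype ι] [DecidableEq ι]

/-- The projection onto the eigenspace of `P` on `i` with the eigenvalue `bsign b`. -/
def eigen (P : Pauli) (i : ι) (b : Bool) : QState ι →ₗ[ℂ] QState ι :=
  (1 / 2 : ℂ) • (LinearMap.id + bsign b • pa (allQubits ι) P i)

lemma eigen_apply (P : Pauli) (i : ι) (b : Bool) (ψ : QState ι) :
    eigen P i b ψ = (1 / 2 : ℂ) • (ψ + bsign b • pa (allQubits ι) P i ψ) := rfl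

lemma pa_eigen (P : Pauli) (i : ι) (ψ : QState ι) :
    pa (allQubits ι) P i (eigen P i true ψ) = -eigen P i true ψ := by
  simp only [eigen_apply, map_smul, map_add, pa_self, bsign_true]
  module

lemma frameMap_eigen (P : Pauli) (conj : Bool) (Q : Pauli) (i : ι) (b : Bool) (ψ : QState ι) :
    frameMap P conj (eigen Q i b ψ) =
      eigen Q i (frameSign P conj Q ^^ b) (frameMap P conj ψ) := by
  rw [eigen_apply, eigen_apply, frameMap_smul _ _ (by simp), frameMap_add,
    frameMap_smul _ _ (by cases b <;> simp), frameMap_pa, smul_smul, bsign_xor, mul_comm (bsign b)]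

lemma eigen_comm {B : QState ι →ₗ[ℂ] QState ι} {P : Pauli} {i : ι}
    (h : ∀ ψ, B (pa (allQubits ι) P i ψ) = pa (allQubits ι) P i (B ψ)) (b : Bool)
    (ψ : QState ι) : B (eigen P i b ψ) = eigen P i b (B ψ) := by
  simp only [eigen_apply, map_smul, map_add, h]

/-- The joint eigenspaces of `P` on the qubit `z P` for the three Pauli matrices. -/
def sector (z : Pauli → ι) (b : Bool × Bool × Bool) : QState ι →ₗ[ℂ] QState ι :=
  eigen .X (z .X) b.1 ∘ₗ eigen .Y (z .Y) b.2.1 ∘ₗ eigen .Z (z .Z) b.2.2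

lemma sector_apply (z : Pauli → ι) (b : Bool × Bool × Bool) (ψ : QState ι) : sector z b ψ =
    eigen .X (z .X) b.1 (eigen .Y (z .Y) b.2.1 (eigen .Z (z .Z) b.2.2 ψ)) := rfl

lemma sector_comm {B : QState ι →ₗ[ℂ] QState ι} {z : Pauli → ι}
    (h : ∀ P ψ, B (pa (allQubits ι) P (z P) ψ) = pa (allQubits ι) P (z P) (B ψ))
    (b : Bool × Bool × Bool) (ψ : QState ι) : B (sector z b ψ) = sector z b (B ψ) := by
  simp only [sector_apply, eigen_comm (h _)]

variable {z : Pauli → ι}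

lemma pa_sector (hz : Function.Injective z) {P : Pauli} (hP : P ≠ .I) (ψ : QState ι) :
    pa (allQubits ι) P (z P) (sector z (true, true, true) ψ) =
      -sector z (true, true, true) ψ := by
  have h : ∀ R, R ≠ P → ∀ φ, pa (allQubits ι) P (z P) (pa (allQubits ι) R (z R) φ) =
      pa (allQubits ι) R (z R) (pa (allQubits ι) P (z P) φ) :=
    fun R hR φ => pa_comm _ _ _ (hz.ne hR.symm) φ
  simp only [sector_apply]
  cases P with
  | I => exact absurd rfl hP
  | X => exact pa_eigen _ _ _
  | Y => rw [eigen_comm (h .X (by simp)), pa_eigen, map_neg]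
  | Z => rw [eigen_comm (h .X (by simp)), eigen_comm (h .Y (by simp)), pa_eigen, map_neg, map_neg]

lemma frameMap_sector (P : Pauli) (conj : Bool) (b : Bool × Bool × Bool) (ψ : QState ι) :
    frameMap P conj (sector z b ψ) = sector z (frameSign P conj .X ^^ b.1,
      frameSign P conj .Y ^^ b.2.1, frameSign P conj .Z ^^ b.2.2) (frameMap P conj ψ) := by
  simp only [sector_apply, frameMap_eigen]

/-- A quadratic functional that is invariant under the Pauli matrices on the qubits `z P` is a sum
over the frames, if all frames leave the state invariant. -/
lemma eq_frameSum_sector {A : QState ι → ℝ} (hs : ∀ (c : ℂ) ψ, A (c • ψ) = ‖c‖ ^ 2 * A ψ)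
    (hp : ∀ φ χ, A (φ + χ) + A (φ - χ) = 2 * (A φ + A χ))
    (hA : ∀ P ψ, A (pa (allQubits ι) P (z P) ψ) = A ψ) {ψ : QState ι}
    (hψ : ∀ P conj, ∃ c : ℂ, ‖c‖ = 1 ∧ frameMap P conj ψ = c • ψ) :
    A ψ = frameSum fun P conj => A (frameMap P conj (sector z (true, true, true) ψ)) := by
  -- The parallelogram law for `φ` and its image under `P` has no cross term left, and invariance
  -- makes the two values on its right-hand side equal. The eigenspaces therefore contribute
  -- independently, as if the partner had been measured.
  have split : ∀ P φ, A φ = A (eigen P (z P) true φ) + A (eigen P (z P) false φ) := by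
    intro P φ
    have h := hp φ (pa (allQubits ι) P (z P) φ)
    simp only [eigen_apply, hs, bsign_true, bsign_false, one_smul, neg_smul, ← sub_eq_add_neg]
    rw [hA] at h
    norm_num
    linarith
  have key : ∀ P conj, A (frameMap P conj (sector z (true, true, true) ψ)) =
      A (sector z (!frameSign P conj .X, !frameSign P conj .Y, !frameSign P conj .Z) ψ) := by
    intro P conj
    obtain ⟨c, hc, h⟩ := hψ P conj
    rw [frameMap_sector, h, map_smul, hs, hc, one_pow, one_mul]
    simp only [Bool.xor_true]
  have h8 : A ψ = ∑ b₃ : Bool, ∑ b₂ : Bool, ∑ b₁ : Bool, A (sector z (b₁, b₂, b₃) ψ) := by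
    simp only [Fintype.sum_bool, sector_apply, ← split]
  rw [h8]
  -- The four Pauli frames change an even number of the three signs, and conjugation changes the
  -- sign of `Y` in addition. Hence the eight frames give each of the eight sign patterns exactly
  -- once.
  simp only [frameSum, key, Fintype.sum_bool]
  simp [frameSign, Pauli.anti]
  ring

end Sectors

/-! ## Placement of the labels on the physical qubits -/

section Placement

variable {n m : ℕ}

/-- The pair on which a label is placed. -/
def Lab.pair : Lab n m → Fin (n + m + 14)
  | .data i => ⟨i, by omega⟩
  | .y j => ⟨n + j, by omega⟩
  | .w => ⟨n + m, by omega⟩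
  | .x => ⟨n + m + 1, by omega⟩
  | .ref .I => ⟨n + m + 2, by omega⟩
  | .ref .X => ⟨n + m + 3, by omega⟩
  | .ref .Y => ⟨n + m + 4, by omega⟩
  | .ref .Z => ⟨n + m + 5, by omega⟩
  | .scr .I => ⟨n + m + 6, by omega⟩
  | .scr .X => ⟨n + m + 7, by omega⟩
  | .scr .Y => ⟨n + m + 8, by omega⟩
  | .scr .Z => ⟨n + m + 9, by omega⟩
  | .cat 0 => ⟨n + m + 10, by omega⟩
  | .cat 1 => ⟨n + m + 11, by omega⟩
  | .cat 2 => ⟨n + m + 10, by omega⟩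
  | .cat 3 => ⟨n + m + 11, by omega⟩

/-- The physical qubit on which a label is placed. -/
def Lab.place (v : Lab n m) : Phys (n + m + 14) :=
  (v.pair, match v with
    | .cat 2 => 1
    | .cat 3 => 1
    | _ => 0)

lemma Lab.place_injective : Function.Injective (Lab.place : Lab n m → _) := by
  intro a b h
  simp only [Lab.place, Prod.mk.injEq] at h
  obtain ⟨h1, h2⟩ := h
  have h1 := congrArg Fin.val h1
  rcases a with i | (_ | _ | _ | _) | (_ | _ | _ | _) | k | _ | _ | j <;>
    rcases b with i' | (_ | _ | _ | _) | (_ | _ | _ | _) | k' | _ | _ | j' <;>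
    (try fin_cases k) <;> (try fin_cases k') <;>
    simp [Lab.pair] at h1 h2 ⊢ <;> omega

variable (n m) in
/-- The placement of the labels. -/
def placement : Lab n m ↪ Phys (n + m + 14) := ⟨Lab.place, Lab.place_injective⟩

variable (n m) in
/-- The other qubit of the pair that contains the reference qubit for `P`. -/
def partner (P : Pauli) : Phys (n + m + 14) := ((Lab.ref P : Lab n m).pair, 1)

end Placement

end

noncomputable section

set_option linter.unusedSectionVars false

/-! ## The simulation from singlets -/

section Initial

variable (n m : ℕ)

/-- The component of the singlets in which the partners of the reference qubits are in their
`-1`-eigenstates. -/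
def startState : QState (Phys (n + m + 14)) :=
  sector (partner n m) (true, true, true) (singletsState _)

variable {n m}

lemma pair_ref_injective : Function.Injective fun P => (Lab.ref P : Lab n m).pair := by
  intro P Q h
  have h := congrArg Fin.val h
  cases P <;> cases Q <;> simp [Lab.pair] at h ⊢

lemma partner_injective : Function.Injective (partner n m) := fun _ _ h =>
  pair_ref_injective (congrArg Prod.fst h)

lemma partner_notMem (P : Pauli) : partner n m P ∉ Set.range (placement n m) := by
  rintro ⟨v, hv⟩
  have h1 : v.pair = (Lab.ref P : Lab n m).pair := congrArg Prod.fst hv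
  have h2 : v.place.2 = 1 := congrArg Prod.snd hv
  have h1 := congrArg Fin.val h1
  rcases v with i | (_ | _ | _ | _) | (_ | _ | _ | _) | k | _ | _ | j <;> (try fin_cases k) <;>
    cases P <;> simp [Lab.pair, Lab.place] at h1 h2

lemma sg_startState {a : Fin (n + m + 14)} (ha : ∀ P : Pauli, a ≠ (Lab.ref P : Lab n m).pair) :
    sg (allQubits _) (a, 0) (a, 1) (startState n m) = startState n m := by
  have hne : ∀ b P, ((a, b) : Phys _) ≠ partner n m P := fun b P h => ha P (congrArg Prod.fst h)
  rw [startState, sector_comm fun P φ => sg_comm_pa P (hne 0 P) (hne 1 P) φ, sg_singletsState]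

/-- A product `P ⊗ P` on a reference pair commutes with the matrix `R` on its partner's position
only if `R = P` there. This is why each Pauli matrix has a reference pair of its own. -/
lemma pa_pair_pa {ι : Type} [Fintype ι] [DecidableEq ι] {P R : Pauli} {i j k : ι} (hij : j ≠ i)
    (hik : i ≠ k) (hjk : j = k → R = P) (φ : QState ι) :
    (pa (allQubits ι) P i ∘ₗ pa (allQubits ι) P j) (pa (allQubits ι) R k φ) =
      pa (allQubits ι) R k ((pa (allQubits ι) P i ∘ₗ pa (allQubits ι) P j) φ) := by
  rw [LinearMap.comp_apply, LinearMap.comp_apply]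
  by_cases h : j = k
  · obtain rfl := hjk h
    subst h
    exact pa_comm _ _ _ hij.symm _
  · rw [pa_comm _ _ _ h, pa_comm _ _ _ hik]

/-- On a singlet, `P ⊗ P` has the eigenvalue -1. As the partner has the eigenvalue -1 of `P` in this
sector, the reference qubit has the eigenvalue 1. The pairs that hold the `cat` qubits are untouched
by the projection to the sector. -/
lemma startState_mem : startState n m ∈ refSpace (placement n m) := by
  refine ⟨⟨?_, ?_⟩, ?_⟩
  · refine sg_startState (a := (Lab.cat 0 : Lab n m).pair) fun P h => ?_
    have h := congrArg Fin.val h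
    cases P <;> simp [Lab.pair] at h
  · refine sg_startState (a := (Lab.cat 1 : Lab n m).pair) fun P h => ?_
    have h := congrArg Fin.val h
    cases P <;> simp [Lab.pair] at h
  · rw [SetLike.mem_coe, Submodule.mem_iInf]
    intro P
    by_cases hP : P = .I
    · subst hP; exact pa_I _ _ _
    set a := (Lab.ref P : Lab n m).pair with ha
    have hpl : placement n m (.ref P) = (a, 0) := rfl
    have h1 : pa (allQubits _) P (a, 0) (pa (allQubits _) P (a, 1) (startState n m)) =
        -startState n m := by
      have hB := fun R φ => pa_pair_pa (P := P) (R := R) (i := ((a, 0) : Phys (n + m + 14)))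
        (j := (a, 1)) (k := partner n m R) (by simp)
        (fun h => by simpa [partner] using congrArg Prod.snd h)
        (fun h => (pair_ref_injective (congrArg Prod.fst h)).symm) φ
      rw [← LinearMap.comp_apply, startState, sector_comm hB, ← map_neg, LinearMap.comp_apply,
        pa_pa_singletsState hP]
    have h2 : pa (allQubits _) P (a, 1) (startState n m) = -startState n m :=
      pa_sector partner_injective hP _
    rw [h2, map_neg] at h1
    exact neg_injective h1

/-- The eight sectors are images of each other under frames, which preserve weights, and their
weights add up to 1. -/
lemma weight_startState : weight (startState n m) = 1 / 8 := by
  have h := eq_frameSum_sector (z := partner n m) weight_smul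
    (fun φ χ => by linarith [weight_parallelogram φ χ])
    (fun P ψ => weight_pa _ _ _ _) (frameMap_singletsState (p := n + m + 14))
  simp only [weight_singletsState, weight_frameMap, frameSum, Fintype.sum_bool] at h
  rw [startState]
  linarith

lemma acceptLim_frameMap {p : ℕ} {σ : Type} (S : Simulator n p σ) (E : Test n) (P : Pauli)
    (conj : Bool) (next : Bool → Circuit n × List Bool) (s : σ) (ψ : QState (Phys p)) :
    S.acceptLim E next s (frameMap P conj ψ) = S.acceptLim (E.frame P conj) next s ψ :=
  (frameMap_isSymmetry S P conj).acceptLim (E' := E.frame P conj)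
    (fun s h ψ => expect_frameMap (S.loc s) P conj (E.effect h) ψ) next s ψ

/-- The simulator. -/
abbrev simulator (n m : ℕ) :
    Simulator n (n + m + 14) (Prog (Lab n m) × Stack (Lab n m)) :=
  machine (placement n m) (initProg n m)

/-- Frames do not change the number of operations, so the eight sectors contribute equally and the
factor 8 cancels the weight 1/8 of one sector. -/
lemma expectedOps_le (c : Circuit n) (K : ℕ) : (simulator n m).expectedOps c K ≤
    222 * (n + m + 5) + 25000 * c.depth + 320000 * 64 ^ m * c.tCount := by
  have h := eq_frameSum_sector (z := partner n m)
    (A := (simulator n m).opsFrom K (fun _ => c) (simulator n m).init)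
    (fun a ψ => Simulator.opsFrom_smul _ _ _ _ _ _)
    (fun φ χ => Simulator.opsFrom_parallelogram _ _ _ _ _ _)
    (fun P ψ => (pa_isSymmetry _ _ P (partner_notMem P)).opsFrom _ _ _ _)
    (frameMap_singletsState (p := n + m + 14))
  simp only [frameSum, (frameMap_isSymmetry (simulator n m) _ _).opsFrom, Fintype.sum_bool] at h
  have h1 := (opsVal (placement n m) (initProg n m) K fun _ => c).initProg_le (s := [])
    (β := 25000 * c.depth + 320000 * 64 ^ m * c.tCount)
    (fun φ hφ _ => (opsFrom_ret_le _ _ _ _ _ _).trans (circuitOps_le _ _ _ _ _ hφ))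
    startState_mem
  rw [weight_startState] at h1
  change (simulator n m).opsFrom K (fun _ => c) (simulator n m).init (startState n m) ≤ _ at h1
  rw [Simulator.expectedOps, h]
  change _ at h1
  rw [startState] at h1
  linarith

lemma comp_dataQubits_ne_zero {ι : Type} [Fintype ι] [DecidableEq ι] (q : Lab n m ↪ ι)
    {φ : QState ι} (h : ∀ d, pa q .Z (.data d) φ = φ) (x : ι → Fin 2)
    (hx : x ∘ (dataQubits n m).trans q ≠ 0) : φ x = 0 := by
  obtain ⟨d, hd⟩ := Function.ne_iff.1 hx
  exact eq_zero_of_pa_Z q (h d) hd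

/-- In this sector the preparation ends with all logical qubits in `|0⟩`, and the execution of the
circuit is compared with the perfect one in the identical frame. -/
lemma acceptLim_startState (E : Test n) (c : Circuit n) :
    |(simulator n m).acceptLim E (fun _ => (c, [])) (simulator n m).init (startState n m) -
      1 / 8 * liftAccept (allQubits (Fin n)) E c [] (zeroState n)| ≤
      1 / 8 * (c.tCount * errSin m ^ 2) := by
  set q := placement n m
  set r := liftAccept (allQubits (Fin n)) E c [] (zeroState n) with hr
  have key : ∀ φ ∈ restSpace q, (∀ d, pa q .Z (.data d) φ = φ) →
      |(simulator n m).acceptLim E (fun _ => (c, [])) (.ret false, []) φ - r * weight φ| ≤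
        c.tCount * errSin m ^ 2 * weight φ := by
    intro φ hφ hd
    have h := liftAccept_of_zero ((dataQubits n m).trans q) E (comp_dataQubits_ne_zero q hd) c [] 1
    rw [onQubits_one, one_mulVec, one_mulVec] at h
    rw [acceptLim_ret, hr, ← h]
    exact circuitLim_bounds q _ E c [] φ hφ
  have h1 := (acceptVal q (initProg n m) E fun _ => (c, [])).initProg_le (s := [])
    (β := r + c.tCount * errSin m ^ 2)
    (fun φ hφ hd => by
      change (simulator n m).acceptLim E (fun _ => (c, [])) (.ret false, []) φ ≤ _
      linarith [(abs_le.1 (key φ hφ hd)).2]) startState_mem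
  have h2 := (negAcceptVal q (initProg n m) E fun _ => (c, [])).initProg_le (s := [])
    (β := -r + c.tCount * errSin m ^ 2)
    (fun φ hφ hd => by
      change -(simulator n m).acceptLim E (fun _ => (c, [])) (.ret false, []) φ ≤ _
      linarith [(abs_le.1 (key φ hφ hd)).1]) startState_mem
  rw [weight_startState] at h1 h2
  change (simulator n m).acceptLim E (fun _ => (c, [])) (simulator n m).init _ ≤ _ at h1
  change -(simulator n m).acceptLim E (fun _ => (c, [])) (simulator n m).init _ ≤ _ at h2
  rw [abs_le]
  constructor <;> linarith

/-- Running from another sector is running from this one with the test moved to another frame.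
Summing the sector estimates over all eight tests reproduces the frame average of the perfect
circuit. -/
lemma accept_bound (E : Test n) (c : Circuit n) :
    |(simulator n m).acceptLim E (fun _ => (c, [])) (simulator n m).init (singletsState _) -
      c.idealAccept E| ≤ c.tCount * errSin m ^ 2 := by
  have h := eq_frameSum_sector (z := partner n m)
    (A := (simulator n m).acceptLim E (fun _ => (c, [])) (simulator n m).init)
    (fun a ψ => Simulator.acceptLim_smul _ _ _ _ _ _)
    (fun φ χ => Simulator.acceptLim_parallelogram _ _ _ _ _ _)
    (fun P ψ => (pa_isSymmetry _ _ P (partner_notMem P)).acceptLim (E' := E)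
      (fun s h ψ => expect_pa_of_notMem _ _ _ (by
        rintro ⟨d, hd⟩; exact partner_notMem P ⟨.data d, hd⟩) ψ) _ _ _)
    (frameMap_singletsState (p := n + m + 14))
  have hf : ∀ P conj ψ, (simulator n m).acceptLim E (fun _ => (c, [])) (simulator n m).init
      (frameMap P conj ψ) = (simulator n m).acceptLim (E.frame P conj) (fun _ => (c, []))
        (simulator n m).init ψ := fun P conj ψ =>
    acceptLim_frameMap _ E P conj _ _ ψ
  have hb : ∀ P conj, _ ≤ _ ∧ _ ≤ _ := fun P conj =>
    abs_le.1 (acceptLim_startState (m := m) (E.frame P conj) c)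
  rw [startState] at hb
  rw [h, Circuit.idealAccept, Circuit.accept_eq]
  simp only [frameSum, hf, Fintype.sum_bool]
  rw [abs_le]
  constructor <;>
  linarith [(hb .I true).1, (hb .X true).1, (hb .Y true).1, (hb .Z true).1, (hb .I false).1,
    (hb .X false).1, (hb .Y false).1, (hb .Z false).1, (hb .I true).2, (hb .X true).2,
    (hb .Y true).2, (hb .Z true).2, (hb .I false).2, (hb .X false).2, (hb .Y false).2,
    (hb .Z false).2]

end Initial

/-! ## The choice of the parameters -/

section Parameters

/-- Since `log 2 > 1 / 2`, any power `2 ^ m ≥ 2 * log (1 / δ)` is large enough, and the first such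
power is at most twice too large, up to rounding. -/
lemma exists_pow_two {δ : ℝ} (h0 : 0 < δ) (h1 : δ < 1) :
    ∃ m : ℕ, (1 / 2 : ℝ) ^ 2 ^ m ≤ δ ∧ (2 : ℝ) ^ m ≤ 4 * (1 + Real.log (1 / δ)) := by
  set l := Real.log (1 / δ) with hl
  have hl0 : 0 < l := Real.log_pos (by rw [lt_div_iff₀ h0]; linarith)
  set N := ⌈2 * l⌉₊ with hN
  have hN0 : N ≠ 0 := (Nat.ceil_pos.2 (by positivity)).ne'
  refine ⟨Nat.log 2 N + 1, ?_, ?_⟩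
  · have h2 : (N : ℝ) ≤ ((2 ^ (Nat.log 2 N + 1) : ℕ) : ℝ) :=
      Nat.cast_le.2 (Nat.lt_pow_succ_log_self one_lt_two N).le
    have h3 : 2 * l ≤ N := Nat.le_ceil _
    rw [← Real.log_le_log_iff (by positivity) h0, Real.log_pow, one_div, Real.log_inv]
    have h4 : Real.log δ = -l := by rw [hl, one_div, Real.log_inv, neg_neg]
    have h5 := Real.log_two_gt_d9
    rw [h4]
    nlinarith
  · have h2 : ((2 ^ Nat.log 2 N : ℕ) : ℝ) ≤ N := Nat.cast_le.2 (Nat.pow_log_le_self 2 hN0)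
    have h3 : (N : ℝ) < 2 * l + 1 := Nat.ceil_lt_add_one (by positivity)
    push_cast at h2
    rw [pow_succ]
    linarith

/-- The cost is `64 ^ m = (2 ^ m) ^ 6`, whence the exponent 6. Without `T` gates the bound leaves no
room for ancillas depending on `δ`, and `m = 0` is taken. -/
lemma exists_parameter (t : ℕ) {δ : ℝ} (h0 : 0 < δ) (h1 : δ < 1) :
    ∃ m : ℕ, (t ≠ 0 → (1 / 2 : ℝ) ^ 2 ^ m ≤ δ) ∧
      (m : ℝ) ≤ 4 * (t * (1 + Real.log (1 / δ)) ^ 6) ∧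
      64 ^ m * (t : ℝ) ≤ 4096 * (t * (1 + Real.log (1 / δ)) ^ 6) := by
  rcases Nat.eq_zero_or_pos t with rfl | ht
  · exact ⟨0, by simp⟩
  obtain ⟨m, hm, hm'⟩ := exists_pow_two h0 h1
  have hl0 : 0 < Real.log (1 / δ) := Real.log_pos (by rw [lt_div_iff₀ h0]; linarith)
  set x := 1 + Real.log (1 / δ) with hx
  have hx1 : 1 ≤ x := by linarith
  have ht1 : (1 : ℝ) ≤ t := Nat.one_le_cast.2 ht
  refine ⟨m, fun _ => hm, ?_, ?_⟩
  · have e1 : (m : ℝ) ≤ 2 ^ m := by exact_mod_cast (Nat.lt_two_pow_self (n := m)).le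
    have e2 : x ≤ x ^ 6 := le_self_pow₀ hx1 (by norm_num)
    have e3 : x ^ 6 ≤ t * x ^ 6 := le_mul_of_one_le_left (by positivity) ht1
    linarith
  · have e : (64 : ℝ) ^ m = (2 ^ m) ^ 6 := by rw [← pow_mul, mul_comm, pow_mul]; norm_num
    have e1 : ((2 : ℝ) ^ m) ^ 6 ≤ (4 * x) ^ 6 := pow_le_pow_left₀ (by positivity) hm' 6
    have e2 : (4 * x) ^ 6 = 4096 * x ^ 6 := by ring
    rw [e]
    calc ((2 : ℝ) ^ m) ^ 6 * t ≤ (4096 * x ^ 6) * t := by rw [← e2]; gcongr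
      _ = _ := by ring

end Parameters

/-! ### The degenerate case without qubits and instructions -/

section Trivial

/-- The simulator without any qubits. -/
def trivialSimulator : Simulator 0 0 Unit where
  init := ()
  load _ _ := ()
  move _ := .done false ()
  loc _ := Function.Embedding.ofIsEmpty

lemma trivialSimulator_opsFrom (K : ℕ) :
    trivialSimulator.opsFrom K (fun _ => .halt) () (singletsState 0) = 0 := by
  cases K <;> rfl

/-- On zero qubits the Pauli strings are the identity and conjugation does not change the real part
of the single matrix entry, so all frames agree. -/
lemma trivialSimulator_acceptFrom (E : Test 0) (K : ℕ) :
    trivialSimulator.acceptFrom E (K + 1) (fun _ => (.halt, [])) () (singletsState 0) =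
      Circuit.idealAccept .halt E := by
  have h : ∀ P conj, frameOp P conj (E.effect []) 0 0 = E.effect [] 0 0 ∨
      frameOp P conj (E.effect []) 0 0 = star (E.effect [] 0 0) := by
    intro P conj
    have hp : pauliString (fun _ : Fin 0 => P) = 1 := by
      ext x y; rw [Subsingleton.elim x y]; simp [pauliString]
    cases conj <;> simp [frameOp, hp]
  have hr : ∀ P conj, (frameOp P conj (E.effect []) 0 0).re = (E.effect [] 0 0).re := by
    intro P conj
    rcases h P conj with h | h <;> rw [h]
    exact Complex.conj_re _
  change expect (onQubits (trivialSimulator.loc ()) (E.effect [])) (singletsState 0) = _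
  rw [expect_onQubits_of_zero _ _ fun x hx => absurd (Subsingleton.elim _ _) hx,
    weight_singletsState, Circuit.idealAccept, Circuit.accept_eq]
  have hq : ∀ P conj, liftAccept (allQubits (Fin 0)) (E.frame P conj) .halt [] (zeroState 0) =
      (E.effect [] 0 0).re := fun P conj => by
    rw [liftAccept, expect_onQubits_of_zero _ _ fun x => zeroState_of_ne, weight_zeroState,
      one_mul]
    exact hr P conj
  simp only [frameSum, hq, Fintype.sum_bool]
  ring

end Trivial

theorem mainTheorem2 :
    ∃ C k : ℕ, ∀ (n L t : ℕ) (δ : ℝ), 0 < δ → δ < 1 →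
      ∃ (p : ℕ) (σ : Type) (S : Simulator n p σ),
        (p : ℝ) ≤ C * (n + L + t * (1 + Real.log (1 / δ)) ^ k) ∧
        ∀ c : Circuit n, c.depth ≤ L → c.tCount ≤ t →
          (∀ K : ℕ, S.expectedOps c K ≤ C * (n + L + t * (1 + Real.log (1 / δ)) ^ k)) ∧
          ∀ E : Test n, ∃ q : ℝ,
            Tendsto (fun K => S.accept c E K) atTop (𝓝 q) ∧
            |q - c.idealAccept E| ≤ c.tCount * δ := by
  -- The constant is dominated by `320000 * 4096`, the cost of the `T` gates.
  refine ⟨2000000000, 6, fun n L t δ h0 h1 => ?_⟩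
  -- In this case the bound is zero and not even the fixed ancillas are allowed.
  by_cases h : n = 0 ∧ L = 0 ∧ t = 0
  · obtain ⟨rfl, rfl, rfl⟩ := h
    refine ⟨0, Unit, trivialSimulator, by simp, fun c hc ht => ?_⟩
    cases c with
    | step g next => rw [Circuit.depth] at hc; omega
    | halt =>
      refine ⟨fun K => ?_, fun E => ⟨Circuit.idealAccept .halt E, ?_, ?_⟩⟩
      · rw [Simulator.expectedOps]
        exact (trivialSimulator_opsFrom K).trans_le (by simp)
      · refine (tendsto_add_atTop_iff_nat 1).1 ?_
        exact tendsto_const_nhds.congr fun K => (trivialSimulator_acceptFrom E K).symm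
      · simp [Circuit.tCount]
  obtain ⟨m, hm, hm1, hm2⟩ := exists_parameter t h0 h1
  have hl0 : 0 < Real.log (1 / δ) := Real.log_pos (by rw [lt_div_iff₀ h0]; linarith)
  have hT : (t : ℝ) ≤ t * (1 + Real.log (1 / δ)) ^ 6 :=
    le_mul_of_one_le_right (Nat.cast_nonneg t) (one_le_pow₀ (by linarith))
  set T := t * (1 + Real.log (1 / δ)) ^ 6 with hT'
  have h3 : (1 : ℝ) ≤ n + L + T := by
    -- Otherwise the sum is at least 1 and absorbs the 14 fixed pairs and the constant cost of the
    -- preparation.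
    have : 1 ≤ n + L + t := by omega
    have : (1 : ℝ) ≤ n + L + t := by exact_mod_cast this
    linarith
  have hn : (0 : ℝ) ≤ n := Nat.cast_nonneg n
  have hL : (0 : ℝ) ≤ L := Nat.cast_nonneg L
  have ht0 : (0 : ℝ) ≤ t := Nat.cast_nonneg t
  refine ⟨n + m + 14, _, simulator n m, ?_, fun c hc ht => ⟨fun K => ?_, fun E =>
    ⟨_, Simulator.tendsto_acceptFrom _ _ _ _ _, (accept_bound E c).trans ?_⟩⟩⟩
  · push_cast; linarith
  · have e1 : (c.depth : ℝ) ≤ L := Nat.cast_le.2 hc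
    have e2 : 64 ^ m * (c.tCount : ℝ) ≤ 64 ^ m * t := by
      have : (c.tCount : ℝ) ≤ t := Nat.cast_le.2 ht
      gcongr
    have := expectedOps_le (m := m) c K
    push_cast
    linarith
  · rcases Nat.eq_zero_or_pos c.tCount with hc0 | hc0
    · rw [hc0]; simp
    · have := (errSin_sq_le m).trans (hm (by omega))
      gcongr

end
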